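/- Let $\mathbb H=\{\operatorname{Im}\tau>0\}$, and put $\vartheta_2(\tau)=\sum_{n\in\mathbb Z}e^{\pi i(n+1/2)^2\tau}$, $\vartheta_3(\tau)=\sum_{n\in\mathbb Z}e^{\pi i n^2\tau}$, $\vartheta_4(\tau)=\sum_{n\in\mathbb Z}(-1)^ne^{\pi i n^2\tau}$, $\eta(\tau)=e^{\pi i\tau/12}\prod_{k\ge1}(1-e^{2\pi ik\tau})$. The function $\vartheta_3$ has no zeros in $\mathbb H$; define on $\mathbb H$ $$x=z=\frac{\vartheta_4(\tau)}{\vartheta_3(\tau)},\qquad y=4i\,\frac{\eta^3(2\tau)}{\vartheta_3^3(\tau)},\qquad w=\frac{\vartheta_2(\tau)}{\vartheta_3(\tau)}.$$ Let $\chi(\tau)=\dfrac{\wp(1)-\wp(2)}{\wp(\tau)-\wp(2)}$ be Burnside's function, where $\wp$ has the half-periods $2,2\tau$ (periods $4,4\tau$). For a function $f$ on $\mathbb H$ let $\mathrm{Aut}(f)$ be the group of all $g\in \mathrm{SL}_2(\mathbb R)$ (acting by Möbius transformations) with $f\circ g=f$; let $\{f,\tau\}=\frac{f'''}{f'}-\frac32\bigl(\frac{f''}{f'}\bigr)^2$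 and $[f,\tau]=\{f,\tau\}/f'^2$; and let $\pm\Gamma(4)\subset \mathrm{SL}_2(\mathbb R)$ be the group of the matrices $\pm\gamma$, where $\gamma\in \mathrm{SL}_2(\mathbb Z)$ and $\gamma\equiv 1 \pmod 4$. Then the following hold. 1. $\chi(\tau)=-x(\tau/2)$ for all $\tau\in\mathbb H$; that is, $x$ is Burnside's function after the change $(x,\tau)\mapsto(-x,2\tau)$. 2. (Uniformization of both curves.) The functions $x,y,z,w$ are holomorphic on $\mathbb H$. The map $\tau\mapsto(x,y)$ is an immersion of $\mathbb H$ onto $\{(x,y)\in\mathbb C^2: y^2=x^5-x,\ y\ne0\}$, and two points of $\mathbb H$ have the same image if and only if they are equivalent under $\mathrm{Aut}(x)\cap\mathrm{Aut}(y)$. The map $\tau\mapsto(z,w)$ is an immersion of $\mathbb H$ onto $\{(z,w)\in\mathbb C^2: z^4+w^4=1,\ zw\neq0\}$, and two points have the same image if and only if they are equivalent under $\mathrm{Aut}(z)\cap\mathrm{Aut}(w)$. 3. (Differential equations.) The derivatives of $x$, $z$ and $w$ have no zeros on $\mathbb H$, and each of the three functions $u=x,z,w$ satisfies $$[u,\tau]=Q_1(u):=-\frac12\,\frac{u^8+14u^4+1}{u^2(u^4-1)^2}.$$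 At all $\tau\in\mathbb H$ with $y^8\ne 2^85^{-5}$, one has $y'\neq0$ and $[y,\tau]=Q_2(x,y):=-\dfrac12\,\dfrac{N(x,y)}{y^2\,(y^8-2^85^{-5})^2}$, where $$\begin{aligned}N={}&y^{16}-\tfrac{192}{5^3}xy^{14}+\tfrac{576}{5^4}x^2y^{12}+\tfrac{1536}{5^5}x^3y^{10}-\tfrac{6144}{5^5}x^4y^8+\tfrac{46592}{5^6}y^8\\&-\tfrac{196608}{5^8}xy^6+\tfrac{344064}{5^9}x^2y^4-\tfrac{393216}{5^{10}}x^3y^2+\tfrac{2^{16}}{5^{10}}.\end{aligned}$$ 4. (Automorphism groups.) $\mathrm{Aut}(\chi)=\pm\Gamma(4)$. The groups of $x,z,w$ are the following conjugates of it in $\mathrm{SL}_2(\mathbb R)$: $\mathrm{Aut}(x)=\mathrm{Aut}(z)=\delta^{-1}(\pm\Gamma(4))\,\delta$ and $\mathrm{Aut}(w)=(\delta S)^{-1}(\pm\Gamma(4))\,\delta S$, where $\delta$ and $S$ are the transformations $\tau\mapsto2\tau$ and $\tau\mapsto-1/\tau$. 5. (Solutions of the Fuchsian equation.) Let $$K(k)=\int_0^1\!\frac{d\lambda}{\sqrt{1-\lambda^2}\sqrt{1-k^2\lambda^2}},\qquad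 K'(k)=\int_0^1\!\frac{d\lambda}{\sqrt{1-\lambda^2}\sqrt{1-(1-k^2)\lambda^2}}$$ with principal square roots, let $\sqrt{i/\pi}$ be the principal root, and let $U=\{x\in\mathbb C: x^4\notin(-\infty,0]\cup[1,\infty)\}$. On every open set $V\subset U$ with a holomorphic branch of $\sqrt{x^5-x}$, the functions $$\Psi_1(x)=\sqrt{\tfrac i\pi}\,\sqrt{x^5-x}\;K'(x^2),\qquad \Psi_2(x)=i\sqrt{\tfrac i\pi}\,\sqrt{x^5-x}\;K(x^2)$$ are holomorphic solutions of $\Psi_{xx}=\tfrac12Q_1(x)\Psi$, with Wronskian $\Psi_1\Psi_2'-\Psi_1'\Psi_2=1$. Moreover, they continue analytically along $x=x(\tau)$ to all of $\mathbb H$, with the normalization $\Psi_1^2=\frac{d}{d\tau}\frac{\vartheta_4(\tau)}{\vartheta_3(\tau)}$ and the ratio $\Psi_2/\Psi_1=\tau$. Precisely, there are holomorphic functions $P_1,P_2$ on $\mathbb H$ that satisfy $P_1^2=dx/d\tau$, $P_2=\tau P_1$ and $\frac{d^2P_j}{dx^2}=\frac12Q_1(x)P_j$ (where $\frac{d}{dx}=\frac1{x'(\tau)}\frac{d}{d\tau}$)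 on $\mathbb H$, and such that for all $\tau$ with $|\operatorname{Re}\tau|<1$ and $|\tau\pm\frac12|>\frac12$ one has $x(\tau)\in U$, $P_1(\tau)=\sqrt{i/\pi}\;y(\tau)\,K'(x(\tau)^2)$ and $P_2(\tau)=i\sqrt{i/\pi}\;y(\tau)\,K(x(\tau)^2)$, with $y(\tau)$ as the branch of $\sqrt{x^5-x}$. -/

import Mathlib

open Complex
open scoped UpperHalfPlane MatrixGroups Real

noncomputable section

namespace ThetaUnif

/-! ### Theta constants, the eta function, and the uniformizing functions -/

/-- `ϑ₂(τ) = ∑ₙ exp(π i (n + 1/2)² τ) = 2 e^{π i τ / 4} ∑_{k ≥ 0} e^{(k² + k) π i τ}`. -/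
def theta2 (τ : ℂ) : ℂ := cexp (π * I * τ / 4) * jacobiTheta₂ (τ / 2) τ

/-- `ϑ₃(τ) = ∑ₙ exp(π i n² τ)`. -/
def theta3 (τ : ℂ) : ℂ := jacobiTheta τ

/-- `ϑ₄(τ) = ∑ₙ (-1)ⁿ exp(π i n² τ)`. -/
def theta4 (τ : ℂ) : ℂ := jacobiTheta₂ (1 / 2) τ

/-- The function `x = z = ϑ₄ / ϑ₃`. -/
def xFun (τ : ℂ) : ℂ := theta4 τ / theta3 τ

/-- The function `y = 4 i η³(2τ) / ϑ₃³(τ)`. -/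
def yFun (τ : ℂ) : ℂ := 4 * I * ModularForm.eta (2 * τ) ^ 3 / theta3 τ ^ 3

/-- The function `w = ϑ₂ / ϑ₃`. -/
def wFun (τ : ℂ) : ℂ := theta2 τ / theta3 τ

/-! ### Burnside's function -/

theorem indep_four_four_mul (τ : ℍ) : LinearIndependent ℝ ![(4 : ℂ), 4 * (τ : ℂ)] := by
  rw [LinearIndependent.pair_iff]
  intro s t h
  have him := congrArg Complex.im h
  have hre := congrArg Complex.re h
  simp at him hre
  have ht : t = 0 := him.resolve_right τ.im_pos.ne'
  subst ht
  simpa using hre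

/-- The periods `4, 4τ`, that is, the half-periods `2, 2τ`. -/
def burnsidePeriods (τ : ℍ) : PeriodPair where
  ω₁ := 4
  ω₂ := 4 * (τ : ℂ)
  indep := indep_four_four_mul τ

/-- Burnside's function
`χ(τ) = (℘(1) - ℘(2)) / (℘(τ) - ℘(2))`, where `℘` has the half-periods `2, 2τ`. -/
def burnsideChi (τ : ℍ) : ℂ :=
  ((burnsidePeriods τ).weierstrassP 1 - (burnsidePeriods τ).weierstrassP 2) /
    ((burnsidePeriods τ).weierstrassP τ - (burnsidePeriods τ).weierstrassP 2)

/-! ### Automorphism groups and uniformization -/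

/-- The group of all Möbius automorphisms of the upper half-plane (as matrices of determinant one)
that leave the function `f` invariant. -/
def autGroup (f : ℍ → ℂ) : Subgroup SL(2, ℝ) where
  carrier := {g | ∀ τ : ℍ, f (g • τ) = f τ}
  one_mem' := by intro τ; simp
  mul_mem' := by
    intro a b ha hb τ
    rw [mul_smul, ha, hb]
  inv_mem' := by
    intro a ha τ
    have h := ha (a⁻¹ • τ)
    rw [smul_inv_smul] at h
    exact h.symm

/-- `Γ(4)` as a group of Möbius transformations: the matrices `± γ` with `γ ∈ SL(2, ℤ)` congruent
to the identity modulo `4`, inside `SL(2, ℝ)`. -/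
def gammaFour : Subgroup SL(2, ℝ) :=
  (CongruenceSubgroup.Gamma 4 ⊔ Subgroup.zpowers (-1)).map
    (Matrix.SpecialLinearGroup.map (Int.castRingHom ℝ))

/-- The matrix of the Möbius transformation `τ ↦ 2τ`, normalized to determinant one. -/
def dilation : SL(2, ℝ) :=
  ⟨!![√2, 0; 0, (√2)⁻¹], by simp [Matrix.det_fin_two_of]⟩

/-- The matrix of the Möbius transformation `τ ↦ -1/τ`. -/
def inversion : SL(2, ℝ) :=
  ⟨!![0, -1; 1, 0], by simp [Matrix.det_fin_two_of]⟩

/-- The conjugate `h⁻¹ Γ h` of a subgroup. -/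
def conjBy (h : SL(2, ℝ)) (Γ : Subgroup SL(2, ℝ)) : Subgroup SL(2, ℝ) :=
  Γ.map (MulAut.conj h⁻¹).toMonoidHom

/-- The pair `(f, g)` of holomorphic functions on the upper half-plane uniformizes the (punctured)
curve `C`: the map `τ ↦ (f τ, g τ)` is an immersion with image `C`, and it identifies exactly those
points that are equivalent under the group `autGroup f ⊓ autGroup g`. -/
structure Uniformizes (f g : ℂ → ℂ) (C : Set (ℂ × ℂ)) : Prop where
  holo_fst : DifferentiableOn ℂ f UpperHalfPlane.upperHalfPlaneSet
  holo_snd : DifferentiableOn ℂ g UpperHalfPlane.upperHalfPlaneSet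
  immersion : ∀ τ : ℍ, deriv f τ ≠ 0 ∨ deriv g τ ≠ 0
  range_eq : Set.range (fun τ : ℍ => (f τ, g τ)) = C
  fibers : ∀ τ τ' : ℍ, (f τ = f τ' ∧ g τ = g τ') ↔
    ∃ γ ∈ autGroup (fun t : ℍ => f t) ⊓ autGroup (fun t : ℍ => g t), γ • τ = τ'

/-- The affine curve `y² = x⁵ - x` without its branch points `x ∈ {0, ±1, ±i}`. -/
def burnsideCurve : Set (ℂ × ℂ) := {p | p.2 ^ 2 = p.1 ^ 5 - p.1 ∧ p.2 ≠ 0}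

/-- The affine curve `z⁴ + w⁴ = 1` without the points where `z` or `w` vanishes. -/
def jacobiCurve : Set (ℂ × ℂ) := {p | p.1 ^ 4 + p.2 ^ 4 = 1 ∧ p.1 ≠ 0 ∧ p.2 ≠ 0}

/-! ### The meromorphic derivative and the Fuchsian equations -/

/-- The Schwarzian derivative `{f, τ} = f''' / f' - (3/2) (f'' / f')²`. -/
def schwarzian (f : ℂ → ℂ) (τ : ℂ) : ℂ :=
  iteratedDeriv 3 f τ / deriv f τ - 3 / 2 * (iteratedDeriv 2 f τ / deriv f τ) ^ 2

/-- The meromorphic derivative `[f, τ] = {f, τ} / f'²`. -/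
def meroDeriv (f : ℂ → ℂ) (τ : ℂ) : ℂ := schwarzian f τ / deriv f τ ^ 2

/-- The right-hand side `Q₁` of the equation of the functions `x, z, w`. -/
def Q1 (x : ℂ) : ℂ := -(1 / 2) * ((x ^ 8 + 14 * x ^ 4 + 1) / (x ^ 2 * (x ^ 4 - 1) ^ 2))

/-- The right-hand side `Q₂` of the equation of the function `y`, as a rational function on the
curve `y² = x⁵ - x`. -/
def Q2 (x y : ℂ) : ℂ :=
  -(1 / 2) *
    ((y ^ 16 - 192 / 5 ^ 3 * x * y ^ 14 + 576 / 5 ^ 4 * x ^ 2 * y ^ 12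
      + 1536 / 5 ^ 5 * x ^ 3 * y ^ 10 - 6144 / 5 ^ 5 * x ^ 4 * y ^ 8 + 46592 / 5 ^ 6 * y ^ 8
      - 196608 / 5 ^ 8 * x * y ^ 6 + 344064 / 5 ^ 9 * x ^ 2 * y ^ 4
      - 393216 / 5 ^ 10 * x ^ 3 * y ^ 2 + 2 ^ 16 / 5 ^ 10) /
    (y ^ 2 * (y ^ 8 - 2 ^ 8 / 5 ^ 5) ^ 2))

/-- `Ψ` is a holomorphic solution on `V` of the Fuchsian equation `Ψ'' = (1/2) Q₁(x) Ψ`. -/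
def IsFuchsianSolution (V : Set ℂ) (Ψ : ℂ → ℂ) : Prop :=
  DifferentiableOn ℂ Ψ V ∧ ∀ x ∈ V, deriv (deriv Ψ) x = 1 / 2 * Q1 x * Ψ x

/-- Differentiation with respect to the variable `x = xFun τ`: `dP/dx = P'(τ) / x'(τ)`. -/
def derivX (P : ℂ → ℂ) (τ : ℂ) : ℂ := deriv P τ / deriv xFun τ

/-! ### Complete elliptic integrals -/

/-- The complete elliptic integral
`K(k) = ∫₀¹ dλ / √((1 - λ²)(1 - k²λ²))`, principal branch (`k² ∉ [1, ∞)`). -/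
def ellK (k : ℂ) : ℂ :=
  ∫ t in (0 : ℝ)..1, 1 / ((√(1 - t ^ 2) : ℝ) * (1 - k ^ 2 * t ^ 2) ^ (1 / 2 : ℂ))

/-- The complementary integral
`K'(k) = ∫₀¹ dλ / √((1 - λ²)(1 - (1 - k²)λ²))`, principal branch (`k² ∉ (-∞, 0]`). -/
def ellK' (k : ℂ) : ℂ :=
  ∫ t in (0 : ℝ)..1, 1 / ((√(1 - t ^ 2) : ℝ) * (1 - (1 - k ^ 2) * t ^ 2) ^ (1 / 2 : ℂ))

/-- The points `x` such that `x⁴` is not a real number `≤ 0` or `≥ 1`: the domain on which the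
principal branches of both `K(x²)` and `K'(x²)` are holomorphic. -/
def principalDomain : Set ℂ := {x | ¬ ∃ r : ℝ, (r ≤ 0 ∨ 1 ≤ r) ∧ x ^ 4 = r}

/-- The open fundamental domain `|Re τ| < 1`, `|τ ± 1/2| > 1/2` of `Γ(2)`. -/
def gammaTwoDomain : Set ℍ :=
  {τ | |τ.re| < 1 ∧ 1 / 2 < ‖(τ : ℂ) - 1 / 2‖ ∧ 1 / 2 < ‖(τ : ℂ) + 1 / 2‖}

/-- The constant `√(i/π)` (principal root). -/
def sqrtIDivPi : ℂ := (I / π) ^ (1 / 2 : ℂ)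

end ThetaUnif

end

open ThetaUnif

/-! The whole argument rests on the theta constants. Splitting a double theta series by parity gives
the product formula `jacobiTheta₂_mul_jacobiTheta₂`, hence the duplication formulas and Jacobi's
identity; the relation `θ₃(τ)θ₄(τ) = θ₄(2τ)²` also shows that the theta constants have no zeros.
Identities between modular objects, such as `(θ₂θ₃θ₄)² = 4η⁶` and `x' = (πi/4) y² θ₃⁴`, are proved
by forming the quotient: it is invariant under `τ ↦ τ + 1` and `τ ↦ -1/τ` and has a limit at `i∞`,
so it is constant (`eq_of_modular_invariant`).

Burnside's function is identified through theta functions of degree two. Such a function is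
determined by its values at `0` and `1/2`, so `(℘(4v) - ℘(2)) θ₁(v)²` is a multiple of `θ₂(v)²`, and
evaluation at division points gives both `χ(τ) = -x(τ/2)` and the half-period values in terms of
`x²`. If `x⁴` agrees at two points, the half-period values are therefore proportional, the
invariants `g₂, g₃` scale accordingly, and the lattices are homothetic with matching half-periods:
the points are `Γ(2)`-equivalent. Four representatives of `Γ(2)` modulo `±Γ(4)` are told apart by
`u, 1/u, -u, -1/u` with `u = x(τ/2)`, which gives the fibres of `χ`. A real matrix that preserves
`χ` acts at each point of the imaginary axis like an element of the countable group `±Γ(4)`, hence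
like the same element at two points, and so lies in `±Γ(4)`. Surjectivity onto the curves comes from
the `j`-invariant written in `x⁴`, followed by the rotations of `x` and `w` by powers of `i`.

The differential equations come from elliptic integrals. Along the imaginary axis `θ₃²` and `θ₄²`
follow the arithmetic-geometric mean under `τ ↦ 2τ`, so Gauss's invariant integral yields `K'(x²) =
(π/2) θ₃²` there, and by inversion `K(x²) = -iτ (π/2) θ₃²`; the identity theorem spreads this. The
hypergeometric equation of `K`, multiplied by the gauge factor `√(x⁵ - x)`, becomes `Ψ'' = (1/2) Q₁
Ψ`, and `P₁ = y √(i/π) (π/2) θ₃²` satisfies `P₁² = x'`, which is what gives the Schwarzian equations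
for `x`, `w` and `y` (`exists_fuchsian_of_period`, `meroDeriv_eq`). The Wronskian is Legendre's
relation. The principal branches are valid on the fundamental domain of `Γ(2)` because `x⁴` takes
every value `r > 1` on the line `Re τ = 1`, whose `Γ(2)`-images miss that domain; the negative
values follow by inversion. -/

namespace ThetaUnif

open Filter Topology

/-! ### Re-indexing identities for the Jacobi theta function -/

/-- The lattice points `(m, n)`, split according to the parity of `m + n`. -/
noncomputable def paritySplit : (ℤ × ℤ) ⊕ (ℤ × ℤ) ≃ ℤ × ℤ :=
  Equiv.ofBijective
    (Sum.elim (fun p => (p.1 + p.2, p.1 - p.2)) (fun p => (p.1 + p.2 + 1, p.1 - p.2))) <| by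
    constructor
    · rintro (⟨a, b⟩ | ⟨a, b⟩) (⟨c, d⟩ | ⟨c, d⟩) h <;> simp at h ⊢ <;> omega
    · rintro ⟨m, n⟩
      rcases Int.emod_two_eq_zero_or_one (m + n) with h | h
      · exact ⟨.inl ((m + n) / 2, (m - n) / 2), by simp; omega⟩
      · exact ⟨.inr ((m + n - 1) / 2, (m - n - 1) / 2), by simp; omega⟩

/-- The integers, split according to parity. -/
noncomputable def intParitySplit : ℤ ⊕ ℤ ≃ ℤ :=
  Equiv.ofBijective (Sum.elim (fun a => 2 * a) (fun a => 2 * a + 1)) <| by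
    constructor
    · rintro (a | a) (c | c) h <;> simp at h ⊢ <;> omega
    · intro m
      rcases Int.emod_two_eq_zero_or_one m with h | h
      · exact ⟨.inl (m / 2), by simp; omega⟩
      · exact ⟨.inr (m / 2), by simp; omega⟩

theorem paritySplit_inl (p : ℤ × ℤ) : paritySplit (.inl p) = (p.1 + p.2, p.1 - p.2) := rfl

theorem paritySplit_inr (p : ℤ × ℤ) : paritySplit (.inr p) = (p.1 + p.2 + 1, p.1 - p.2) := rfl

theorem intParitySplit_inl (a : ℤ) : intParitySplit (.inl a) = 2 * a := rfl

theorem intParitySplit_inr (a : ℤ) : intParitySplit (.inr a) = 2 * a + 1 := rfl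

theorem hasSum_jacobiTheta₂_mul (z u : ℂ) {τ τ' : ℂ} (hτ : 0 < τ.im) (hτ' : 0 < τ'.im) :
    HasSum (fun p : ℤ × ℤ => jacobiTheta₂_term p.1 z τ * jacobiTheta₂_term p.2 u τ')
      (jacobiTheta₂ z τ * jacobiTheta₂ u τ') := by
  have h1 : Summable fun n : ℤ => ‖jacobiTheta₂_term n z τ‖ :=
    ((summable_jacobiTheta₂_term_iff z τ).mpr hτ).norm
  have h2 : Summable fun n : ℤ => ‖jacobiTheta₂_term n u τ'‖ :=
    ((summable_jacobiTheta₂_term_iff u τ').mpr hτ').norm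
  have h3 := summable_mul_of_summable_norm h1 h2
  have h4 := h3.hasSum
  rw [← tsum_mul_tsum_of_summable_norm h1 h2] at h4
  exact h4

theorem two_mul_im_pos {τ : ℂ} (hτ : 0 < τ.im) : 0 < (2 * τ).im := by simpa using hτ

theorem four_mul_im_pos {τ : ℂ} (hτ : 0 < τ.im) : 0 < (4 * τ).im := by simpa using hτ

/-- With `m = a + b`, `n = a - b` one has `m² + n² = 2a² + 2b²`, so the pairs with `m + n` even give
a product of series of modulus `2τ`; the pairs with `m + n` odd give the second product, with its
exponential factor. The duplication formulas for squares and products of theta constants below are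
all specializations. -/
theorem jacobiTheta₂_mul_jacobiTheta₂ (z u : ℂ) {τ : ℂ} (hτ : 0 < τ.im) :
    jacobiTheta₂ z τ * jacobiTheta₂ u τ =
      jacobiTheta₂ (z + u) (2 * τ) * jacobiTheta₂ (z - u) (2 * τ) +
      cexp (2 * π * I * z + π * I * τ) *
        (jacobiTheta₂ (z + u + τ) (2 * τ) * jacobiTheta₂ (z - u + τ) (2 * τ)) := by
  have h := hasSum_jacobiTheta₂_mul z u hτ hτ
  rw [← paritySplit.hasSum_iff] at h
  have h2 := two_mul_im_pos hτ
  refine h.unique (HasSum.sum ?_ ?_)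
  · convert! hasSum_jacobiTheta₂_mul (z + u) (z - u) h2 h2 using 2 with p
    simp only [Function.comp, paritySplit_inl,
      jacobiTheta₂_term, ← Complex.exp_add]
    congr 1; push_cast; ring
  · convert! (hasSum_jacobiTheta₂_mul (z + u + τ) (z - u + τ) h2 h2).mul_left
      (cexp (2 * π * I * z + π * I * τ)) using 2 with p
    simp only [Function.comp, paritySplit_inr,
      jacobiTheta₂_term, ← Complex.exp_add]
    congr 1; push_cast; ring

theorem jacobiTheta₂_eq_add (z : ℂ) {τ : ℂ} (hτ : 0 < τ.im) :
    jacobiTheta₂ z τ = jacobiTheta₂ (2 * z) (4 * τ) +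
      cexp (2 * π * I * z + π * I * τ) * jacobiTheta₂ (2 * z + 2 * τ) (4 * τ) := by
  have h := hasSum_jacobiTheta₂_term z hτ
  rw [← intParitySplit.hasSum_iff] at h
  have h2 := four_mul_im_pos hτ
  refine h.unique (HasSum.sum ?_ ?_)
  · convert! hasSum_jacobiTheta₂_term (2 * z) h2 using 2 with p
    simp only [Function.comp, intParitySplit_inl, jacobiTheta₂_term]
    congr 1; push_cast; ring
  · convert! (hasSum_jacobiTheta₂_term (2 * z + 2 * τ) h2).mul_left
      (cexp (2 * π * I * z + π * I * τ)) using 2 with p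
    simp only [Function.comp, intParitySplit_inr,
      jacobiTheta₂_term, ← Complex.exp_add]
    congr 1; push_cast; ring

/-! ### Theta constants: values, duplication formulas -/

theorem theta3_eq (τ : ℂ) : theta3 τ = jacobiTheta₂ 0 τ := jacobiTheta_eq_jacobiTheta₂ τ

theorem jacobiTheta₂_half_eq (τ : ℂ) :
    jacobiTheta₂ (τ / 2) τ = cexp (-(π * I * τ / 4)) * theta2 τ := by
  rw [theta2, ← mul_assoc, ← Complex.exp_add, neg_add_cancel, Complex.exp_zero, one_mul]

theorem jacobiTheta₂_self (τ : ℂ) : jacobiTheta₂ τ τ = cexp (-(π * I * τ)) * theta3 τ := by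
  have h := jacobiTheta₂_add_left' 0 τ
  rw [zero_add] at h
  rw [h, theta3_eq]
  congr 2; ring

/-- Evenness combined with the quasi-periodicity in `1` and `τ` makes the value its own negative. -/
theorem jacobiTheta₂_half_add_half (τ : ℂ) : jacobiTheta₂ (1 / 2 + τ / 2) τ = 0 := by
  have h1 := jacobiTheta₂_neg_left (1 / 2 + τ / 2) τ
  have h2 := jacobiTheta₂_add_left' (-(1 / 2 + τ / 2)) τ
  have h3 := jacobiTheta₂_add_left (-(1 / 2 + τ / 2) + τ) τ
  rw [show -(1 / 2 + τ / 2) + τ + 1 = 1 / 2 + τ / 2 by ring] at h3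
  rw [show -↑π * I * (τ + 2 * -(1 / 2 + τ / 2)) = π * I by ring, Complex.exp_pi_mul_I, h1] at h2
  rw [← h3] at h2
  linear_combination h2 / 2

theorem jacobiTheta₂_tau_two_mul (τ : ℂ) :
    jacobiTheta₂ τ (2 * τ) = cexp (-(π * I * τ / 2)) * theta2 (2 * τ) := by
  have h := jacobiTheta₂_half_eq (2 * τ)
  rw [show 2 * τ / 2 = τ by ring, show ↑π * I * (2 * τ) / 4 = π * I * τ / 2 by ring] at h
  exact h

theorem exp_pi_I_eq (z : ℂ) (n : ℤ) : cexp (z + n * (2 * π * I)) = cexp z :=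
  Complex.exp_periodic.int_mul n z

theorem theta3_sq {τ : ℂ} (hτ : 0 < τ.im) :
    theta3 τ ^ 2 = theta3 (2 * τ) ^ 2 + theta2 (2 * τ) ^ 2 := by
  have h := jacobiTheta₂_mul_jacobiTheta₂ 0 0 hτ
  simp only [add_zero, sub_zero, mul_zero, zero_add, ← theta3_eq, jacobiTheta₂_tau_two_mul] at h
  rw [sq, h]
  have : cexp (π * I * τ) * (cexp (-(π * I * τ / 2)) * cexp (-(π * I * τ / 2))) = 1 := by
    rw [← Complex.exp_add, ← Complex.exp_add, ← Complex.exp_zero]; congr 1; ring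
  linear_combination theta2 (2 * τ) ^ 2 * this

theorem theta4_sq {τ : ℂ} (hτ : 0 < τ.im) :
    theta4 τ ^ 2 = theta3 (2 * τ) ^ 2 - theta2 (2 * τ) ^ 2 := by
  have h := jacobiTheta₂_mul_jacobiTheta₂ (1 / 2) (1 / 2) hτ
  have h1 := jacobiTheta₂_add_left 0 (2 * τ)
  have h2 := jacobiTheta₂_add_left τ (2 * τ)
  rw [add_comm] at h2
  rw [zero_add] at h1
  rw [show (1 : ℂ) / 2 + 1 / 2 = 1 by norm_num, sub_self, zero_add, h1, h2,
    jacobiTheta₂_tau_two_mul, ← theta3_eq] at h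
  have : cexp (2 * π * I * (1 / 2) + π * I * τ) *
      (cexp (-(π * I * τ / 2)) * cexp (-(π * I * τ / 2))) = -1 := by
    rw [← Complex.exp_add, ← Complex.exp_add, ← Complex.exp_pi_mul_I]; congr 1; ring
  rw [theta4, sq, h]
  linear_combination theta2 (2 * τ) ^ 2 * this

theorem theta3_mul_theta4 {τ : ℂ} (hτ : 0 < τ.im) :
    theta3 τ * theta4 τ = theta4 (2 * τ) ^ 2 := by
  have h := jacobiTheta₂_mul_jacobiTheta₂ 0 (1 / 2) hτ
  have h0 := jacobiTheta₂_half_add_half (2 * τ)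
  rw [show 2 * τ / 2 = τ by ring] at h0
  rw [zero_add, zero_sub, h0, jacobiTheta₂_neg_left] at h
  rw [theta3_eq, theta4, theta4, h]
  ring

theorem theta2_sq {τ : ℂ} (hτ : 0 < τ.im) :
    theta2 τ ^ 2 = 2 * theta2 (2 * τ) * theta3 (2 * τ) := by
  have h := jacobiTheta₂_mul_jacobiTheta₂ (τ / 2) (τ / 2) hτ
  rw [show τ / 2 + τ / 2 = τ by ring, sub_self, zero_add, show τ + τ = 2 * τ by ring,
    jacobiTheta₂_self, jacobiTheta₂_tau_two_mul, ← theta3_eq] at h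
  have e1 : cexp (π * I * τ / 4) ^ 2 * cexp (-(π * I * τ / 2)) = 1 := by
    rw [← Complex.exp_nat_mul, ← Complex.exp_add, ← Complex.exp_zero]
    congr 1; push_cast; ring
  have e2 : cexp (2 * π * I * (τ / 2) + π * I * τ) * cexp (-(π * I * (2 * τ))) = 1 := by
    rw [← Complex.exp_add, ← Complex.exp_zero]
    congr 1; ring
  rw [theta2, mul_pow, sq (jacobiTheta₂ _ _), h]
  linear_combination (2 * theta2 (2 * τ) * theta3 (2 * τ)) * e1 +
     theta2 (2 * τ) * theta3 (2 * τ) * cexp (π * I * τ / 4) ^ 2 * cexp (-(π * I * τ / 2)) * e2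

/-- Jacobi's identity. -/
theorem jacobi_identity {τ : ℂ} (hτ : 0 < τ.im) :
    theta2 τ ^ 4 + theta4 τ ^ 4 = theta3 τ ^ 4 := by
  have h2 : 0 < (τ / 2).im := by
    have : (τ / 2).im = τ.im / 2 := by simp
    rw [this]; positivity
  have e : 2 * (τ / 2) = τ := by ring
  have h3 := theta3_sq h2
  have h4 := theta4_sq h2
  have h34 := theta3_mul_theta4 h2
  rw [e] at h3 h4 h34
  -- The identity at `τ` descends from `τ/2`: `θ₄⁴ = θ₃(τ/2)² θ₄(τ/2)²`, and the two factors are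
  -- `θ₃² + θ₂²` and `θ₃² - θ₂²` at `τ`.
  have : theta4 τ ^ 4 = theta3 (τ / 2) ^ 2 * theta4 (τ / 2) ^ 2 := by
    rw [← mul_pow, h34]; ring
  rw [this, h3, h4]; ring

theorem theta3_eq_add {τ : ℂ} (hτ : 0 < τ.im) :
    theta3 τ = theta3 (4 * τ) + theta2 (4 * τ) := by
  have h := jacobiTheta₂_eq_add 0 hτ
  have h2 := jacobiTheta₂_half_eq (4 * τ)
  rw [show 4 * τ / 2 = 2 * τ by ring] at h2
  rw [mul_zero, mul_zero, zero_add, zero_add, h2] at h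
  have e : cexp (π * I * τ) * cexp (-(π * I * (4 * τ) / 4)) = 1 := by
    rw [← Complex.exp_add, ← Complex.exp_zero]; congr 1; ring
  rw [theta3_eq, theta3_eq, h]
  linear_combination theta2 (4 * τ) * e

theorem theta4_eq_sub {τ : ℂ} (hτ : 0 < τ.im) :
    theta4 τ = theta3 (4 * τ) - theta2 (4 * τ) := by
  have h := jacobiTheta₂_eq_add (1 / 2) hτ
  have h2 := jacobiTheta₂_half_eq (4 * τ)
  rw [show 4 * τ / 2 = 2 * τ by ring] at h2
  have h3 := jacobiTheta₂_add_left 0 (4 * τ)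
  have h4 := jacobiTheta₂_add_left (2 * τ) (4 * τ)
  rw [zero_add] at h3
  rw [show (2 : ℂ) * (1 / 2) = 1 by norm_num, add_comm 1, h3, h4, h2] at h
  have e : cexp (2 * π * I * (1 / 2) + π * I * τ) * cexp (-(π * I * (4 * τ) / 4)) = -1 := by
    rw [← Complex.exp_add, ← Complex.exp_pi_mul_I]; congr 1; ring
  rw [theta4, theta3_eq, h]
  linear_combination theta2 (4 * τ) * e

/-! ### Transformations of the theta constants -/

/-- Since `n² ≡ n (mod 2)`, the factor `e^{πi n²}` equals `e^{πi n}`, which is a shift of `z` by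
`1/2`. -/
theorem jacobiTheta₂_add_one_right (z τ : ℂ) :
    jacobiTheta₂ z (τ + 1) = jacobiTheta₂ (z + 1 / 2) τ := by
  refine tsum_congr fun n => ?_
  obtain ⟨k, hk⟩ : ∃ k : ℤ, n ^ 2 = n + 2 * k := by
    obtain ⟨k, hk⟩ := Int.even_mul_pred_self n
    exact ⟨k, by linear_combination hk⟩
  have hk' : (n : ℂ) ^ 2 = n + 2 * k := by exact_mod_cast hk
  rw [jacobiTheta₂_term, jacobiTheta₂_term, ← exp_pi_I_eq (2 * π * I * n * (z + 1 / 2) + _) k]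
  congr 1
  linear_combination (π * I) * hk'

theorem theta3_add_one (τ : ℂ) : theta3 (τ + 1) = theta4 τ := by
  rw [theta3_eq, jacobiTheta₂_add_one_right, zero_add, theta4]

theorem theta4_add_one (τ : ℂ) : theta4 (τ + 1) = theta3 τ := by
  rw [theta4, jacobiTheta₂_add_one_right, theta3_eq, show (1 : ℂ) / 2 + 1 / 2 = 0 + 1 by norm_num,
    jacobiTheta₂_add_left]

theorem theta2_add_one (τ : ℂ) : theta2 (τ + 1) = cexp (π * I / 4) * theta2 τ := by
  rw [theta2, theta2, jacobiTheta₂_add_one_right, show (τ + 1) / 2 + 1 / 2 = τ / 2 + 1 by ring,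
    jacobiTheta₂_add_left, ← mul_assoc, ← Complex.exp_add]
  congr 2; ring

theorem neg_I_mul_cpow_ne_zero {τ : ℂ} (hτ : 0 < τ.im) : (-I * τ) ^ (1 / 2 : ℂ) ≠ 0 := by
  rw [Ne, cpow_eq_zero_iff, not_and_or]
  left
  have : τ ≠ 0 := by rintro rfl; simp at hτ
  simpa using this

theorem neg_I_mul_cpow_sq (τ : ℂ) : ((-I * τ) ^ (1 / 2 : ℂ)) ^ 2 = -I * τ := by
  rw [← Complex.cpow_nat_mul]; norm_num

theorem theta3_neg_one_div {τ : ℂ} (hτ : 0 < τ.im) :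
    theta3 (-1 / τ) = (-I * τ) ^ (1 / 2 : ℂ) * theta3 τ := by
  have h := jacobiTheta₂_functional_equation 0 τ
  have h1 := neg_I_mul_cpow_ne_zero hτ
  simp only [ne_eq, OfNat.ofNat_ne_zero, not_false_eq_true, zero_pow, mul_zero, zero_div,
    Complex.exp_zero, mul_one, ← theta3_eq] at h
  rw [h, ← mul_assoc, mul_one_div_cancel h1, one_mul]

theorem theta2_neg_one_div {τ : ℂ} (hτ : 0 < τ.im) :
    theta2 (-1 / τ) = (-I * τ) ^ (1 / 2 : ℂ) * theta4 τ := by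
  have h0 : τ ≠ 0 := by rintro rfl; simp at hτ
  have h := jacobiTheta₂_functional_equation (1 / 2) τ
  have h1 := neg_I_mul_cpow_ne_zero hτ
  have h2 := jacobiTheta₂_neg_left (1 / 2 / τ) (-1 / τ)
  rw [show -(1 / 2 / τ) = -1 / τ / 2 by ring] at h2
  rw [← h2, show -↑π * I * (1 / 2) ^ 2 / τ = π * I * (-1 / τ) / 4 by ring] at h
  rw [theta4, h, theta2]
  linear_combination (-(cexp (π * I * (-1 / τ) / 4) * jacobiTheta₂ (-1 / τ / 2) (-1 / τ))) *
    mul_one_div_cancel h1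

theorem theta4_neg_one_div {τ : ℂ} (hτ : 0 < τ.im) :
    theta4 (-1 / τ) = (-I * τ) ^ (1 / 2 : ℂ) * theta2 τ := by
  have h0 : τ ≠ 0 := by rintro rfl; simp at hτ
  have h := jacobiTheta₂_functional_equation (τ / 2) τ
  have h1 := neg_I_mul_cpow_ne_zero hτ
  have e : cexp (π * I * τ / 4) * cexp (-π * I * (τ / 2) ^ 2 / τ) = 1 := by
    rw [← Complex.exp_add, ← Complex.exp_zero]; congr 1; field_simp; ring
  rw [show τ / 2 / τ = 1 / 2 by field_simp] at h
  rw [theta2, h, theta4]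
  linear_combination (-((-I * τ) ^ (1 / 2 : ℂ) * (1 / (-I * τ) ^ (1 / 2 : ℂ)) *
    jacobiTheta₂ (1 / 2) (-1 / τ))) * e - jacobiTheta₂ (1 / 2) (-1 / τ) * mul_one_div_cancel h1

/-! ### Holomorphy and behaviour at the cusp -/

theorem differentiableAt_theta3 {τ : ℂ} (hτ : 0 < τ.im) : DifferentiableAt ℂ theta3 τ :=
  differentiableAt_jacobiTheta hτ

theorem differentiableAt_theta4 {τ : ℂ} (hτ : 0 < τ.im) : DifferentiableAt ℂ theta4 τ :=
  differentiableAt_jacobiTheta₂_snd _ hτ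

theorem differentiableAt_theta2 {τ : ℂ} (hτ : 0 < τ.im) : DifferentiableAt ℂ theta2 τ := by
  unfold theta2
  refine DifferentiableAt.mul (by fun_prop) ?_
  exact (hasFDerivAt_jacobiTheta₂ (τ / 2) hτ).differentiableAt.comp τ
    (f := fun τ : ℂ => (τ / 2, τ)) (by fun_prop)

theorem tendsto_theta3 : Tendsto theta3 (comap im atTop) (𝓝 1) := by
  have h := isBigO_at_im_infty_jacobiTheta_sub_one
  have h0 : Tendsto (fun τ : ℂ => Real.exp (-π * τ.im)) (comap im atTop) (𝓝 0) := by
    refine (Real.tendsto_exp_atBot.comp ?_).comp (tendsto_comap (f := im))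
    exact (tendsto_id.const_mul_atTop_of_neg (by simp [Real.pi_pos]))
  have := h.trans_tendsto h0
  have h1 := this.add_const 1
  simp only [sub_add_cancel, zero_add] at h1
  exact h1

theorem tendsto_theta4 : Tendsto theta4 (comap im atTop) (𝓝 1) := by
  have : theta4 = theta3 ∘ (fun τ => τ + 1) := by ext τ; simp [theta3_add_one]
  rw [this]
  refine tendsto_theta3.comp ?_
  rw [tendsto_comap_iff]
  have : im ∘ (fun τ : ℂ => τ + 1) = im := by ext; simp
  rw [this]; exact tendsto_comap

theorem tendsto_two_pow_mul {τ : ℂ} (hτ : 0 < τ.im) :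
    Tendsto (fun n : ℕ => 2 ^ n * τ) atTop (comap im atTop) := by
  rw [tendsto_comap_iff]
  have : im ∘ (fun n : ℕ => 2 ^ n * τ) = fun n : ℕ => (2 : ℝ) ^ n * τ.im := by
    ext n
    have : (2 : ℂ) ^ n * τ = ((2 ^ n : ℝ) : ℂ) * τ := by push_cast; rfl
    simp only [Function.comp, this, Complex.im_ofReal_mul]
  rw [this]
  exact (tendsto_pow_atTop_atTop_of_one_lt (by norm_num)).atTop_mul_const hτ

/-- A zero at `τ` propagates to all `2ⁿτ` through `θ₃(τ)θ₄(τ) = θ₄(2τ)²`, while `θ₄ → 1` at `i∞`. -/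
theorem theta4_ne_zero {τ : ℂ} (hτ : 0 < τ.im) : theta4 τ ≠ 0 := by
  intro h
  have key : ∀ n : ℕ, 0 < (2 ^ n * τ).im ∧ theta4 (2 ^ n * τ) = 0 := by
    intro n
    induction n with
    | zero => simpa using ⟨hτ, h⟩
    | succ n ih =>
      rw [pow_succ', mul_assoc]
      refine ⟨two_mul_im_pos ih.1, ?_⟩
      have := theta3_mul_theta4 ih.1
      rw [ih.2, mul_zero] at this
      exact pow_eq_zero_iff (two_ne_zero) |>.mp this.symm
  have h1 := tendsto_theta4.comp (tendsto_two_pow_mul hτ)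
  have h2 : theta4 ∘ (fun n : ℕ => 2 ^ n * τ) = fun _ => 0 := by ext n; exact (key n).2
  rw [h2] at h1
  exact zero_ne_one (tendsto_nhds_unique tendsto_const_nhds h1)

theorem theta3_ne_zero {τ : ℂ} (hτ : 0 < τ.im) : theta3 τ ≠ 0 := by
  intro h
  have := theta3_mul_theta4 hτ
  rw [h, zero_mul] at this
  exact theta4_ne_zero (two_mul_im_pos hτ) (pow_eq_zero_iff (two_ne_zero) |>.mp this.symm)

theorem neg_one_div_im_pos {τ : ℂ} (hτ : 0 < τ.im) : 0 < (-1 / τ).im := by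
  have h := UpperHalfPlane.im_inv_neg_coe_pos ⟨τ, hτ⟩
  rw [show -1 / τ = (-τ)⁻¹ by rw [neg_div, one_div, inv_neg]]
  exact h

theorem theta2_ne_zero {τ : ℂ} (hτ : 0 < τ.im) : theta2 τ ≠ 0 := by
  intro h
  have := theta4_neg_one_div hτ
  rw [h, mul_zero] at this
  exact theta4_ne_zero (neg_one_div_im_pos hτ) this

/-- The terms have absolute value `exp(-π n(n+1) Im τ)`: only `n = 0` and `n = -1` survive, each
equal to `1`. For `Im τ ≥ 1` the series is dominated by its terms at `τ = i`. -/
theorem tendsto_jacobiTheta₂_half :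
    Tendsto (fun τ => jacobiTheta₂ (τ / 2) τ) (comap im atTop) (𝓝 2) := by
  have hev : ∀ᶠ τ : ℂ in comap im atTop, 1 ≤ τ.im :=
    tendsto_comap.eventually (eventually_ge_atTop 1)
  have hterm : ∀ (n : ℤ) (τ : ℂ), ‖jacobiTheta₂_term n (τ / 2) τ‖
      = Real.exp (-π * (n * (n + 1) : ℤ) * τ.im) := by
    intro n τ
    rw [norm_jacobiTheta₂_term]; congr 1
    have : (τ / 2).im = τ.im / 2 := by simp
    rw [this]; push_cast; ring
  have hnn : ∀ n : ℤ, 0 ≤ n * (n + 1) := by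
    intro n
    rcases le_or_gt 0 n with h | h
    · positivity
    · exact mul_nonneg_of_nonpos_of_nonpos h.le (by omega)
  have h := tendsto_tsum_of_dominated_convergence (𝓕 := comap im atTop)
    (f := fun (τ : ℂ) (n : ℤ) => jacobiTheta₂_term n (τ / 2) τ)
    (g := fun n : ℤ => if n ∈ ({0, -1} : Finset ℤ) then (1 : ℂ) else 0)
    (bound := fun n : ℤ => ‖jacobiTheta₂_term n (I / 2) I‖)
    ((summable_jacobiTheta₂_term_iff _ _).mpr (by simp)).norm ?_ ?_
  · rw [tsum_eq_sum (s := {0, -1}) (fun n hn => if_neg hn)] at h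
    convert! h using 2
    rw [Finset.sum_congr rfl fun b hb => if_pos hb]
    norm_num
  · intro n
    by_cases hn : n ∈ ({0, -1} : Finset ℤ)
    · simp only [hn, if_true]
      refine tendsto_const_nhds.congr fun τ => ?_
      simp only [Finset.mem_insert, Finset.mem_singleton] at hn
      rcases hn with rfl | rfl
      · simp [jacobiTheta₂_term]
      · rw [jacobiTheta₂_term, ← Complex.exp_zero]; congr 1; push_cast; ring
    · simp only [hn, if_false]
      rw [tendsto_zero_iff_norm_tendsto_zero]
      simp_rw [hterm]
      refine Real.tendsto_exp_atBot.comp ?_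
      have hpos : 0 < n * (n + 1) := by
        refine lt_of_le_of_ne (hnn n) fun h0 => hn ?_
        rcases mul_eq_zero.mp h0.symm with h | h
        · simp [h]
        · simp; omega
      refine tendsto_comap.const_mul_atTop_of_neg ?_
      have : (0 : ℝ) < (n * (n + 1) : ℤ) := by exact_mod_cast hpos
      nlinarith [Real.pi_pos]
  · filter_upwards [hev] with τ hτ n
    rw [hterm, hterm]
    have : (0 : ℝ) ≤ (n * (n + 1) : ℤ) := by exact_mod_cast hnn n
    rw [Real.exp_le_exp]
    have h2 := mul_nonneg Real.pi_pos.le this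
    simp only [I_im]
    nlinarith

open scoped ModularForm

/-! ### The product of the theta constants and the eta function -/

/-- The quotient `(ϑ₂ϑ₃ϑ₄)² / (4η⁶)`. -/
noncomputable def thetaEtaQuotient (τ : ℂ) : ℂ :=
  (theta2 τ * theta3 τ * theta4 τ) ^ 2 / (4 * ModularForm.eta τ ^ 6)

theorem eta_add_one (τ : ℂ) :
    ModularForm.eta (τ + 1) = cexp (π * I / 12) * ModularForm.eta τ := by
  have h : ∀ n, ModularForm.eta_q n (τ + 1) = ModularForm.eta_q n τ := by
    intro n
    rw [ModularForm.eta_q_eq_cexp, ModularForm.eta_q_eq_cexp, ← exp_pi_I_eq (2 * π * I * (n + 1) * τ) (n + 1)]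
    congr 1; push_cast; ring
  simp only [ModularForm.eta, h, Function.Periodic.qParam, ← mul_assoc, ← Complex.exp_add]
  congr 2; push_cast; ring

/-- Squaring removes the branch of the square root; the quotient below only involves `η⁶`. -/
theorem eta_neg_one_div_sq {τ : ℂ} (hτ : 0 < τ.im) :
    ModularForm.eta (-1 / τ) ^ 2 = -I * τ * ModularForm.eta τ ^ 2 := by
  have h := ModularForm.eta_comp_eq_csqrt_I_inv (x := τ) hτ
  simp only [Function.comp, Pi.smul_apply, Pi.mul_apply, smul_eq_mul] at h
  have h0 : τ ≠ 0 := by rintro rfl; simp at hτ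
  have hs : ∀ z : ℂ, Complex.sqrt z ^ 2 = z := by
    intro z; rw [Complex.sqrt, ← Complex.cpow_nat_mul]; norm_num
  rw [h, mul_pow, mul_pow, inv_pow, hs, hs, Complex.inv_I]; ring

theorem thetaEtaQuotient_add_one (τ : ℂ) :
    thetaEtaQuotient (τ + 1) = thetaEtaQuotient τ := by
  rw [thetaEtaQuotient, thetaEtaQuotient, theta2_add_one, theta3_add_one, theta4_add_one,
    eta_add_one, mul_pow (cexp _) _ 6, ← Complex.exp_nat_mul]
  have e : cexp (π * I / 4) ^ 2 = cexp ((6 : ℕ) * (π * I / 12)) := by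
    rw [← Complex.exp_nat_mul]; congr 1; push_cast; ring
  rw [← e, ← mul_div_mul_left (_ ^ 2) (4 * _ ^ 6) (pow_ne_zero 2 (Complex.exp_ne_zero (π * I / 4)))]
  congr 1 <;> ring

theorem thetaEtaQuotient_neg_one_div {τ : ℂ} (hτ : 0 < τ.im) :
    thetaEtaQuotient (-1 / τ) = thetaEtaQuotient τ := by
  have h0 : τ ≠ 0 := by rintro rfl; simp at hτ
  have h := neg_I_mul_cpow_sq τ
  have hI : -I * τ ≠ 0 := mul_ne_zero (by simp) h0
  have e : ModularForm.eta (-1 / τ) ^ 6 = (-I * τ) ^ 3 * ModularForm.eta τ ^ 6 := by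
    rw [show (6 : ℕ) = 2 * 3 by rfl, pow_mul, eta_neg_one_div_sq hτ]; ring
  rw [thetaEtaQuotient, thetaEtaQuotient, theta2_neg_one_div hτ, theta3_neg_one_div hτ,
    theta4_neg_one_div hτ, e,
    ← mul_div_mul_left (_ ^ 2) (4 * ModularForm.eta τ ^ 6) (pow_ne_zero 3 hI)]
  congr 1
  · generalize (-I * τ) ^ (1 / 2 : ℂ) = r at h ⊢
    rw [← h]; ring
  · ring

theorem tendsto_eta_product :
    Tendsto (fun τ => ∏' n, (1 - ModularForm.eta_q n τ)) (comap im atTop) (𝓝 1) := by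
  have htprod : Tendsto (fun q : ℂ => ∏' (n : ℕ), (1 - q ^ (n + 1))) (𝓝 0) (𝓝 1) := by
    have h := (ModularForm.differentiableOn_tprod_one_sub_pow.differentiableAt
      (Metric.isOpen_ball.mem_nhds (Metric.mem_ball_self one_pos))).continuousAt.tendsto
    simpa using h
  refine htprod.comp ?_
  exact (Function.Periodic.qParam_tendsto one_pos).mono_right nhdsWithin_le_nhds

theorem tendsto_thetaEtaQuotient : Tendsto thetaEtaQuotient (comap im atTop) (𝓝 1) := by
  have h := ((tendsto_jacobiTheta₂_half.mul tendsto_theta3).mul tendsto_theta4).pow 2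
  have h' := h.div ((tendsto_eta_product.pow 6).const_mul 4) (by norm_num)
  norm_num at h'
  refine h'.congr fun τ => ?_
  simp only [Pi.div_apply]
  rw [thetaEtaQuotient, ModularForm.eta, jacobiTheta₂_half_eq, Function.Periodic.qParam,
    mul_pow (cexp _) _ 6, ← Complex.exp_nat_mul]
  -- The factor `e^{πiτ/2}` of `θ₂²` cancels that of `η⁶`; what remains tends to `2²/4 = 1`.
  have e : cexp (-(π * I * τ / 4)) ^ 2 * cexp ((6 : ℕ) * (2 * π * I * τ / (24 : ℝ))) = 1 := by
    rw [← Complex.exp_nat_mul, ← Complex.exp_add, ← Complex.exp_zero]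
    congr 1; push_cast; ring
  rw [eq_comm, ← mul_div_mul_left (_ ^ 2) (4 * _)
    (pow_ne_zero 2 (Complex.exp_ne_zero (-(π * I * τ / 4))))]
  congr 1
  · ring
  · linear_combination 4 * (∏' n, (1 - ModularForm.eta_q n τ)) ^ 6 * e

theorem differentiableAt_thetaEtaQuotient {τ : ℂ} (hτ : 0 < τ.im) :
    DifferentiableAt ℂ thetaEtaQuotient τ := by
  have h1 := differentiableAt_theta2 hτ
  have h2 := differentiableAt_theta3 hτ
  have h3 := differentiableAt_theta4 hτ
  have h4 := ModularForm.differentiableAt_eta_of_mem_upperHalfPlaneSet (z := τ) hτ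
  have h5 := ModularForm.eta_ne_zero (z := τ) hτ
  unfold thetaEtaQuotient
  exact ((h1.mul h2).mul h3 |>.pow 2).div ((h4.pow 6).const_mul 4) (by simp [h5])

theorem tendsto_coe_atImInfty :
    Tendsto ((↑) : ℍ → ℂ) UpperHalfPlane.atImInfty (comap im atTop) := by
  rw [tendsto_comap_iff]; exact tendsto_comap

/-- A holomorphic function on the upper half-plane that is invariant under `τ ↦ τ + 1` and
`τ ↦ -1/τ` and has a limit at `i∞` is constant. -/
theorem eq_of_modular_invariant {f : ℂ → ℂ} {c : ℂ}
    (hd : ∀ τ : ℍ, DifferentiableAt ℂ f τ) (hT : ∀ τ : ℍ, f (τ + 1) = f τ)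
    (hS : ∀ τ : ℍ, f (-1 / τ) = f τ) (hlim : Tendsto f (comap im atTop) (𝓝 c)) (τ : ℍ) :
    f τ = c := by
  have hl : Tendsto (fun t : ℍ => f t) UpperHalfPlane.atImInfty (𝓝 c) :=
    hlim.comp tendsto_coe_atImInfty
  have hST : ∀ γ : SL(2, ℤ), (fun t : ℍ => f t) ∣[(0 : ℤ)] γ = fun t : ℍ => f t := by
    refine SlashInvariantForm.slash_action_generators_SL2Z ?_ ?_
    · ext t
      rw [ModularForm.SL_slash_apply, UpperHalfPlane.modular_S_smul]
      simpa [neg_div] using hS t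
    · ext t
      rw [ModularForm.SL_slash_apply, UpperHalfPlane.modular_T_smul]
      simpa [add_comm] using hT t
  -- Invariance under the two generators makes `f` a modular form of weight zero and level one; the
  -- limit at `i∞` gives boundedness at the only class of cusps, so `f` is constant.
  let F : ModularForm 𝒮ℒ 0 :=
    { toFun := fun t : ℍ => f t
      slash_action_eq' := by
        rintro _ ⟨γ, rfl⟩
        exact hST γ
      holo' := by
        rw [UpperHalfPlane.mdifferentiable_iff]
        refine DifferentiableOn.congr (f := f) (fun z hz => ?_) fun z hz => ?_
        · exact (hd ⟨z, hz⟩).differentiableWithinAt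
        · simp [UpperHalfPlane.ofComplex_apply_of_im_pos hz]
      bdd_at_cusps' := by
        intro x hx
        rw [Subgroup.IsArithmetic.isCusp_iff_isCusp_SL2Z] at hx
        rw [OnePoint.isBoundedAt_iff_forall_SL2Z hx]
        intro γ _
        rw [hST γ]
        exact hl.isBigO_one ℝ }
  obtain ⟨k, hk⟩ := ModularFormClass.levelOne_weight_zero_const F
  have hk' : ∀ t : ℍ, f t = k := fun t => congrFun hk t
  have : Tendsto (fun t : ℍ => f t) UpperHalfPlane.atImInfty (𝓝 k) :=
    tendsto_const_nhds.congr fun t => (hk' t).symm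
  rw [hk', tendsto_nhds_unique this hl]

/-- `(ϑ₂ϑ₃ϑ₄)² = 4η⁶`. -/
theorem theta_mul_sq_eq {τ : ℂ} (hτ : 0 < τ.im) :
    (theta2 τ * theta3 τ * theta4 τ) ^ 2 = 4 * ModularForm.eta τ ^ 6 := by
  have h := eq_of_modular_invariant (fun t : ℍ => differentiableAt_thetaEtaQuotient t.2)
    (fun t => thetaEtaQuotient_add_one t) (fun t => thetaEtaQuotient_neg_one_div t.2)
    tendsto_thetaEtaQuotient ⟨τ, hτ⟩
  have h5 := ModularForm.eta_ne_zero (z := τ) hτ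
  exact (div_eq_one_iff_eq (by simp [h5])).mp h

/-- By duplication `θ₂(τ)⁴ = 4 (θ₂θ₃)²(2τ)` and `θ₃θ₄ = θ₄(2τ)²`, so the left side is `4 (θ₂θ₃θ₄)²`
at `2τ`. This is why `η(2τ)` occurs in `y`. -/
theorem theta_eq_eta_two_mul {τ : ℂ} (hτ : 0 < τ.im) :
    theta2 τ ^ 4 * theta3 τ * theta4 τ = 16 * ModularForm.eta (2 * τ) ^ 6 := by
  have h := theta_mul_sq_eq (two_mul_im_pos hτ)
  have h2 := theta2_sq hτ
  have h34 := theta3_mul_theta4 hτ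
  have e : theta2 τ ^ 4 = (2 * theta2 (2 * τ) * theta3 (2 * τ)) ^ 2 := by rw [← h2]; ring
  rw [mul_assoc, h34, e]
  linear_combination 4 * h

/-! ### The functions `x`, `y`, `w` -/

variable {τ : ℂ}

theorem xFun_ne_zero (hτ : 0 < τ.im) : xFun τ ≠ 0 :=
  div_ne_zero (theta4_ne_zero hτ) (theta3_ne_zero hτ)

theorem wFun_ne_zero (hτ : 0 < τ.im) : wFun τ ≠ 0 :=
  div_ne_zero (theta2_ne_zero hτ) (theta3_ne_zero hτ)

theorem yFun_ne_zero (hτ : 0 < τ.im) : yFun τ ≠ 0 :=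
  div_ne_zero (mul_ne_zero (by simp) (pow_ne_zero 3 (ModularForm.eta_ne_zero
    (z := 2 * τ) (two_mul_im_pos hτ)))) (pow_ne_zero 3 (theta3_ne_zero hτ))

theorem differentiableAt_xFun (hτ : 0 < τ.im) : DifferentiableAt ℂ xFun τ :=
  (differentiableAt_theta4 hτ).div (differentiableAt_theta3 hτ) (theta3_ne_zero hτ)

theorem differentiableAt_wFun (hτ : 0 < τ.im) : DifferentiableAt ℂ wFun τ :=
  (differentiableAt_theta2 hτ).div (differentiableAt_theta3 hτ) (theta3_ne_zero hτ)

theorem differentiableAt_yFun (hτ : 0 < τ.im) : DifferentiableAt ℂ yFun τ := by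
  have h4 := ModularForm.differentiableAt_eta_of_mem_upperHalfPlaneSet (z := 2 * τ)
    (two_mul_im_pos hτ)
  have h : DifferentiableAt ℂ (fun t => ModularForm.eta (2 * t)) τ :=
    h4.comp τ (f := fun t => 2 * t) (by fun_prop)
  exact ((h.pow 3).const_mul _).div ((differentiableAt_theta3 hτ).pow 3)
    (pow_ne_zero 3 (theta3_ne_zero hτ))

theorem xFun_pow_add_wFun_pow (hτ : 0 < τ.im) : xFun τ ^ 4 + wFun τ ^ 4 = 1 := by
  have h := jacobi_identity hτ
  have h3 := theta3_ne_zero hτ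
  rw [xFun, wFun, div_pow, div_pow, ← add_div, add_comm, h, div_self (pow_ne_zero 4 h3)]

/-- One has `y² = -16 η(2τ)⁶/θ₃⁶ = -θ₂⁴θ₄/θ₃⁵`, and Jacobi's identity turns `-θ₂⁴/θ₃⁴` into `x⁴ -
1`. -/
theorem yFun_sq_eq (hτ : 0 < τ.im) : yFun τ ^ 2 = xFun τ ^ 5 - xFun τ := by
  have h := theta_eq_eta_two_mul hτ
  have hj := jacobi_identity hτ
  have h3 := theta3_ne_zero hτ
  rw [yFun, xFun]
  field_simp
  rw [I_sq]
  linear_combination -theta4 τ * hj * theta3 τ + h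

theorem xFun_add_one (τ : ℂ) : xFun (τ + 1) = (xFun τ)⁻¹ := by
  rw [xFun, xFun, theta4_add_one, theta3_add_one, inv_div]

theorem xFun_add_two (τ : ℂ) : xFun (τ + 2) = xFun τ := by
  rw [show τ + 2 = τ + 1 + 1 by ring, xFun_add_one, xFun_add_one, inv_inv]

theorem xFun_neg_one_div (hτ : 0 < τ.im) : xFun (-1 / τ) = wFun τ := by
  rw [xFun, wFun, theta4_neg_one_div hτ, theta3_neg_one_div hτ,
    mul_div_mul_left _ _ (neg_I_mul_cpow_ne_zero hτ)]

theorem wFun_neg_one_div (hτ : 0 < τ.im) : wFun (-1 / τ) = xFun τ := by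
  rw [xFun, wFun, theta2_neg_one_div hτ, theta3_neg_one_div hτ,
    mul_div_mul_left _ _ (neg_I_mul_cpow_ne_zero hτ)]

theorem wFun_add_two (τ : ℂ) : wFun (τ + 2) = I * wFun τ := by
  have e : cexp (π * I / 4) * cexp (π * I / 4) = I := by
    rw [← Complex.exp_add, show (π * I / 4 + π * I / 4 : ℂ) = π / 2 * I by ring,
      Complex.exp_pi_div_two_mul_I]
  rw [wFun, wFun, show τ + 2 = τ + 1 + 1 by ring, theta2_add_one, theta2_add_one, theta3_add_one,
    theta4_add_one, ← mul_assoc, e, mul_div_assoc]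

/-- The argument of `η` moves by `4`, and `η³` picks up `e^{πi} = -1`. As `x` is unchanged, `τ ↦ τ +
2` exchanges the two sheets over `x`. -/
theorem yFun_add_two (τ : ℂ) : yFun (τ + 2) = -yFun τ := by
  have h : ∀ t, ModularForm.eta (t + 4) ^ 3 = - ModularForm.eta t ^ 3 := by
    intro t
    rw [show t + 4 = t + 1 + 1 + 1 + 1 by ring, eta_add_one, eta_add_one, eta_add_one, eta_add_one]
    have e : cexp (π * I / 12) ^ 12 = -1 := by
      rw [← Complex.exp_nat_mul, ← Complex.exp_pi_mul_I]; congr 1; push_cast; ring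
    linear_combination ModularForm.eta t ^ 3 * e
  rw [yFun, yFun, show 2 * (τ + 2) = 2 * τ + 4 by ring, h, show τ + 2 = τ + 1 + 1 by ring,
    theta3_add_one, theta4_add_one]
  ring

theorem tendsto_xFun : Tendsto xFun (comap im atTop) (𝓝 1) := by
  have := tendsto_theta4.div tendsto_theta3 one_ne_zero
  rwa [div_one] at this

open MeasureTheory

/-! ### Theta functions of degree two -/

/-- The real part of the shift is absorbed by periodicity on the line; for the imaginary part,
Cauchy's theorem on a rectangle applies, its vertical sides cancelling by periodicity. -/
theorem integral_add_of_periodic {g : ℂ → ℂ} (hg : Differentiable ℂ g)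
    (hp : ∀ v, g (v + 1) = g v) (s : ℂ) :
    ∫ x in (0 : ℝ)..1, g (x + s) = ∫ x in (0 : ℝ)..1, g x := by
  have h1 : ∫ x in (0 : ℝ)..1, g (x + s) = ∫ x in (0 : ℝ)..1, g (x + s.im * I) := by
    have hper : Function.Periodic (fun x : ℝ => g (x + s.im * I)) 1 := fun x => by
      simp only [ofReal_add, ofReal_one]
      rw [← hp (x + s.im * I)]; congr 1; ring
    have := hper.intervalIntegral_add_eq s.re 0
    rw [zero_add] at this
    rw [← this]
    have h2 := intervalIntegral.integral_comp_add_right (a := 0) (b := 1)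
      (fun x : ℝ => g (x + s.im * I)) s.re
    rw [zero_add, add_comm 1 s.re] at h2
    rw [← h2]
    refine intervalIntegral.integral_congr fun x _ => ?_
    congr 1
    rw [ofReal_add, add_assoc, re_add_im]
  rw [h1]
  have h := Complex.integral_boundary_rect_eq_zero_of_differentiableOn g 0 (1 + s.im * I)
    hg.differentiableOn
  simp only [zero_re, zero_im, add_re, one_re, mul_re, ofReal_re, I_re, mul_zero, ofReal_im, I_im,
    sub_zero, add_zero, add_im, one_im, mul_im, zero_add, mul_one, zero_mul,
    ofReal_zero, ofReal_one] at h
  have e : ∀ y : ℝ, g (1 + y * I) = g (y * I) := fun y => by rw [add_comm, hp]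
  simp only [e, add_sub_cancel_right] at h
  exact (sub_eq_zero.mp h).symm

/-- The zero family of coefficients is summable, so the Fourier series converges pointwise to `f`.
-/
theorem eq_zero_of_fourier_eq_zero {f : ℝ → ℂ} (hf : Continuous f) (hp : Function.Periodic f 1)
    (h : ∀ n : ℤ, ∫ x in (0 : ℝ)..1, cexp (-(2 * π * I * n * x)) * f x = 0) : f 0 = 0 := by
  let F : C(AddCircle (1 : ℝ), ℂ) := ⟨hp.lift, continuous_coinduced_dom.mpr hf⟩
  have hF : ∀ n, fourierCoeff F n = 0 := by
    intro n
    rw [fourierCoeff_eq_intervalIntegral _ n 0]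
    simp only [zero_add, div_one, one_smul]
    rw [← h n]
    refine intervalIntegral.integral_congr fun x _ => ?_
    simp only [fourier_coe_apply, smul_eq_mul]
    congr 2
    push_cast; ring
  have hsum : Summable (fourierCoeff F) := by
    rw [show fourierCoeff F = fun _ => 0 from funext hF]; exact summable_zero
  have hs := has_pointwise_sum_fourier_series_of_summable hsum ((0 : ℝ) : AddCircle (1 : ℝ))
  simp only [hF, zero_smul] at hs
  exact hs.unique hasSum_zero

/-- Theta functions of degree two, with the multipliers of `ϑ₁²`. -/
structure IsDegreeTwoTheta (τ : ℂ) (F : ℂ → ℂ) : Prop where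
  differentiable : Differentiable ℂ F
  add_one : ∀ v, F (v + 1) = F v
  add_tau : ∀ v, F (v + τ) = cexp (-(4 * π * I * (τ + v))) * F v

theorem IsDegreeTwoTheta.sub_smul {τ : ℂ} {F G : ℂ → ℂ} (hF : IsDegreeTwoTheta τ F)
    (hG : IsDegreeTwoTheta τ G) (a b : ℂ) : IsDegreeTwoTheta τ (fun v => a * F v - b * G v) where
  differentiable := (hF.differentiable.const_mul a).sub (hG.differentiable.const_mul b)
  add_one v := by simp only [hF.add_one, hG.add_one]
  add_tau v := by simp only [hF.add_tau, hG.add_tau]; ring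

theorem IsDegreeTwoTheta.add_half {τ : ℂ} {F : ℂ → ℂ} (hF : IsDegreeTwoTheta τ F) :
    IsDegreeTwoTheta τ (fun v => F (v + 1 / 2)) where
  differentiable := hF.differentiable.comp (by fun_prop : Differentiable ℂ fun v : ℂ => v + 1 / 2)
  add_one v := by rw [← hF.add_one (v + 1 / 2)]; congr 1; ring
  add_tau v := by
    rw [show v + τ + 1 / 2 = v + 1 / 2 + τ by ring, hF.add_tau, ← exp_pi_I_eq _ 1]
    congr 2; push_cast; ring

/-- The Fourier coefficients of a theta function. -/
noncomputable def thetaCoeff (F : ℂ → ℂ) (n : ℤ) : ℂ :=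
  ∫ x in (0 : ℝ)..1, cexp (-(2 * π * I * n * x)) * F x

theorem exp_mul_periodic {F : ℂ → ℂ} (hF : ∀ v, F (v + 1) = F v) (n : ℤ) (v : ℂ) :
    cexp (-(2 * π * I * n * (v + 1))) * F (v + 1) = cexp (-(2 * π * I * n * v)) * F v := by
  rw [hF, ← exp_pi_I_eq (-(2 * π * I * n * (v + 1))) n]
  congr 2; ring

/-- Moving the contour by `τ` turns the quasi-periodicity into a recursion of step two for the
Fourier coefficients. Hence the coefficients of index `0` and `1` determine everything: the space
has dimension at most two. -/
theorem IsDegreeTwoTheta.coeff_add_two {τ : ℂ} {F : ℂ → ℂ} (hF : IsDegreeTwoTheta τ F) (n : ℤ) :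
    thetaCoeff F n = cexp (-(2 * π * I * (n + 2) * τ)) * thetaCoeff F (n + 2) := by
  have hd : Differentiable ℂ fun v => cexp (-(2 * π * I * n * v)) * F v := by
    have := hF.differentiable
    fun_prop
  have h := integral_add_of_periodic hd (exp_mul_periodic hF.add_one n) τ
  rw [thetaCoeff, thetaCoeff, ← h, ← intervalIntegral.integral_const_mul]
  refine intervalIntegral.integral_congr fun x _ => ?_
  simp only [hF.add_tau, ← mul_assoc, ← Complex.exp_add]
  congr 2; push_cast; ring

theorem IsDegreeTwoTheta.eq_zero_of_coeff {τ : ℂ} {F : ℂ → ℂ} (hF : IsDegreeTwoTheta τ F)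
    (h0 : thetaCoeff F 0 = 0) (h1 : thetaCoeff F 1 = 0) (v : ℂ) : F v = 0 := by
  have up : ∀ n, thetaCoeff F n = 0 ↔ thetaCoeff F (n + 2) = 0 := fun n => by
    rw [hF.coeff_add_two n]; simp
  have hnat : ∀ n : ℕ, thetaCoeff F n = 0 ∧ thetaCoeff F (n + 1) = 0 := by
    intro n
    induction n with
    | zero => exact ⟨by simpa using h0, by simpa using h1⟩
    | succ n ih =>
      refine ⟨by exact_mod_cast ih.2, ?_⟩
      have := (up n).mp ih.1
      rw [Nat.cast_succ, add_assoc]; exact this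
  have hneg : ∀ n : ℕ, thetaCoeff F (-n) = 0 ∧ thetaCoeff F (-n + 1) = 0 := by
    intro n
    induction n with
    | zero => exact ⟨by simpa using h0, by simpa using h1⟩
    | succ n ih =>
      have e : -((n + 1 : ℕ) : ℤ) + 1 = -n := by push_cast; ring
      rw [e]
      refine ⟨?_, ih.1⟩
      rw [up]
      convert! ih.2 using 2
      push_cast; ring
  have hall : ∀ n : ℤ, thetaCoeff F n = 0 := by
    intro n
    obtain ⟨k, rfl | rfl⟩ := n.eq_nat_or_neg
    · exact (hnat k).1
    · exact (hneg k).1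
  have hc := hF.differentiable.continuous
  have := eq_zero_of_fourier_eq_zero (f := fun x : ℝ => F (x + v)) (by fun_prop)
    (fun x => by
      simp only; rw [← hF.add_one (x + v)]; congr 1; push_cast; ring) ?_
  · simpa using this
  · intro n
    have hd : Differentiable ℂ fun v => cexp (-(2 * π * I * n * v)) * F v := by
      have := hF.differentiable
      fun_prop
    have h := integral_add_of_periodic hd (exp_mul_periodic hF.add_one n) v
    rw [← mul_zero (cexp (2 * π * I * n * v)), ← hall n, thetaCoeff, ← h,
      ← intervalIntegral.integral_const_mul]
    refine intervalIntegral.integral_congr fun x _ => ?_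
    simp only [← mul_assoc, ← Complex.exp_add]
    congr 2; ring

theorem thetaCoeff_add_half {F : ℂ → ℂ} (hd : Differentiable ℂ F) (hp : ∀ v, F (v + 1) = F v)
    (n : ℤ) : thetaCoeff (fun v => F (v + 1 / 2)) n = (-1) ^ n * thetaCoeff F n := by
  have hd : Differentiable ℂ fun v => cexp (-(2 * π * I * n * v)) * F v := by
    fun_prop
  have h := integral_add_of_periodic hd (exp_mul_periodic hp n) (1 / 2)
  rw [thetaCoeff, thetaCoeff, ← h, ← intervalIntegral.integral_const_mul]
  refine intervalIntegral.integral_congr fun x _ => ?_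
  simp only [← mul_assoc]
  rw [← Complex.exp_pi_mul_I, ← Complex.exp_int_mul, ← Complex.exp_add]
  congr 2; ring

theorem isDegreeTwoTheta_even (τ : ℂ) (hτ : 0 < τ.im) :
    IsDegreeTwoTheta τ (fun v => jacobiTheta₂ (2 * v + τ) (2 * τ)) where
  differentiable v := (differentiableAt_jacobiTheta₂_fst (2 * v + τ) (two_mul_im_pos hτ)).comp v
    (f := fun v => 2 * v + τ) (by fun_prop)
  add_one v := by
    rw [show 2 * (v + 1) + τ = 2 * v + τ + 1 + 1 by ring, jacobiTheta₂_add_left,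
      jacobiTheta₂_add_left]
  add_tau v := by
    rw [show 2 * (v + τ) + τ = 2 * v + τ + 2 * τ by ring, jacobiTheta₂_add_left']
    congr 2; ring

theorem isDegreeTwoTheta_odd (τ : ℂ) (hτ : 0 < τ.im) :
    IsDegreeTwoTheta τ (fun v => cexp (2 * π * I * v) * jacobiTheta₂ (2 * v + 2 * τ) (2 * τ)) where
  differentiable := by
    refine Differentiable.mul (by fun_prop) fun v => ?_
    exact (differentiableAt_jacobiTheta₂_fst (2 * v + 2 * τ) (two_mul_im_pos hτ)).comp v
      (f := fun v => 2 * v + 2 * τ) (by fun_prop)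
  add_one v := by
    rw [show 2 * (v + 1) + 2 * τ = 2 * v + 2 * τ + 1 + 1 by ring, jacobiTheta₂_add_left,
      jacobiTheta₂_add_left, ← exp_pi_I_eq (2 * π * I * v) 1]
    congr 2; push_cast; ring
  add_tau v := by
    rw [show 2 * (v + τ) + 2 * τ = 2 * v + 2 * τ + 2 * τ by ring, jacobiTheta₂_add_left',
      ← mul_assoc, ← mul_assoc, ← Complex.exp_add, ← Complex.exp_add]
    congr 2; ring

/-- A theta function of degree two that vanishes at `0` and at `1/2` is zero. -/
theorem IsDegreeTwoTheta.eq_zero {τ : ℂ} (hτ : 0 < τ.im) {F : ℂ → ℂ} (hF : IsDegreeTwoTheta τ F)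
    (h0 : F 0 = 0) (h1 : F (1 / 2) = 0) (v : ℂ) : F v = 0 := by
  have h2 := two_mul_im_pos hτ
  -- `F` is split into its eigenparts under `v ↦ v + 1/2`. Each eigenspace is spanned by one `G`
  -- with `G(0) ≠ 0`; the eigenpart of `F` vanishes at `0` because `F(0) = F(1/2) = 0`, hence it is
  -- zero.
  have key : ∀ (ε : ℂ) (G : ℂ → ℂ), (ε = 1 ∨ ε = -1) → IsDegreeTwoTheta τ G → G 0 ≠ 0 →
      (∀ v, G (v + 1 / 2) = ε * G v) → ∀ v, F v + ε * F (v + 1 / 2) = 0 := by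
    intro ε G hε hG hG0 hGh v
    have hE := hF.sub_smul hF.add_half 1 (-ε)
    set E : ℂ → ℂ := fun v => 1 * F v - -ε * F (v + 1 / 2) with hEdef
    have hEh : ∀ v, E (v + 1 / 2) = ε * E v := by
      intro v
      simp only [hEdef]
      rw [show v + 1 / 2 + 1 / 2 = v + 1 by ring, hF.add_one]
      rcases hε with rfl | rfl <;> ring
    have hpar : ∀ H : ℂ → ℂ, IsDegreeTwoTheta τ H → (∀ v, H (v + 1 / 2) = ε * H v) →
        ∀ n : ℤ, ε * thetaCoeff H n = (-1) ^ n * thetaCoeff H n := by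
      intro H hH hHh n
      rw [← thetaCoeff_add_half hH.differentiable hH.add_one n, thetaCoeff, thetaCoeff,
        ← intervalIntegral.integral_const_mul]
      refine intervalIntegral.integral_congr fun x _ => ?_
      simp only [hHh]; ring
    -- An eigenfunction only has Fourier coefficients of one parity: `i` is the index that may
    -- survive and `j` the one that is killed.
    obtain ⟨i, j, hij, hj⟩ : ∃ i j : ℤ, ((i = 0 ∧ j = 1) ∨ (i = 1 ∧ j = 0)) ∧
        ∀ H : ℂ → ℂ, IsDegreeTwoTheta τ H → (∀ v, H (v + 1 / 2) = ε * H v) →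
          thetaCoeff H j = 0 := by
      rcases hε with rfl | rfl
      · refine ⟨0, 1, Or.inl ⟨rfl, rfl⟩, fun H hH hHh => ?_⟩
        have := hpar H hH hHh 1
        rw [zpow_one] at this
        linear_combination this / 2
      · refine ⟨1, 0, Or.inr ⟨rfl, rfl⟩, fun H hH hHh => ?_⟩
        have := hpar H hH hHh 0
        rw [zpow_zero] at this
        linear_combination -this / 2
    have hzero : ∀ H : ℂ → ℂ, IsDegreeTwoTheta τ H → thetaCoeff H i = 0 → thetaCoeff H j = 0 →
        ∀ v, H v = 0 := by
      intro H hH hi hj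
      rcases hij with ⟨rfl, rfl⟩ | ⟨rfl, rfl⟩
      · exact hH.eq_zero_of_coeff hi hj
      · exact hH.eq_zero_of_coeff hj hi
    have hGi : thetaCoeff G i ≠ 0 := fun hi => hG0 (hzero G hG hi (hj G hG hGh) 0)
    have hlin : ∀ (n : ℤ) (a b : ℂ),
        thetaCoeff (fun v => a * E v - b * G v) n = a * thetaCoeff E n - b * thetaCoeff G n := by
      intro n a b
      have hc1 := hE.differentiable.continuous
      have hc2 := hG.differentiable.continuous
      simp only [thetaCoeff]
      rw [← intervalIntegral.integral_const_mul, ← intervalIntegral.integral_const_mul,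
        ← intervalIntegral.integral_sub]
      · refine intervalIntegral.integral_congr fun x _ => ?_
        ring
      · exact Continuous.intervalIntegrable (by fun_prop) _ _
      · exact Continuous.intervalIntegrable (by fun_prop) _ _
    have hz := hzero _ (hE.sub_smul hG (thetaCoeff G i) (thetaCoeff E i))
      (by rw [hlin]; ring) (by rw [hlin, hj E hE hEh, hj G hG hGh]; ring)
    have hz0 := hz 0
    have hE0 : E 0 = 0 := by simp [hEdef, h0]; right; simpa using h1
    rw [hE0, mul_zero, zero_sub, neg_eq_zero] at hz0
    have hEi : thetaCoeff E i = 0 := (mul_eq_zero.mp hz0).resolve_right hG0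
    have := hz v
    rw [hEi, zero_mul, sub_zero] at this
    have hEv := (mul_eq_zero.mp this).resolve_left hGi
    simp only [hEdef] at hEv
    linear_combination hEv
  have k1 := key 1 _ (Or.inl rfl) (isDegreeTwoTheta_even τ hτ) (by
    rw [mul_zero, zero_add, jacobiTheta₂_tau_two_mul]
    exact mul_ne_zero (Complex.exp_ne_zero _) (theta2_ne_zero h2)) (fun v => by
    rw [show 2 * (v + 1 / 2) + τ = 2 * v + τ + 1 by ring, jacobiTheta₂_add_left, one_mul]) v
  have k2 := key (-1) _ (Or.inr rfl) (isDegreeTwoTheta_odd τ hτ) (by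
    rw [mul_zero, mul_zero, zero_add, jacobiTheta₂_self]
    exact mul_ne_zero (Complex.exp_ne_zero _) (mul_ne_zero (Complex.exp_ne_zero _)
      (theta3_ne_zero h2))) (fun v => by
    rw [show 2 * (v + 1 / 2) + 2 * τ = 2 * v + 2 * τ + 1 by ring, jacobiTheta₂_add_left,
      show 2 * π * I * (v + 1 / 2) = 2 * π * I * v + π * I by ring, Complex.exp_add,
      Complex.exp_pi_mul_I]
    ring) v
  linear_combination (k1 + k2) / 2

/-- The condition on `s` says `2s ∈ ℤ`. Up to exponential factors, `s = 0` gives `ϑ₂(v)²` and `s =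
1/2` gives `ϑ₁(v)²`. -/
theorem isDegreeTwoTheta_sq (τ s : ℂ) (hτ : 0 < τ.im) (hs : cexp (4 * π * I * s) = 1) :
    IsDegreeTwoTheta τ (fun v => jacobiTheta₂ (v + s + τ / 2) τ ^ 2) where
  differentiable v := ((differentiableAt_jacobiTheta₂_fst (v + s + τ / 2) hτ).comp v
    (f := fun v => v + s + τ / 2) (by fun_prop)).pow 2
  add_one v := by
    rw [show v + 1 + s + τ / 2 = v + s + τ / 2 + 1 by ring, jacobiTheta₂_add_left]
  add_tau v := by
    rw [show v + τ + s + τ / 2 = v + s + τ / 2 + τ by ring, jacobiTheta₂_add_left', mul_pow,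
      ← Complex.exp_nat_mul, ← mul_one (cexp (-(4 * π * I * (τ + v)))), ← inv_one, ← hs,
      ← Complex.exp_neg, ← Complex.exp_add]
    congr 2; push_cast; ring

/-! ### The Weierstrass function as a quotient of theta functions -/

theorem mem_burnside_lattice {τ : ℍ} {z : ℂ} :
    z ∈ (burnsidePeriods τ).lattice ↔ ∃ m n : ℤ, (m : ℂ) * 4 + n * (4 * τ) = z :=
  PeriodPair.mem_lattice

theorem four_mul_mem_burnside_lattice {τ : ℍ} {v : ℂ} :
    4 * v ∈ (burnsidePeriods τ).lattice ↔ ∃ m n : ℤ, (m : ℂ) + n * τ = v := by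
  rw [mem_burnside_lattice]
  constructor <;> rintro ⟨m, n, h⟩ <;> refine ⟨m, n, ?_⟩
  · linear_combination h / 4
  · linear_combination 4 * h

theorem add_mul_eq_zero {τ : ℍ} {a b : ℝ} (h : (a : ℂ) + b * τ = 0) : a = 0 ∧ b = 0 := by
  have him := congrArg Complex.im h
  have hre := congrArg Complex.re h
  simp at him hre
  have hb : b = 0 := him.resolve_right τ.im_pos.ne'
  subst hb
  simpa using hre

/-- A point with a non-integral coordinate is not in the lattice. -/
theorem notMem_burnside_lattice {τ : ℍ} {a b : ℝ}
    (h : (∀ m : ℤ, (m : ℝ) ≠ a) ∨ ∀ n : ℤ, (n : ℝ) ≠ b) :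
    4 * ((a : ℂ) + b * τ) ∉ (burnsidePeriods τ).lattice := by
  rw [four_mul_mem_burnside_lattice]
  rintro ⟨m, n, hmn⟩
  have h0 : ((m - a : ℝ) : ℂ) + ((n - b : ℝ) : ℂ) * τ = 0 := by
    push_cast; linear_combination hmn
  obtain ⟨h1, h2⟩ := add_mul_eq_zero h0
  rcases h with h | h
  · exact h m (by linarith)
  · exact h n (by linarith)

theorem jacobiTheta₂_odd_int (m n : ℤ) (τ : ℂ) :
    jacobiTheta₂ (m + n * τ + 1 / 2 + τ / 2) τ = 0 := by
  have hm : ∀ (m : ℤ) (z : ℂ), jacobiTheta₂ (m + z) τ = jacobiTheta₂ z τ := by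
    intro m z
    have : Function.Periodic (fun z => jacobiTheta₂ z τ) 1 := fun z => jacobiTheta₂_add_left z τ
    have := this.int_mul m z
    rw [mul_one] at this
    rw [add_comm]; exact this
  have hshift : ∀ z, jacobiTheta₂ (z + τ) τ = 0 ↔ jacobiTheta₂ z τ = 0 := by
    intro z; rw [jacobiTheta₂_add_left']; simp
  rw [show (m : ℂ) + n * τ + 1 / 2 + τ / 2 = m + (n * τ + 1 / 2 + τ / 2) by ring, hm]
  have h0 := jacobiTheta₂_half_add_half τ
  have hnat : ∀ k : ℕ, jacobiTheta₂ (k * τ + 1 / 2 + τ / 2) τ = 0 ∧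
      jacobiTheta₂ (-k * τ + 1 / 2 + τ / 2) τ = 0 := by
    intro k
    induction k with
    | zero => simpa using h0
    | succ k ih =>
      constructor
      · rw [← ih.1.symm.trans ih.1, ← ih.1]
        have := (hshift (k * τ + 1 / 2 + τ / 2)).mpr ih.1
        rw [ih.1, ← this]; congr 1; push_cast; ring
      · rw [← hshift, ← ih.2]; congr 1; push_cast; ring
  obtain ⟨k, rfl | rfl⟩ := n.eq_nat_or_neg
  · simpa using (hnat k).1
  · simpa using (hnat k).2

open Classical in
/-- The entire function that agrees with `(℘(4v) - e) ϑ₁(v)²` outside of the lattice. -/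
noncomputable def wpTheta (τ : ℍ) (e v : ℂ) : ℂ :=
  if 4 * v ∈ (burnsidePeriods τ).lattice then
    (deriv (fun v => jacobiTheta₂ (v + 1 / 2 + τ / 2) τ) v) ^ 2 / 16
  else ((burnsidePeriods τ).weierstrassP (4 * v) - e) * jacobiTheta₂ (v + 1 / 2 + τ / 2) τ ^ 2

theorem differentiable_jacobiTheta₂_odd (τ : ℍ) :
    Differentiable ℂ fun v => jacobiTheta₂ (v + 1 / 2 + τ / 2) τ := fun v =>
  (differentiableAt_jacobiTheta₂_fst (v + 1 / 2 + τ / 2) τ.2).comp v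
    (f := fun v => v + 1 / 2 + (τ : ℂ) / 2) (by fun_prop)

theorem differentiable_wpTheta (τ : ℍ) (e : ℂ) : Differentiable ℂ (wpTheta τ e) := by
  intro v
  set L := burnsidePeriods τ with hL
  have hth := differentiable_jacobiTheta₂_odd τ
  have hmul : Tendsto (fun v : ℂ => 4 * v) (𝓝 v) (𝓝 (4 * v)) := by
    apply Continuous.tendsto; fun_prop
  by_cases hv : 4 * v ∈ L.lattice
  · have hex := L.analyticAt_weierstrassPExcept (4 * v)
    have hex' : DifferentiableAt ℂ (fun u => L.weierstrassPExcept (4 * v) (4 * u)) v :=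
      hex.differentiableAt.comp v (f := fun u => 4 * u) (by fun_prop)
    set θ : ℂ → ℂ := fun v => jacobiTheta₂ (v + 1 / 2 + τ / 2) τ with hθ
    have hsl : DifferentiableAt ℂ (dslope θ v) v :=
      (((differentiableOn_dslope (s := Set.univ) (c := v) Filter.univ_mem).mpr
        hth.differentiableOn) v (Set.mem_univ v)).differentiableAt Filter.univ_mem
    have hθv : θ v = 0 := by
      obtain ⟨m, n, hmn⟩ := four_mul_mem_burnside_lattice.mp hv
      rw [hθ]; simp only; rw [← hmn]; exact jacobiTheta₂_odd_int m n τ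
    -- At a lattice point the double pole `1/(4u - 4v)²` times `θ(u)²` is the squared difference
    -- quotient of `θ` divided by `16`; this is the origin of the value assigned to `wpTheta` on the
    -- lattice.
    have hD : DifferentiableAt ℂ (fun u => (L.weierstrassPExcept (4 * v) (4 * u)
        - 1 / (4 * v) ^ 2 - e) * θ u ^ 2 + dslope θ v u ^ 2 / 16) v :=
      ((hex'.sub_const _ |>.sub_const _).mul ((hth v).pow 2)).add ((hsl.pow 2).div_const _)
    refine hD.congr_of_eventuallyEq ?_
    filter_upwards [hmul.eventually (L.compl_lattice_sdiff_singleton_mem_nhds (4 * v))] with u hu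
    by_cases huv : u = v
    · subst huv
      rw [wpTheta, if_pos hv, dslope_same, hθv]; ring
    · have hu' : 4 * u ∉ L.lattice := fun h => hu ⟨h, fun h' => huv (by simpa using h')⟩
      rw [wpTheta, if_neg hu', dslope_of_ne _ huv, slope_def_field, hθv, sub_zero,
        ← L.weierstrassPExcept_add ⟨4 * v, hv⟩]
      have : u - v ≠ 0 := sub_ne_zero.mpr huv
      simp only [hθ]
      field_simp
      ring
  · have hd : DifferentiableAt ℂ (fun u => (L.weierstrassP (4 * u) - e) *
        jacobiTheta₂ (u + 1 / 2 + τ / 2) τ ^ 2) v := by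
      have h1 : DifferentiableAt ℂ (fun u => L.weierstrassP (4 * u)) v :=
        (L.analyticOnNhd_weierstrassP (4 * v) hv).differentiableAt.comp v
          (f := fun u => 4 * u) (by fun_prop)
      exact (h1.sub_const e).mul ((hth v).pow 2)
    refine hd.congr_of_eventuallyEq ?_
    filter_upwards [hmul.eventually (L.isClosed_lattice.isOpen_compl.mem_nhds hv)] with u hu
    exact if_neg hu

theorem dense_four_mul_notMem (τ : ℍ) : Dense {v : ℂ | 4 * v ∉ (burnsidePeriods τ).lattice} := by
  have hc : Set.Countable {v : ℂ | 4 * v ∈ (burnsidePeriods τ).lattice} := by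
    refine (Set.countable_range fun p : ℤ × ℤ => (p.1 : ℂ) + p.2 * τ).mono fun v hv => ?_
    obtain ⟨m, n, h⟩ := four_mul_mem_burnside_lattice.mp hv
    exact ⟨(m, n), h⟩
  exact hc.dense_compl ℝ

/-- Off the lattice the multipliers are those of `ϑ₁²`, since `℘(4v)` has periods `1` and `τ` in
`v`; density and continuity give the rest. -/
theorem isDegreeTwoTheta_wpTheta (τ : ℍ) (e : ℂ) : IsDegreeTwoTheta τ (wpTheta τ e) := by
  have hd := differentiable_wpTheta τ e
  have hc := hd.continuous
  have hL1 : (4 : ℂ) ∈ (burnsidePeriods τ).lattice := (burnsidePeriods τ).ω₁_mem_lattice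
  have hL2 : 4 * (τ : ℂ) ∈ (burnsidePeriods τ).lattice := (burnsidePeriods τ).ω₂_mem_lattice
  have hsq := isDegreeTwoTheta_sq τ (1 / 2) τ.2 (by
    rw [show 4 * π * I * (1 / 2) = 2 * π * I by ring, Complex.exp_two_pi_mul_I])
  refine ⟨hd, fun v => ?_, fun v => ?_⟩
  · refine congrFun (Continuous.ext_on (dense_four_mul_notMem τ)
      (f := fun v => wpTheta τ e (v + 1)) (by fun_prop) hc fun v hv => ?_) v
    have hv' : 4 * (v + 1) ∉ (burnsidePeriods τ).lattice := fun h => hv (by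
      have := sub_mem h hL1
      rwa [mul_add, mul_one, add_sub_cancel_right] at this)
    have hP := (burnsidePeriods τ).weierstrassP_add_coe (4 * v) ⟨_, hL1⟩
    simp only at hP
    have h1 := hsq.add_one v
    simp only [wpTheta]
    rw [if_neg hv', if_neg hv, h1, mul_add, mul_one, hP]
  · refine congrFun (Continuous.ext_on (dense_four_mul_notMem τ)
      (f := fun v => wpTheta τ e (v + τ))
      (g := fun v => cexp (-(4 * π * I * (τ + v))) * wpTheta τ e v) (by fun_prop) (by fun_prop)
      fun v hv => ?_) v
    have hv' : 4 * (v + τ) ∉ (burnsidePeriods τ).lattice := fun h => hv (by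
      have := sub_mem h hL2
      rwa [mul_add, add_sub_cancel_right] at this)
    have hP := (burnsidePeriods τ).weierstrassP_add_coe (4 * v) ⟨_, hL2⟩
    simp only at hP
    have h1 := hsq.add_tau v
    simp only [wpTheta]
    rw [if_neg hv', if_neg hv, h1, mul_add, hP]
    ring

theorem two_notMem (τ : ℍ) : (2 : ℂ) ∉ (burnsidePeriods τ).lattice := by
  have := notMem_burnside_lattice (τ := τ) (a := 1 / 2) (b := 0) (Or.inl fun m h => by
    have : (2 * m : ℝ) = 1 := by linarith
    have : 2 * m = 1 := by exact_mod_cast this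
    omega)
  convert! this using 1
  push_cast; norm_num

/-- `℘(4v) - e₁` is a constant multiple of `(ϑ₂(v) / ϑ₁(v))²`. -/
theorem exists_weierstrassP_sub_eq (τ : ℍ) : ∃ κ : ℂ, κ ≠ 0 ∧
    ∀ v : ℂ, 4 * v ∉ (burnsidePeriods τ).lattice →
      ((burnsidePeriods τ).weierstrassP (4 * v) - (burnsidePeriods τ).weierstrassP 2) *
        jacobiTheta₂ (v + 1 / 2 + τ / 2) τ ^ 2 = κ * jacobiTheta₂ (v + τ / 2) τ ^ 2 := by
  set L := burnsidePeriods τ with hL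
  set e := L.weierstrassP 2 with he
  have hF := isDegreeTwoTheta_wpTheta τ e
  have hG := isDegreeTwoTheta_sq τ 0 τ.2 (by simp)
  set G : ℂ → ℂ := fun v => jacobiTheta₂ (v + 0 + τ / 2) τ ^ 2 with hGdef
  have hG0 : G 0 ≠ 0 := by
    simp only [hGdef, zero_add]
    rw [jacobiTheta₂_half_eq]
    exact pow_ne_zero 2 (mul_ne_zero (Complex.exp_ne_zero _) (theta2_ne_zero τ.2))
  have hGh : G (1 / 2) = 0 := by
    simp only [hGdef, add_zero]
    rw [jacobiTheta₂_half_add_half]; simp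
  have h2 := two_notMem τ
  have e2 : (4 : ℂ) * (1 / 2) = 2 := by norm_num
  have hFh : wpTheta τ e (1 / 2) = 0 := by
    rw [wpTheta, e2, if_neg h2, ← hL, ← he, sub_self, zero_mul]
  -- The combination `G(0) F - F(0) G` vanishes at `0` and, since both `F` and `G` do, at `1/2`; so
  -- it is identically zero.
  have key := (hF.sub_smul hG (G 0) (wpTheta τ e 0)).eq_zero τ.2 (by ring)
    (by rw [hFh, hGh]; ring)
  refine ⟨wpTheta τ e 0 / G 0, div_ne_zero ?_ hG0, fun v hv => ?_⟩
  -- If the constant vanished, `F` would be zero and `℘` constant near `0`, against its double pole.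
  · intro h0
    have hF0 : ∀ v, wpTheta τ e v = 0 := by
      intro v
      have := key v
      rw [h0, zero_mul, sub_zero] at this
      exact (mul_eq_zero.mp this).resolve_left hG0
    have han : AnalyticOnNhd ℂ (fun v => jacobiTheta₂ (v + 1 / 2 + τ / 2) τ) Set.univ :=
      (differentiable_jacobiTheta₂_odd τ).differentiableOn.analyticOnNhd isOpen_univ
    have hne : ∀ᶠ v in 𝓝[≠] (0 : ℂ), jacobiTheta₂ (v + 1 / 2 + τ / 2) τ ≠ 0 := by
      rcases (han 0 (Set.mem_univ _)).eventually_eq_zero_or_eventually_ne_zero with h | h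
      · exfalso
        have hz := han.eqOn_zero_of_preconnected_of_eventuallyEq_zero isPreconnected_univ
          (Set.mem_univ _) h (Set.mem_univ (1 / 2 : ℂ))
        simp only [Pi.zero_apply] at hz
        rw [show (1 : ℂ) / 2 + 1 / 2 + τ / 2 = τ / 2 + 1 by ring, jacobiTheta₂_add_left,
          jacobiTheta₂_half_eq] at hz
        exact mul_ne_zero (Complex.exp_ne_zero _) (theta2_ne_zero τ.2) hz
      · exact h
    have hconst : ∀ᶠ v in 𝓝[≠] (0 : ℂ), L.weierstrassP (4 * v) = e := by
      have hlat : ∀ᶠ v in 𝓝[≠] (0 : ℂ), 4 * v ∈ (↑L.lattice \ {0} : Set ℂ)ᶜ := by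
        refine Filter.Eventually.filter_mono nhdsWithin_le_nhds ?_
        have ht : Tendsto (fun v : ℂ => 4 * v) (𝓝 0) (𝓝 0) := by
          have : Continuous fun v : ℂ => 4 * v := by fun_prop
          simpa using this.tendsto 0
        exact ht.eventually (L.compl_lattice_sdiff_singleton_mem_nhds 0)
      filter_upwards [hne, hlat, self_mem_nhdsWithin] with v hv1 hv2 hv3
      have hv4 : 4 * v ∉ L.lattice := fun h => hv2 ⟨h, by simpa using hv3⟩
      have := hF0 v
      rw [wpTheta, if_neg hv4] at this
      have := (mul_eq_zero.mp this).resolve_right (pow_ne_zero 2 hv1)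
      exact sub_eq_zero.mp this
    have hconst' : L.weierstrassP =ᶠ[𝓝[≠] (0 : ℂ)] fun _ => e := by
      have ht : Tendsto (fun v : ℂ => v / 4) (𝓝[≠] 0) (𝓝[≠] 0) := by
        refine tendsto_nhdsWithin_iff.mpr ⟨?_, ?_⟩
        · have : Continuous fun v : ℂ => v / 4 := by fun_prop
          simpa using (this.tendsto 0).mono_left nhdsWithin_le_nhds
        · filter_upwards [self_mem_nhdsWithin] with v hv
          simpa using hv
      filter_upwards [ht.eventually hconst] with v hv
      rw [← hv]; congr 1; ring
    have ho := L.order_weierstrassP 0 (zero_mem _)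
    rw [meromorphicOrderAt_congr hconst'] at ho
    have h3 : 0 ≤ meromorphicOrderAt (fun _ : ℂ => e) 0 :=
      (analyticAt_const).meromorphicOrderAt_nonneg
    rw [ho] at h3
    exact absurd h3 (by decide)
  · have := key v
    rw [wpTheta, if_neg hv] at this
    simp only [hGdef, add_zero] at this hG0 ⊢
    rw [div_mul_eq_mul_div, eq_div_iff hG0]
    linear_combination this

/-! ### Theta values at the division points. -/

theorem half_im_pos {τ : ℂ} (hτ : 0 < τ.im) : 0 < (τ / 2).im := by
  have : (τ / 2).im = τ.im / 2 := by simp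
  rw [this]; positivity

/-- Multiplied by the theta value at `1/4 + τ/2`, the product formula leaves an exponential times
`θ₂(2τ)θ₄(2τ)`, which has no zeros. -/
theorem jacobiTheta₂_quarter_ne_zero {τ : ℂ} (hτ : 0 < τ.im) :
    jacobiTheta₂ (1 / 4 + 1 / 2 + τ / 2) τ ≠ 0 := by
  intro h0
  have h := jacobiTheta₂_mul_jacobiTheta₂ (1 / 4 + τ / 2) (1 / 4 + 1 / 2 + τ / 2) hτ
  have h2 := two_mul_im_pos hτ
  rw [h0, mul_zero, show (1 : ℂ) / 4 + τ / 2 + (1 / 4 + 1 / 2 + τ / 2) = τ + 1 by ring,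
    show (1 : ℂ) / 4 + τ / 2 - (1 / 4 + 1 / 2 + τ / 2) = -(1 / 2) by ring,
    show -(1 / 2) + τ = 1 / 2 + 2 * τ / 2 + -1 by ring,
    ← jacobiTheta₂_add_left (1 / 2 + 2 * τ / 2 + -1),
    show 1 / 2 + 2 * τ / 2 + -1 + 1 = 1 / 2 + 2 * τ / 2 by ring,
    jacobiTheta₂_half_add_half, mul_zero, mul_zero, add_zero, jacobiTheta₂_add_left,
    jacobiTheta₂_neg_left, jacobiTheta₂_tau_two_mul] at h
  exact mul_ne_zero (mul_ne_zero (Complex.exp_ne_zero _) (theta2_ne_zero h2))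
    (theta4_ne_zero h2) h.symm

/-- Evenness and the shift by `1` relate the two arguments by `τ`; the quasi-periodicity factor
squares to `e^{-πi} = -1`. -/
theorem jacobiTheta₂_quarter_sq (τ : ℂ) :
    jacobiTheta₂ (1 / 4 + τ / 2) τ ^ 2 = -jacobiTheta₂ (1 / 4 + 1 / 2 + τ / 2) τ ^ 2 := by
  have h := jacobiTheta₂_add_left' (1 / 4 - τ / 2) τ
  rw [← jacobiTheta₂_neg_left (1 / 4 + 1 / 2 + τ / 2),
    ← jacobiTheta₂_add_left (-(1 / 4 + 1 / 2 + τ / 2)),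
    show -(1 / 4 + 1 / 2 + τ / 2) + 1 = 1 / 4 - τ / 2 by ring]
  rw [show 1 / 4 - τ / 2 + τ = 1 / 4 + τ / 2 by ring] at h
  rw [h, mul_pow, ← Complex.exp_nat_mul,
    show ((2 : ℕ) : ℂ) * (-π * I * (τ + 2 * (1 / 4 - τ / 2))) = -(π * I) by push_cast; ring,
    Complex.exp_neg, Complex.exp_pi_mul_I]
  norm_num

/-- Even-odd splitting at modulus `τ/2` expresses `θ₂(τ/2)`, up to an exponential, through this
value alone. -/
theorem jacobiTheta₂_half_two_mul_ne_zero {τ : ℂ} (hτ : 0 < τ.im) :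
    jacobiTheta₂ (τ / 2) (2 * τ) ≠ 0 := by
  intro h0
  have h2 := half_im_pos hτ
  have h := jacobiTheta₂_eq_add (τ / 2 / 2) h2
  have h3 := jacobiTheta₂_add_left' (-(τ / 2)) (2 * τ)
  rw [jacobiTheta₂_neg_left, h0, mul_zero] at h3
  rw [show 4 * (τ / 2) = 2 * τ by ring, show 2 * (τ / 2 / 2) = τ / 2 by ring, h0,
    show τ / 2 + 2 * (τ / 2) = -(τ / 2) + 2 * τ by ring, h3, jacobiTheta₂_half_eq, mul_zero,
    add_zero] at h
  exact mul_ne_zero (Complex.exp_ne_zero _) (theta2_ne_zero h2) h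

theorem jacobiTheta₂_three_halves (τ : ℂ) :
    jacobiTheta₂ (3 * τ / 2) (2 * τ) = cexp (-(π * I * τ)) * jacobiTheta₂ (τ / 2) (2 * τ) := by
  have h := jacobiTheta₂_add_left' (-(τ / 2)) (2 * τ)
  rw [jacobiTheta₂_neg_left, show -(τ / 2) + 2 * τ = 3 * τ / 2 by ring] at h
  rw [h]; congr 2; ring

theorem jacobiTheta₂_five_halves (τ : ℂ) :
    jacobiTheta₂ (5 * τ / 2) (2 * τ) = cexp (-(3 * π * I * τ)) * jacobiTheta₂ (τ / 2) (2 * τ) := by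
  have h := jacobiTheta₂_add_left' (τ / 2) (2 * τ)
  rw [show (τ / 2) + 2 * τ = 5 * τ / 2 by ring] at h
  rw [h]; congr 2; ring

/-- The product formula with equal arguments produces `θ₃(2τ) + θ₂(2τ) = θ₃(τ/2)`; in the companion
formula shifted by `1/2` the sign changes and gives `θ₄(τ/2)`. The quotient of the two is where
`x(τ/2)` enters Burnside's function. -/
theorem jacobiTheta₂_three_quarters_sq {τ : ℂ} (hτ : 0 < τ.im) :
    jacobiTheta₂ (τ / 4 + τ / 2) τ ^ 2 =
      cexp (-(π * I * τ)) * jacobiTheta₂ (τ / 2) (2 * τ) * theta3 (τ / 2) := by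
  have h := jacobiTheta₂_mul_jacobiTheta₂ (τ / 4 + τ / 2) (τ / 4 + τ / 2) hτ
  have h3 := theta3_eq_add (half_im_pos hτ)
  rw [show 4 * (τ / 2) = 2 * τ by ring] at h3
  rw [sub_self, zero_add, show τ / 4 + τ / 2 + (τ / 4 + τ / 2) = 3 * τ / 2 by ring,
    show 3 * τ / 2 + τ = 5 * τ / 2 by ring, jacobiTheta₂_three_halves, jacobiTheta₂_five_halves,
    jacobiTheta₂_tau_two_mul, ← theta3_eq] at h
  have e : cexp (2 * π * I * (τ / 4 + τ / 2) + π * I * τ) *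
      (cexp (-(3 * π * I * τ)) * cexp (-(π * I * τ / 2))) = cexp (-(π * I * τ)) := by
    rw [← Complex.exp_add, ← Complex.exp_add]; congr 1; ring
  rw [sq, h, h3]
  linear_combination jacobiTheta₂ (τ / 2) (2 * τ) * theta2 (2 * τ) * e

theorem jacobiTheta₂_three_quarters_add_half_sq {τ : ℂ} (hτ : 0 < τ.im) :
    jacobiTheta₂ (τ / 4 + 1 / 2 + τ / 2) τ ^ 2 =
      cexp (-(π * I * τ)) * jacobiTheta₂ (τ / 2) (2 * τ) * theta4 (τ / 2) := by
  have h := jacobiTheta₂_mul_jacobiTheta₂ (τ / 4 + 1 / 2 + τ / 2) (τ / 4 + 1 / 2 + τ / 2) hτ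
  have h3 := theta4_eq_sub (half_im_pos hτ)
  rw [show 4 * (τ / 2) = 2 * τ by ring] at h3
  rw [sub_self, zero_add,
    show τ / 4 + 1 / 2 + τ / 2 + (τ / 4 + 1 / 2 + τ / 2) = 3 * τ / 2 + 1 by ring,
    show 3 * τ / 2 + 1 + τ = 5 * τ / 2 + 1 by ring, jacobiTheta₂_add_left, jacobiTheta₂_add_left,
    jacobiTheta₂_three_halves, jacobiTheta₂_five_halves,
    jacobiTheta₂_tau_two_mul, ← theta3_eq] at h
  have e : cexp (2 * π * I * (τ / 4 + 1 / 2 + τ / 2) + π * I * τ) *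
      (cexp (-(3 * π * I * τ)) * cexp (-(π * I * τ / 2))) = -cexp (-(π * I * τ)) := by
    rw [← Complex.exp_add, ← Complex.exp_add, ← neg_one_mul (cexp (-(π * I * τ))),
      ← Complex.exp_pi_mul_I, ← Complex.exp_add]
    congr 1; ring
  rw [sq, h, h3]
  linear_combination jacobiTheta₂ (τ / 2) (2 * τ) * theta2 (2 * τ) * e

theorem jacobiTheta₂_half_add_self (τ : ℂ) :
    jacobiTheta₂ (1 / 2 + τ) τ = -cexp (-(π * I * τ)) * theta4 τ := by
  rw [jacobiTheta₂_add_left', theta4, show -π * I * (τ + 2 * (1 / 2)) = -(π * I * τ) + -(π * I) by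
    ring, Complex.exp_add, Complex.exp_neg (π * I), Complex.exp_pi_mul_I]
  norm_num

/-- The values of `℘ - ℘(2)` at the division points, in terms of `x`. -/
theorem exists_weierstrassP_values (τ : ℍ) : ∃ κ : ℂ, κ ≠ 0 ∧
    (burnsidePeriods τ).weierstrassP 1 - (burnsidePeriods τ).weierstrassP 2 = -κ ∧
    (burnsidePeriods τ).weierstrassP τ - (burnsidePeriods τ).weierstrassP 2
      = κ / xFun (τ / 2) ∧
    (burnsidePeriods τ).weierstrassP (2 * τ) - (burnsidePeriods τ).weierstrassP 2
      = κ / xFun τ ^ 2 ∧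
    (burnsidePeriods τ).weierstrassP (2 + 2 * τ) - (burnsidePeriods τ).weierstrassP 2
      = κ * xFun τ ^ 2 := by
  obtain ⟨κ, hκ, h⟩ := exists_weierstrassP_sub_eq τ
  have hτ : 0 < (τ : ℂ).im := τ.2
  have hτ2 := half_im_pos hτ
  have hE := Complex.exp_ne_zero (-(π * I * τ))
  have h3 := theta3_ne_zero hτ
  have h4 := theta4_ne_zero hτ
  have nint : ∀ (p q : ℕ), 1 < q → p.Coprime q → ∀ m : ℤ, (m : ℝ) ≠ (p : ℝ) / q := by
    intro p q hq hpq m hm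
    have hq0 : (q : ℝ) ≠ 0 := by positivity
    rw [eq_div_iff hq0] at hm
    have hm' : m * q = p := by exact_mod_cast hm
    have hd : (q : ℤ) ∣ p := ⟨m, by rw [← hm']; ring⟩
    have := Nat.Coprime.eq_one_of_dvd hpq.symm (by exact_mod_cast hd)
    omega
  refine ⟨κ, hκ, ?_, ?_, ?_, ?_⟩
  · have hv := h (1 / 4) (by
      have := notMem_burnside_lattice (τ := τ) (a := (1 : ℕ) / (4 : ℕ)) (b := 0)
        (Or.inl (nint 1 4 (by norm_num) (by norm_num)))
      convert! this using 2; push_cast; ring)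
    rw [show (4 : ℂ) * (1 / 4) = 1 by norm_num, jacobiTheta₂_quarter_sq] at hv
    refine mul_right_cancel₀ (pow_ne_zero 2 (jacobiTheta₂_quarter_ne_zero hτ)) ?_
    rw [hv]; ring
  · have hv := h (τ / 4) (by
      have := notMem_burnside_lattice (τ := τ) (a := 0) (b := (1 : ℕ) / (4 : ℕ))
        (Or.inr (nint 1 4 (by norm_num) (by norm_num)))
      convert! this using 2; push_cast; ring)
    rw [show 4 * ((τ : ℂ) / 4) = τ by ring, jacobiTheta₂_three_quarters_sq hτ,
      jacobiTheta₂_three_quarters_add_half_sq hτ] at hv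
    have hne := mul_ne_zero hE (jacobiTheta₂_half_two_mul_ne_zero hτ)
    have h42 := theta4_ne_zero hτ2
    rw [xFun, div_div_eq_mul_div, eq_div_iff h42]
    refine mul_left_cancel₀ hne ?_
    linear_combination hv
  · have hv := h (τ / 2) (by
      have := notMem_burnside_lattice (τ := τ) (a := 0) (b := (1 : ℕ) / (2 : ℕ))
        (Or.inr (nint 1 2 (by norm_num) (by norm_num)))
      convert! this using 2; push_cast; ring)
    rw [show 4 * ((τ : ℂ) / 2) = 2 * τ by ring, show (τ : ℂ) / 2 + 1 / 2 + τ / 2 = 1 / 2 + τ by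
      ring, show (τ : ℂ) / 2 + τ / 2 = τ by ring, jacobiTheta₂_half_add_self,
      jacobiTheta₂_self] at hv
    rw [xFun, div_pow, div_div_eq_mul_div, eq_div_iff (pow_ne_zero 2 h4)]
    refine mul_left_cancel₀ (pow_ne_zero 2 hE) ?_
    linear_combination hv
  · have hv := h (1 / 2 + τ / 2) (by
      have := notMem_burnside_lattice (τ := τ) (a := (1 : ℕ) / (2 : ℕ)) (b := (1 : ℕ) / (2 : ℕ))
        (Or.inr (nint 1 2 (by norm_num) (by norm_num)))
      convert! this using 2; push_cast; ring)
    rw [show 4 * (1 / 2 + (τ : ℂ) / 2) = 2 + 2 * τ by ring,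
      show 1 / 2 + (τ : ℂ) / 2 + 1 / 2 + τ / 2 = τ + 1 by ring,
      show 1 / 2 + (τ : ℂ) / 2 + τ / 2 = 1 / 2 + τ by ring, jacobiTheta₂_half_add_self,
      jacobiTheta₂_add_left, jacobiTheta₂_self] at hv
    rw [xFun, div_pow, mul_div_assoc', eq_div_iff (pow_ne_zero 2 h3)]
    refine mul_left_cancel₀ (pow_ne_zero 2 hE) ?_
    linear_combination hv

/-- `x` is Burnside's function. -/
theorem burnsideChi_eq (τ : ℍ) : burnsideChi τ = -xFun ((τ : ℂ) / 2) := by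
  obtain ⟨κ, hκ, h1, h2, -⟩ := exists_weierstrassP_values τ
  rw [burnsideChi, h1, h2]
  have := xFun_ne_zero (half_im_pos τ.2)
  field_simp

/-! ### Lattices with the same invariants -/

theorem weierstrassP_homogeneous {L L' : PeriodPair} {c : ℂ}
    (h : ∀ z, z ∈ L'.lattice ↔ c * z ∈ L.lattice) (hc : c ≠ 0) (z : ℂ) :
    L'.weierstrassP z = c ^ 2 * L.weierstrassP (c * z) := by
  let e : L'.lattice ≃ L.lattice :=
    { toFun := fun l => ⟨c * l, (h l).mp l.2⟩
      invFun := fun l => ⟨c⁻¹ * l, (h _).mpr (by rw [mul_inv_cancel_left₀ hc]; exact l.2)⟩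
      left_inv := fun l => by ext; simp [hc]
      right_inv := fun l => by ext; simp [hc] }
  rw [PeriodPair.weierstrassP, PeriodPair.weierstrassP, ← tsum_mul_left, ← e.tsum_eq]
  refine tsum_congr fun l => ?_
  have he : ((e l : L.lattice) : ℂ) = c * l := rfl
  rw [he, ← mul_sub, mul_pow, mul_pow, mul_sub, mul_one_div, mul_one_div,
    div_mul_cancel_left₀ (pow_ne_zero 2 hc), div_mul_cancel_left₀ (pow_ne_zero 2 hc),
    one_div, one_div]

/-- Two solutions of the Weierstrass equation with the principal part `1/z²` agree. -/
theorem weierstrass_unique {p q : ℂ → ℂ} {g₂ g₃ : ℂ} (hp : AnalyticAt ℂ p 0)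
    (hq : AnalyticAt ℂ q 0)
    (hP : ∀ᶠ z in 𝓝[≠] (0 : ℂ), (-2 / z ^ 3 + deriv p z) ^ 2 =
      4 * (1 / z ^ 2 + p z) ^ 3 - g₂ * (1 / z ^ 2 + p z) - g₃)
    (hQ : ∀ᶠ z in 𝓝[≠] (0 : ℂ), (-2 / z ^ 3 + deriv q z) ^ 2 =
      4 * (1 / z ^ 2 + q z) ^ 3 - g₂ * (1 / z ^ 2 + q z) - g₃) :
    ∀ᶠ z in 𝓝 (0 : ℂ), p z = q z := by
  have hd : AnalyticAt ℂ (fun z => p z - q z) 0 := hp.sub hq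
  by_contra hne
  have hne' : ¬ ∀ᶠ z in 𝓝 (0 : ℂ), p z - q z = 0 := by simpa only [sub_eq_zero] using hne
  obtain ⟨n, u, hu, hu0, hdu⟩ := hd.exists_eventuallyEq_pow_smul_nonzero_iff.mpr hne'
  simp only [sub_zero, smul_eq_mul] at hdu
  have hderiv : ∀ᶠ z in 𝓝 (0 : ℂ), deriv p z - deriv q z =
      n * z ^ (n - 1) * u z + z ^ n * deriv u z := by
    filter_upwards [hdu.eventually_nhds, hp.eventually_analyticAt, hq.eventually_analyticAt,
      hu.eventually_analyticAt] with z hz hpz hqz huz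
    rw [← deriv_fun_sub hpz.differentiableAt hqz.differentiableAt,
      Filter.EventuallyEq.deriv_eq hz]
    exact (((hasDerivAt_pow n z).mul huz.differentiableAt.hasDerivAt).congr_deriv (by ring)).deriv
  -- With `p - q = zⁿ u` and `u(0) ≠ 0`, the difference of the two equations is divisible by `zⁿ`.
  -- At `z = 0` the quotient reads `-4n u(0) = 12 u(0)`, impossible for a natural number `n`.
  have key : ∀ᶠ z in 𝓝[≠] (0 : ℂ),
      (-4 + z ^ 3 * (deriv p z + deriv q z)) * (n * u z + z * deriv u z) =
      (4 * ((1 + z ^ 2 * p z) ^ 2 + (1 + z ^ 2 * p z) * (1 + z ^ 2 * q z)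
        + (1 + z ^ 2 * q z) ^ 2) - g₂ * z ^ 4) * u z := by
    filter_upwards [hP, hQ, hdu.filter_mono nhdsWithin_le_nhds,
      hderiv.filter_mono nhdsWithin_le_nhds, self_mem_nhdsWithin] with z h1 h2 h3 h4 hz
    have hz' : z ≠ 0 := hz
    have h5 : z * (deriv p z - deriv q z) = z ^ n * (n * u z + z * deriv u z) := by
      rw [h4]
      rcases Nat.eq_zero_or_pos n with rfl | hn
      · simp
      · obtain ⟨k, rfl⟩ := Nat.exists_eq_succ_of_ne_zero hn.ne'
        simp only [Nat.succ_sub_one, pow_succ]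
        ring
    have h6 : (-4 / z ^ 3 + (deriv p z + deriv q z)) * (deriv p z - deriv q z) =
        (4 * ((1 / z ^ 2 + p z) ^ 2 + (1 / z ^ 2 + p z) * (1 / z ^ 2 + q z)
        + (1 / z ^ 2 + q z) ^ 2) - g₂) * (p z - q z) := by
      linear_combination h1 - h2
    refine mul_left_cancel₀ (pow_ne_zero n hz') ?_
    have h7 : z ^ 3 * (-4 / z ^ 3) = -4 := by field_simp
    have h8 : z ^ 2 * (1 / z ^ 2) = 1 := by field_simp
    calc z ^ n * ((-4 + z ^ 3 * (deriv p z + deriv q z)) * (n * u z + z * deriv u z))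
        = (-4 + z ^ 3 * (deriv p z + deriv q z)) * (z ^ n * (n * u z + z * deriv u z)) := by ring
      _ = z ^ 4 * ((-4 / z ^ 3 + (deriv p z + deriv q z)) * (deriv p z - deriv q z)) := by
        rw [← h5]; linear_combination (-(z * (deriv p z - deriv q z))) * h7
      _ = _ := by
        have e1 : z ^ 2 * (1 / z ^ 2 + p z) = 1 + z ^ 2 * p z := by
          linear_combination h8
        have e2 : z ^ 2 * (1 / z ^ 2 + q z) = 1 + z ^ 2 * q z := by
          linear_combination h8
        rw [h6, h3, ← e1, ← e2]; ring
  have c1 := hp.deriv.continuousAt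
  have c2 := hq.deriv.continuousAt
  have c3 := hu.deriv.continuousAt
  have c4 := hp.continuousAt
  have c5 := hq.continuousAt
  have c6 := hu.continuousAt
  have l1 : Tendsto (fun z : ℂ => (-4 + z ^ 3 * (deriv p z + deriv q z)) *
      (n * u z + z * deriv u z)) (𝓝[≠] 0) (𝓝 _) :=
    (ContinuousAt.tendsto (by fun_prop)).mono_left nhdsWithin_le_nhds
  have l2 : Tendsto (fun z : ℂ => (4 * ((1 + z ^ 2 * p z) ^ 2 +
      (1 + z ^ 2 * p z) * (1 + z ^ 2 * q z)
        + (1 + z ^ 2 * q z) ^ 2) - g₂ * z ^ 4) * u z) (𝓝[≠] 0) (𝓝 _) :=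
    (ContinuousAt.tendsto (by fun_prop)).mono_left nhdsWithin_le_nhds
  have heq := tendsto_nhds_unique (l1.congr' key) l2
  simp only [ne_eq, OfNat.ofNat_ne_zero, not_false_eq_true, zero_pow, zero_mul, add_zero,
    mul_zero, sub_zero] at heq
  have h9 : ((n : ℂ) + 3) * u 0 = 0 := by linear_combination (-1 / 4 : ℂ) * heq
  rcases mul_eq_zero.mp h9 with h | h
  · have : ((n + 3 : ℕ) : ℂ) = 0 := by push_cast; exact h
    exact absurd (Nat.cast_eq_zero.mp this) (by omega)
  · exact hu0 h

theorem weierstrassPExcept_zero_add (L : PeriodPair) (z : ℂ) :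
    L.weierstrassP z = 1 / z ^ 2 + L.weierstrassPExcept 0 z := by
  have := L.weierstrassPExcept_add ⟨0, zero_mem _⟩ z
  simp only [sub_zero] at this
  rw [← this]; simp; ring

theorem eventually_notMem_lattice (L : PeriodPair) {c : ℂ} (hc : c ≠ 0) :
    ∀ᶠ z in 𝓝[≠] (0 : ℂ), c * z ∉ L.lattice := by
  have ht : Tendsto (fun z : ℂ => c * z) (𝓝 0) (𝓝 0) := by
    have : Continuous fun v : ℂ => c * v := by fun_prop
    simpa using this.tendsto 0
  have := (ht.eventually (L.compl_lattice_sdiff_singleton_mem_nhds 0)).filter_mono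
    (nhdsWithin_le_nhds (s := {0}ᶜ))
  filter_upwards [this, self_mem_nhdsWithin] with z hz hz0 hmem
  exact hz ⟨hmem, by simpa [hc] using hz0⟩

/-- The equation of `c² ℘(cz)` is written through its regular part at `0`, the form to which
`weierstrass_unique` applies. -/
theorem weierstrassP_scaled_equation (L : PeriodPair) {c : ℂ} (hc : c ≠ 0) :
    AnalyticAt ℂ (fun z => c ^ 2 * L.weierstrassPExcept 0 (c * z)) 0 ∧
    ∀ᶠ z in 𝓝[≠] (0 : ℂ),
      (-2 / z ^ 3 + deriv (fun z => c ^ 2 * L.weierstrassPExcept 0 (c * z)) z) ^ 2 =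
      4 * (1 / z ^ 2 + c ^ 2 * L.weierstrassPExcept 0 (c * z)) ^ 3
        - (c ^ 4 * L.g₂) * (1 / z ^ 2 + c ^ 2 * L.weierstrassPExcept 0 (c * z))
        - c ^ 6 * L.g₃ := by
  have han : AnalyticAt ℂ (fun z => c ^ 2 * L.weierstrassPExcept 0 (c * z)) 0 := by
    have h1 : AnalyticAt ℂ (L.weierstrassPExcept 0) (c * 0) := by
      rw [mul_zero]; exact L.analyticAt_weierstrassPExcept 0
    exact analyticAt_const.mul (h1.comp (f := fun z => c * z) (by fun_prop))
  refine ⟨han, ?_⟩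
  filter_upwards [eventually_notMem_lattice L hc, self_mem_nhdsWithin,
    han.eventually_analyticAt.filter_mono nhdsWithin_le_nhds] with z hz hz0 hanz
  have hz0 : z ≠ 0 := hz0
  have hfun : (fun z => c ^ 2 * L.weierstrassPExcept 0 (c * z)) =ᶠ[𝓝 z]
      fun z => c ^ 2 * L.weierstrassP (c * z) - 1 / z ^ 2 := by
    filter_upwards [isOpen_ne.mem_nhds hz0] with w hw
    rw [weierstrassPExcept_zero_add]
    have : w ≠ 0 := hw
    field_simp
    ring
  have hval := hfun.eq_of_nhds
  have hderiv : deriv (fun z => c ^ 2 * L.weierstrassPExcept 0 (c * z)) z =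
      c ^ 3 * L.derivWeierstrassP (c * z) + 2 / z ^ 3 := by
    rw [hfun.deriv_eq]
    have h1 : HasDerivAt L.weierstrassP (L.derivWeierstrassP (c * z)) (c * z) := by
      rw [← L.deriv_weierstrassP]
      exact (L.analyticOnNhd_weierstrassP _ hz).differentiableAt.hasDerivAt
    have h2 : HasDerivAt (fun z => L.weierstrassP (c * z)) (L.derivWeierstrassP (c * z) * c) z := by
      have h3 : HasDerivAt (fun z : ℂ => c * z) c z := by
        simpa using (hasDerivAt_id z).const_mul c
      exact h1.comp z h3
    have h4 : HasDerivAt (fun z : ℂ => 1 / z ^ 2) (-2 / z ^ 3) z := by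
      have := ((hasDerivAt_pow 2 z).inv (pow_ne_zero 2 hz0))
      simp only [one_div]
      refine this.congr_deriv ?_
      field_simp
      norm_num
      ring
    refine ((h2.const_mul (c ^ 2)).sub h4).deriv.trans ?_
    field_simp
    ring
  rw [hderiv, hval]
  have := L.derivWeierstrassP_sq _ hz
  linear_combination c ^ 6 * this

theorem weierstrassP_eq_of_invariants {L L' : PeriodPair} {c : ℂ} (hc : c ≠ 0)
    (h2 : L'.g₂ = c ^ 4 * L.g₂) (h3 : L'.g₃ = c ^ 6 * L.g₃) :
    ∀ᶠ z in 𝓝 (0 : ℂ), L'.weierstrassP z = c ^ 2 * L.weierstrassP (c * z) := by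
  obtain ⟨a1, e1⟩ := weierstrassP_scaled_equation L hc
  obtain ⟨a2, e2⟩ := weierstrassP_scaled_equation L' one_ne_zero
  simp only [one_pow, one_mul, h2, h3] at a2 e2
  filter_upwards [weierstrass_unique a2 a1 e2 e1] with z hz
  rw [weierstrassPExcept_zero_add, hz, weierstrassPExcept_zero_add]
  by_cases hz0 : z = 0
  · simp [hz0]
  · field_simp

theorem countable_lattice (L : PeriodPair) : (L.lattice : Set ℂ).Countable := by
  refine (Set.countable_range fun p : ℤ × ℤ => (p.1 : ℂ) * L.ω₁ + p.2 * L.ω₂).mono fun v hv => ?_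
  obtain ⟨m, n, h⟩ := PeriodPair.mem_lattice.mp hv
  exact ⟨(m, n), h⟩

/-- The functions `℘_{L'}(z)` and `c² ℘_L(cz)` agree near `0`, hence on the complement of the
countable set of their lattice points, which is connected. So a pole of the first must be a pole of
the second. -/
theorem lattice_subset_of_invariants {L L' : PeriodPair} {c : ℂ} (hc : c ≠ 0)
    (h2 : L'.g₂ = c ^ 4 * L.g₂) (h3 : L'.g₃ = c ^ 6 * L.g₃) {z₀ : ℂ} (hz₀ : z₀ ∈ L'.lattice) :
    c * z₀ ∈ L.lattice := by
  by_contra hnot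
  set C : Set ℂ := L'.lattice ∪ (fun z => c * z) ⁻¹' L.lattice with hC
  have hCc : C.Countable := (countable_lattice L').union
    ((countable_lattice L).preimage (mul_right_injective₀ hc))
  have hCcl : IsClosed C := L'.isClosed_lattice.union
    (L.isClosed_lattice.preimage (by fun_prop))
  have hpre : IsPreconnected Cᶜ :=
    (hCc.isConnected_compl_of_one_lt_rank (by rw [Complex.rank_real_complex]; norm_num)).isPreconnected
  have hQan : ∀ z, c * z ∉ L.lattice → AnalyticAt ℂ (fun z => c ^ 2 * L.weierstrassP (c * z)) z :=
    fun z hz => analyticAt_const.mul ((L.analyticOnNhd_weierstrassP _ hz).comp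
      (f := fun z => c * z) (by fun_prop))
  have hloc := weierstrassP_eq_of_invariants hc h2 h3
  obtain ⟨z₁, hz₁, hz₁'⟩ : ∃ z₁, z₁ ∈ Cᶜ ∧
      L'.weierstrassP =ᶠ[𝓝 z₁] fun z => c ^ 2 * L.weierstrassP (c * z) := by
    have n1 := eventually_notMem_lattice L hc
    have n2 := eventually_notMem_lattice L' one_ne_zero
    have n3 := hloc.eventually_nhds.filter_mono (nhdsWithin_le_nhds (s := {0}ᶜ))
    obtain ⟨z, ha, hb, hc⟩ := (n1.and (n2.and n3)).exists
    rw [one_mul] at hb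
    exact ⟨z, fun h => h.elim hb ha, hc⟩
  have heq := AnalyticOnNhd.eqOn_of_preconnected_of_eventuallyEq
    (f := L'.weierstrassP) (g := fun z => c ^ 2 * L.weierstrassP (c * z)) (U := Cᶜ)
    (fun z hz => L'.analyticOnNhd_weierstrassP z fun h => hz (Or.inl h))
    (fun z hz => hQan z fun h => hz (Or.inr h)) hpre hz₁ hz₁'
  have hev : L'.weierstrassP =ᶠ[𝓝[≠] z₀] fun z => c ^ 2 * L.weierstrassP (c * z) := by
    have m1 := (L'.compl_lattice_sdiff_singleton_mem_nhds z₀)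
    have m2 : ∀ᶠ z in 𝓝 z₀, c * z ∉ L.lattice :=
      (Continuous.tendsto (f := fun z : ℂ => c * z) (by fun_prop) z₀).eventually
        (L.isClosed_lattice.isOpen_compl.mem_nhds hnot)
    filter_upwards [nhdsWithin_le_nhds m1, m2.filter_mono nhdsWithin_le_nhds,
      self_mem_nhdsWithin] with z a b d
    exact heq fun h => h.elim (fun h => a ⟨h, d⟩) b
  have ho := L'.order_weierstrassP z₀ hz₀
  rw [meromorphicOrderAt_congr hev] at ho
  have h3 := (hQan z₀ hnot).meromorphicOrderAt_nonneg
  rw [ho] at h3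
  exact absurd h3 (by decide)

/-- Lattices with proportional invariants are homothetic. -/
theorem mem_lattice_iff_of_invariants {L L' : PeriodPair} {c : ℂ} (hc : c ≠ 0)
    (h2 : L'.g₂ = c ^ 4 * L.g₂) (h3 : L'.g₃ = c ^ 6 * L.g₃) (z : ℂ) :
    z ∈ L'.lattice ↔ c * z ∈ L.lattice := by
  refine ⟨lattice_subset_of_invariants hc h2 h3, fun h => ?_⟩
  have := lattice_subset_of_invariants (inv_ne_zero hc) (L := L') (L' := L)
    (by rw [h2]; field_simp) (by rw [h3]; field_simp) h
  rwa [inv_mul_cancel_left₀ hc] at this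

/-- `℘'` is odd and periodic, so it vanishes at half-periods. -/
theorem weierstrassP_half_period (L : PeriodPair) {w : ℂ} (hw : w ∉ L.lattice)
    (h2w : 2 * w ∈ L.lattice) :
    4 * L.weierstrassP w ^ 3 - L.g₂ * L.weierstrassP w - L.g₃ = 0 := by
  have h1 := L.derivWeierstrassP_add_coe (-w) ⟨2 * w, h2w⟩
  simp only at h1
  rw [show -w + 2 * w = w by ring, L.derivWeierstrassP_neg] at h1
  have h0 : L.derivWeierstrassP w = 0 := by linear_combination h1 / 2
  rw [← L.derivWeierstrassP_sq w hw, h0]; ring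

theorem invariants_eq_of_roots {a b c g₂ g₃ : ℂ} (ha : 4 * a ^ 3 - g₂ * a - g₃ = 0)
    (hb : 4 * b ^ 3 - g₂ * b - g₃ = 0) (hc : 4 * c ^ 3 - g₂ * c - g₃ = 0)
    (hab : a ≠ b) (hac : a ≠ c) (hbc : b ≠ c) :
    a + b + c = 0 ∧ g₂ = 4 * (a ^ 2 + a * b + b ^ 2) ∧ g₃ = -4 * (a * b * (a + b)) := by
  have h1 : 4 * (a ^ 2 + a * b + b ^ 2) - g₂ = 0 := by
    refine mul_left_cancel₀ (sub_ne_zero.mpr hab) ?_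
    linear_combination ha - hb
  have h2 : 4 * (a ^ 2 + a * c + c ^ 2) - g₂ = 0 := by
    refine mul_left_cancel₀ (sub_ne_zero.mpr hac) ?_
    linear_combination ha - hc
  have h3 : a + b + c = 0 := by
    refine mul_left_cancel₀ (sub_ne_zero.mpr hbc) ?_
    linear_combination (h1 - h2) / 4
  refine ⟨h3, by linear_combination -h1, ?_⟩
  linear_combination -ha + a * h1

/-! ### Fibres of `x⁴` and of Burnside's function -/

theorem coe_SL2Z_smul (γ : SL(2, ℤ)) (τ : ℍ) :
    ((γ • τ : ℍ) : ℂ) = ((γ 0 0 : ℂ) * τ + (γ 0 1 : ℂ)) / ((γ 1 0 : ℂ) * τ + (γ 1 1 : ℂ)) := by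
  rw [UpperHalfPlane.coe_specialLinearGroup_apply]; simp

theorem coe_SL2R_smul (γ : SL(2, ℝ)) (τ : ℍ) :
    ((γ • τ : ℍ) : ℂ) = ((γ 0 0 : ℂ) * τ + (γ 0 1 : ℂ)) / ((γ 1 0 : ℂ) * τ + (γ 1 1 : ℂ)) := by
  rw [UpperHalfPlane.coe_specialLinearGroup_apply]; simp

theorem int_mul_add_ne_zero {c d : ℤ} (h : c ≠ 0 ∨ d ≠ 0) (τ : ℍ) : (c : ℂ) * τ + d ≠ 0 := by
  intro h0
  have := add_mul_eq_zero (τ := τ) (a := d) (b := c) (by push_cast; linear_combination h0)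
  rcases h with h | h
  · exact h (by exact_mod_cast this.2)
  · exact h (by exact_mod_cast this.1)

theorem det_eq (γ : SL(2, ℤ)) : γ 0 0 * γ 1 1 - γ 0 1 * γ 1 0 = 1 := by
  rw [← Matrix.det_fin_two]; exact γ.2

theorem exists_SL2Z {a b c d : ℤ} (h : a * d - b * c = 1) :
    ∃ γ : SL(2, ℤ), γ 0 0 = a ∧ γ 0 1 = b ∧ γ 1 0 = c ∧ γ 1 1 = d :=
  ⟨⟨!![a, b; c, d], by rw [Matrix.det_fin_two_of]; exact h⟩, rfl, rfl, rfl, rfl⟩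

theorem SL2Z_denom_ne_zero (γ : SL(2, ℤ)) (τ : ℍ) : (γ 1 0 : ℂ) * τ + (γ 1 1 : ℂ) ≠ 0 := by
  refine int_mul_add_ne_zero ?_ τ
  by_contra! h
  have := det_eq γ
  rw [h.1, h.2] at this
  simp at this

theorem weierstrassP_add_lattice (τ : ℍ) (z : ℂ) (m n : ℤ) :
    (burnsidePeriods τ).weierstrassP (z + 4 * (m + n * τ)) =
      (burnsidePeriods τ).weierstrassP z :=
  (burnsidePeriods τ).weierstrassP_add_coe z
    ⟨4 * (m + n * τ), four_mul_mem_burnside_lattice.mpr ⟨m, n, rfl⟩⟩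

theorem mem_burnside_lattice_smul (γ : SL(2, ℤ)) (τ : ℍ) (z : ℂ) :
    z ∈ (burnsidePeriods (γ • τ)).lattice ↔
      ((γ 1 0 : ℂ) * τ + (γ 1 1 : ℂ)) * z ∈ (burnsidePeriods τ).lattice := by
  have hd := SL2Z_denom_ne_zero γ τ
  have hdet : (γ 0 0 : ℂ) * γ 1 1 - γ 0 1 * γ 1 0 = 1 := by exact_mod_cast det_eq γ
  rw [mem_burnside_lattice, mem_burnside_lattice, coe_SL2Z_smul]
  constructor
  · rintro ⟨m, n, rfl⟩
    refine ⟨m * γ 1 1 + n * γ 0 1, m * γ 1 0 + n * γ 0 0, ?_⟩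
    have hm := mul_div_cancel₀ ((γ 0 0 : ℂ) * τ + (γ 0 1 : ℂ)) hd
    push_cast
    linear_combination (-4 * n : ℂ) * hm
  · rintro ⟨m, n, h⟩
    refine ⟨m * γ 0 0 - n * γ 0 1, n * γ 1 1 - m * γ 1 0, ?_⟩
    refine mul_left_cancel₀ hd ?_
    rw [← h]
    field_simp
    push_cast
    linear_combination (m + n * τ : ℂ) * hdet

theorem weierstrassP_smul (γ : SL(2, ℤ)) (τ : ℍ) (z : ℂ) :
    (burnsidePeriods (γ • τ)).weierstrassP z = ((γ 1 0 : ℂ) * τ + (γ 1 1 : ℂ)) ^ 2 *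
      (burnsidePeriods τ).weierstrassP (((γ 1 0 : ℂ) * τ + (γ 1 1 : ℂ)) * z) :=
  weierstrassP_homogeneous (mem_burnside_lattice_smul γ τ) (SL2Z_denom_ne_zero γ τ) z

/-- The factor `(cτ + d)²` cancels in the quotient, and for `γ ≡ 1 (mod 4)` the arguments `1, 2, τ`
only move by elements of the lattice `4ℤ + 4τℤ`. -/
theorem burnsideChi_smul_of_mem {γ : SL(2, ℤ)} (hγ : γ ∈ CongruenceSubgroup.Gamma 4) (τ : ℍ) :
    burnsideChi (γ • τ) = burnsideChi τ := by
  obtain ⟨ha, hb, hc, hd⟩ := CongruenceSubgroup.Gamma_mem.mp hγ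
  have h1 : ∀ a : ℤ, (a : ZMod 4) = 1 → ∃ k : ℤ, a = 4 * k + 1 := fun a h => by
    have : ((a - 1 : ℤ) : ZMod 4) = 0 := by push_cast; rw [h]; ring
    obtain ⟨k, hk⟩ := (ZMod.intCast_zmod_eq_zero_iff_dvd _ 4).mp this
    exact ⟨k, by push_cast at hk; omega⟩
  have h0 : ∀ a : ℤ, (a : ZMod 4) = 0 → ∃ k : ℤ, a = 4 * k := fun a h =>
    (ZMod.intCast_zmod_eq_zero_iff_dvd _ 4).mp h
  obtain ⟨a, ha⟩ := h1 _ ha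
  obtain ⟨d, hd⟩ := h1 _ hd
  obtain ⟨b, hb⟩ := h0 _ hb
  obtain ⟨c, hc⟩ := h0 _ hc
  have hne := SL2Z_denom_ne_zero γ τ
  have e1 := weierstrassP_add_lattice τ 1 d c
  have e2 := weierstrassP_add_lattice τ 2 (2 * d) (2 * c)
  have e3 := weierstrassP_add_lattice τ τ b a
  have hmul : ((γ 1 0 : ℂ) * τ + (γ 1 1 : ℂ)) * ((γ • τ : ℍ) : ℂ) =
      τ + 4 * (b + a * τ) := by
    rw [coe_SL2Z_smul, mul_div_cancel₀ _ hne, ha, hb]; push_cast; ring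
  rw [burnsideChi, weierstrassP_smul, weierstrassP_smul, weierstrassP_smul, hmul, e3,
    show ((γ 1 0 : ℂ) * τ + (γ 1 1 : ℂ)) * 1 = 1 + 4 * (d + c * τ) by
      rw [hc, hd]; push_cast; ring, e1,
    show ((γ 1 0 : ℂ) * τ + (γ 1 1 : ℂ)) * 2 = 2 + 4 * ((2 * d : ℤ) + (2 * c : ℤ) * τ) by
      rw [hc, hd]; push_cast; ring, e2, ← mul_sub, ← mul_sub,
    mul_div_mul_left _ _ (pow_ne_zero 2 hne), burnsideChi]

/-- The half-period sums `(℘(2), ℘(2τ), ℘(2 + 2τ))`: distinctness, invariants. -/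
theorem half_periods (τ : ℍ) :
    (burnsidePeriods τ).weierstrassP 2 ≠ (burnsidePeriods τ).weierstrassP (2 * τ) ∧
    (burnsidePeriods τ).weierstrassP 2 ≠ (burnsidePeriods τ).weierstrassP (2 + 2 * τ) ∧
    (burnsidePeriods τ).weierstrassP (2 * τ) ≠ (burnsidePeriods τ).weierstrassP (2 + 2 * τ) ∧
    (burnsidePeriods τ).weierstrassP 2 + (burnsidePeriods τ).weierstrassP (2 * τ) +
      (burnsidePeriods τ).weierstrassP (2 + 2 * τ) = 0 ∧
    (burnsidePeriods τ).g₂ = 4 * ((burnsidePeriods τ).weierstrassP 2 ^ 2 +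
      (burnsidePeriods τ).weierstrassP 2 * (burnsidePeriods τ).weierstrassP (2 * τ) +
      (burnsidePeriods τ).weierstrassP (2 * τ) ^ 2) ∧
    (burnsidePeriods τ).g₃ = -4 * ((burnsidePeriods τ).weierstrassP 2 *
      (burnsidePeriods τ).weierstrassP (2 * τ) *
      ((burnsidePeriods τ).weierstrassP 2 + (burnsidePeriods τ).weierstrassP (2 * τ))) := by
  obtain ⟨κ, hκ, -, -, h2, h3⟩ := exists_weierstrassP_values τ
  have hx := xFun_ne_zero τ.2
  have hw := wFun_ne_zero τ.2
  have hxw := xFun_pow_add_wFun_pow τ.2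
  have half : ∀ m : ℤ, (m : ℝ) ≠ 1 / 2 := fun m h => by
    have : (2 * m : ℝ) = 1 := by linarith
    have : 2 * m = 1 := by exact_mod_cast this
    omega
  have n1 := two_notMem τ
  have n2 : 2 * (τ : ℂ) ∉ (burnsidePeriods τ).lattice := by
    have := notMem_burnside_lattice (τ := τ) (a := 0) (b := 1 / 2) (Or.inr half)
    convert! this using 2; push_cast; ring
  have n3 : 2 + 2 * (τ : ℂ) ∉ (burnsidePeriods τ).lattice := by
    have := notMem_burnside_lattice (τ := τ) (a := 1 / 2) (b := 1 / 2) (Or.inr half)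
    convert! this using 2; push_cast; ring
  have r1 := weierstrassP_half_period _ n1 (mem_burnside_lattice.mpr ⟨1, 0, by push_cast; ring⟩)
  have r2 := weierstrassP_half_period _ n2 (mem_burnside_lattice.mpr ⟨0, 1, by push_cast; ring⟩)
  have r3 := weierstrassP_half_period _ n3 (mem_burnside_lattice.mpr ⟨1, 1, by push_cast; ring⟩)
  have d1 : (burnsidePeriods τ).weierstrassP 2 ≠ (burnsidePeriods τ).weierstrassP (2 * τ) := by
    intro h
    rw [h, sub_self] at h2
    exact div_ne_zero hκ (pow_ne_zero 2 hx) h2.symm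
  have d2 : (burnsidePeriods τ).weierstrassP 2 ≠
      (burnsidePeriods τ).weierstrassP (2 + 2 * τ) := by
    intro h
    rw [h, sub_self] at h3
    exact mul_ne_zero hκ (pow_ne_zero 2 hx) h3.symm
  have d3 : (burnsidePeriods τ).weierstrassP (2 * τ) ≠
      (burnsidePeriods τ).weierstrassP (2 + 2 * τ) := by
    intro h
    rw [h, h3, eq_div_iff (pow_ne_zero 2 hx)] at h2
    have : κ * (xFun τ ^ 4 - 1) = 0 := by linear_combination h2
    rcases mul_eq_zero.mp this with h | h
    · exact hκ h
    · exact pow_ne_zero 4 hw (by linear_combination hxw - h)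
  exact ⟨d1, d2, d3, invariants_eq_of_roots r1 r2 r3 d1 d2 d3⟩

/-- The value of `℘` at a half-period determines its class modulo the lattice; this reads off the
residues modulo `2` of the matrix in the next theorem. -/
theorem weierstrassP_two_mul_int (τ : ℍ) (m n : ℤ)
    (h : ¬ (2 ∣ m ∧ 2 ∣ n)) :
    ((burnsidePeriods τ).weierstrassP (2 * (m + n * τ)) = (burnsidePeriods τ).weierstrassP 2 →
      ¬ 2 ∣ m ∧ 2 ∣ n) ∧
    ((burnsidePeriods τ).weierstrassP (2 * (m + n * τ)) =
      (burnsidePeriods τ).weierstrassP (2 * τ) → 2 ∣ m ∧ ¬ 2 ∣ n) := by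
  obtain ⟨d1, d2, d3, -⟩ := half_periods τ
  obtain ⟨m, rfl | rfl⟩ := Int.even_or_odd' m <;> obtain ⟨n, rfl | rfl⟩ := Int.even_or_odd' n
  · exact absurd ⟨⟨m, rfl⟩, ⟨n, rfl⟩⟩ h
  · rw [show 2 * (((2 * m : ℤ) : ℂ) + ((2 * n + 1 : ℤ) : ℂ) * τ) = 2 * τ + 4 * (m + n * τ) by
      push_cast; ring, weierstrassP_add_lattice]
    exact ⟨fun h => absurd h.symm d1, fun _ => ⟨⟨m, rfl⟩, by omega⟩⟩
  · rw [show 2 * (((2 * m + 1 : ℤ) : ℂ) + ((2 * n : ℤ) : ℂ) * τ) = 2 + 4 * (m + n * τ) by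
      push_cast; ring, weierstrassP_add_lattice]
    exact ⟨fun _ => ⟨by omega, ⟨n, rfl⟩⟩, fun h => absurd h d1⟩
  · rw [show 2 * (((2 * m + 1 : ℤ) : ℂ) + ((2 * n + 1 : ℤ) : ℂ) * τ) =
      2 + 2 * τ + 4 * (m + n * τ) by push_cast; ring, weierstrassP_add_lattice]
    exact ⟨fun h => absurd h.symm d2, fun h => absurd h.symm d3⟩

/-- The fibres of `x⁴` are contained in the orbits of `Γ(2)`. -/
theorem exists_Gamma_two_of_xFun_pow_eq {τ τ' : ℍ} (h : xFun τ ^ 4 = xFun τ' ^ 4) :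
    ∃ γ ∈ CongruenceSubgroup.Gamma 2, γ • τ = τ' := by
  obtain ⟨κ, hκ, -, -, h2, h3⟩ := exists_weierstrassP_values τ
  obtain ⟨κ', hκ', -, -, h2', h3'⟩ := exists_weierstrassP_values τ'
  obtain ⟨-, -, -, s, g2, g3⟩ := half_periods τ
  obtain ⟨-, -, -, s', g2', g3'⟩ := half_periods τ'
  have hx := xFun_ne_zero τ.2
  have hx' := xFun_ne_zero τ'.2
  -- Equal fourth powers mean `x(τ)² = ± x(τ')²`; either way both differences from `℘(2)` scale by
  -- the same `r = ± κ'/κ`.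
  obtain ⟨r, hr, e2, e3⟩ : ∃ r : ℂ, r ≠ 0 ∧
      (burnsidePeriods τ').weierstrassP (2 * τ') - (burnsidePeriods τ').weierstrassP 2 =
        r * ((burnsidePeriods τ).weierstrassP (2 * τ) - (burnsidePeriods τ).weierstrassP 2) ∧
      (burnsidePeriods τ').weierstrassP (2 + 2 * τ') - (burnsidePeriods τ').weierstrassP 2 =
        r * ((burnsidePeriods τ).weierstrassP (2 + 2 * τ) -
          (burnsidePeriods τ).weierstrassP 2) := by
    have hsq : (xFun τ ^ 2) ^ 2 = (xFun τ' ^ 2) ^ 2 := by rw [← pow_mul, ← pow_mul]; exact h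
    rw [h2, h3, h2', h3']
    rcases sq_eq_sq_iff_eq_or_eq_neg.mp hsq with e | e
    · refine ⟨κ' / κ, div_ne_zero hκ' hκ, ?_, ?_⟩ <;> rw [e] <;> field_simp
    · refine ⟨-(κ' / κ), neg_ne_zero.mpr (div_ne_zero hκ' hκ), ?_, ?_⟩ <;> rw [e] <;> field_simp
  -- The three half-period values sum to zero, so proportional differences force proportional
  -- values.
  have v1 : (burnsidePeriods τ').weierstrassP 2 = r * (burnsidePeriods τ).weierstrassP 2 := by
    linear_combination (-1 / 3 : ℂ) * e2 - 1 / 3 * e3 + 1 / 3 * s' - r / 3 * s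
  have v2 : (burnsidePeriods τ').weierstrassP (2 * τ') =
      r * (burnsidePeriods τ).weierstrassP (2 * τ) := by
    linear_combination e2 + v1
  obtain ⟨c, hc2⟩ : ∃ c : ℂ, r = c * c :=
    (IsAlgClosed.exists_pow_nat_eq r two_pos).imp fun c h => by rw [← h, pow_two]
  have hc : c ≠ 0 := fun h => hr (by rw [hc2, h]; ring)
  have i2 : (burnsidePeriods τ').g₂ = c ^ 4 * (burnsidePeriods τ).g₂ := by
    rw [g2, g2', v1, v2, hc2]; ring
  have i3 : (burnsidePeriods τ').g₃ = c ^ 6 * (burnsidePeriods τ).g₃ := by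
    rw [g3, g3', v1, v2, hc2]; ring
  have hmem := mem_lattice_iff_of_invariants hc i2 i3
  have hP := weierstrassP_homogeneous hmem hc
  obtain ⟨m, n, hmn⟩ := four_mul_mem_burnside_lattice.mp
    (show 4 * c ∈ (burnsidePeriods τ).lattice by
      rw [mul_comm]; exact (hmem 4).mp (burnsidePeriods τ').ω₁_mem_lattice)
  obtain ⟨b, a, hba⟩ := four_mul_mem_burnside_lattice.mp
    (show 4 * (c * τ') ∈ (burnsidePeriods τ).lattice by
      rw [mul_left_comm]; exact (hmem _).mp (burnsidePeriods τ').ω₂_mem_lattice)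
  obtain ⟨m', n', hmn'⟩ := four_mul_mem_burnside_lattice.mp
    (show 4 * (1 / c) ∈ (burnsidePeriods τ').lattice by
      rw [hmem, mul_left_comm, mul_one_div_cancel hc, mul_one]
      exact (burnsidePeriods τ).ω₁_mem_lattice)
  obtain ⟨p, q, hpq⟩ := four_mul_mem_burnside_lattice.mp
    (show 4 * (τ / c) ∈ (burnsidePeriods τ').lattice by
      rw [hmem, mul_left_comm, mul_div_cancel₀ _ hc]
      exact (burnsidePeriods τ).ω₂_mem_lattice)
  rw [eq_div_iff hc] at hmn' hpq
  have z1 := add_mul_eq_zero (τ := τ) (a := (m' * m + n' * b - 1 : ℤ)) (b := (m' * n + n' * a : ℤ))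
    (by push_cast; linear_combination hmn' + m' * hmn + n' * hba)
  have z2 := add_mul_eq_zero (τ := τ) (a := (p * m + q * b : ℤ)) (b := (p * n + q * a - 1 : ℤ))
    (by push_cast; linear_combination hpq + p * hmn + q * hba)
  norm_cast at z1 z2
  -- The homothety and its inverse give two integral matrices inverse to each other, so each
  -- determinant is `±1`; positivity of imaginary parts then excludes `-1`.
  have hunit : (m' * q - n' * p) * (m * a - n * b) = 1 := by
    linear_combination (1 + m' * m + n' * b - 1) * z2.2 + z1.1 - (m' * n + n' * a) * z2.1
  have hτ' : (τ' : ℂ) = (a * τ + b) / (n * τ + m) := by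
    rw [eq_div_iff (by rw [add_comm, hmn]; exact hc), add_comm _ (m : ℂ), hmn, mul_comm, ← hba]
    ring
  have him : 0 < ((a * m - b * n : ℤ) : ℝ) * (τ : ℂ).im := by
    have h1 : ((c * τ') * (starRingEnd ℂ) c).im = normSq c * (τ' : ℂ).im := by
      rw [mul_right_comm, Complex.mul_conj, Complex.re_ofReal_mul |> fun _ => Complex.im_ofReal_mul]
    have h2 : ((c * τ') * (starRingEnd ℂ) c).im = ((a * m - b * n : ℤ) : ℝ) * (τ : ℂ).im := by
      rw [← hba, ← hmn]
      simp
      ring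
    rw [← h2, h1]
    exact mul_pos (normSq_pos.mpr hc) τ'.2
  have hdetpos : 0 < a * m - b * n := by
    have := (pos_iff_pos_of_mul_pos him).mpr τ.2
    exact_mod_cast this
  have hdet : a * m - b * n = 1 := by
    have := Int.eq_one_or_neg_one_of_mul_eq_one' hunit
    rcases this with h | h
    · linear_combination h.2
    · exfalso; linarith [h.2]
  -- The homothety takes `2` and `2τ'` to half-periods with the `℘`-values at `2` and `2τ`; this is
  -- the congruence modulo `2`.
  have p1 := (weierstrassP_two_mul_int τ m n (by
    rintro ⟨⟨m, rfl⟩, ⟨n, rfl⟩⟩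
    have : 2 * (a * m - b * n) = 1 := by linear_combination hdet
    omega)).1 (by
      have := hP 2
      rw [v1, hc2, ← pow_two] at this
      rw [hmn, mul_comm 2 c]
      exact (mul_left_cancel₀ (pow_ne_zero 2 hc) this).symm)
  have p2 := (weierstrassP_two_mul_int τ b a (by
    rintro ⟨⟨b, rfl⟩, ⟨a, rfl⟩⟩
    have : 2 * (a * m - b * n) = 1 := by linear_combination hdet
    omega)).2 (by
      have := hP (2 * τ')
      rw [v2, hc2, ← pow_two, mul_left_comm] at this
      rw [hba]
      exact (mul_left_cancel₀ (pow_ne_zero 2 hc) this).symm)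
  obtain ⟨γ, rfl, rfl, rfl, rfl⟩ := exists_SL2Z hdet
  refine ⟨γ, ?_, ?_⟩
  · rw [CongruenceSubgroup.Gamma_mem]
    have odd : ∀ k : ℤ, ¬ 2 ∣ k → (k : ZMod 2) = 1 := fun k hk => by
      have := (ZMod.intCast_zmod_eq_zero_iff_dvd (k - 1) 2).mpr (by push_cast; omega)
      push_cast at this
      linear_combination this
    have even : ∀ k : ℤ, 2 ∣ k → (k : ZMod 2) = 0 := fun k hk =>
      (ZMod.intCast_zmod_eq_zero_iff_dvd k 2).mpr hk
    exact ⟨odd _ p2.2, even _ p2.1, even _ p1.2, odd _ p1.1⟩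
  · ext
    rw [coe_SL2Z_smul, hτ']

/-! ### Invariance and fibres of Burnside's function. -/

/-- Landen's transformation: `x(τ/2)` determines `x(τ)²`. This reduces the fibres of `χ` to those of
`x⁴`. -/
theorem xFun_two_mul_sq (τ : ℂ) (hτ : 0 < τ.im) :
    xFun (2 * τ) ^ 2 * (1 + xFun τ ^ 2) = 2 * xFun τ := by
  have h2 := theta3_ne_zero (two_mul_im_pos hτ)
  have h := theta3_ne_zero hτ
  have e1 := theta3_mul_theta4 hτ
  have e2 := theta3_sq hτ
  have e3 := theta4_sq hτ
  rw [xFun, xFun]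
  field_simp
  linear_combination theta4 (2 * τ) ^ 2 * (e2 + e3) - 2 * theta3 (2 * τ) ^ 2 * e1

theorem burnsideChi_mem_gammaFour (g : SL(2, ℝ)) (hg : g ∈ gammaFour) (τ : ℍ) :
    burnsideChi (g • τ) = burnsideChi τ := by
  obtain ⟨γ, hγ, rfl⟩ := hg
  change γ ∈ CongruenceSubgroup.Gamma 4 ⊔ Subgroup.zpowers (-1) at hγ
  change burnsideChi (γ • τ) = _
  have hle : CongruenceSubgroup.Gamma 4 ⊔ Subgroup.zpowers (-1) ≤
      ({ carrier := {g : SL(2, ℤ) | ∀ τ : ℍ, burnsideChi (g • τ) = burnsideChi τ}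
         one_mem' := fun τ => by simp
         mul_mem' := fun {a b} ha hb τ => by rw [mul_smul, ha, hb]
         inv_mem' := fun {a} ha τ => by
          have h := ha (a⁻¹ • τ)
          rw [smul_inv_smul] at h
          exact h.symm } : Subgroup SL(2, ℤ)) := by
    rw [sup_le_iff, Subgroup.zpowers_le]
    refine ⟨fun γ hγ τ => burnsideChi_smul_of_mem hγ τ, fun τ => ?_⟩
    rw [ModularGroup.SL_neg_smul, one_smul]
  exact hle hγ τ

/-- Inversion conjugates the map to the translation by `-4`, and `w(τ + 4) = i² w(τ)`. -/
theorem xFun_four_mul_add_one {τ : ℂ} (hτ : 0 < τ.im) : xFun (τ / (4 * τ + 1)) = -xFun τ := by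
  have h0 : τ ≠ 0 := fun h => by simp [h] at hτ
  have hd : 4 * τ + 1 ≠ 0 := fun h => by
    have := congrArg Complex.im h
    simp at this
    exact hτ.ne' this
  have h1 := neg_one_div_im_pos hτ
  have h2 : (-1 / τ) = -1 / (τ / (4 * τ + 1)) + 2 + 2 := by
    field_simp; ring
  have h3 : 0 < (-1 / (τ / (4 * τ + 1))).im := by
    have := congrArg Complex.im h2
    simp only [Complex.add_im, Complex.im_ofNat, add_zero] at this
    rw [← this]; exact h1
  have h4 := neg_one_div_im_pos h3
  have h5 := wFun_neg_one_div h3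
  rw [show -1 / (-1 / (τ / (4 * τ + 1))) = τ / (4 * τ + 1) by field_simp] at h4
  have e1 := wFun_neg_one_div h4
  have e2 := wFun_neg_one_div hτ
  rw [h2, wFun_add_two, wFun_add_two, e1] at e2
  linear_combination -e2 + xFun (τ / (4 * τ + 1)) * I_mul_I

/-- The translates of Burnside's function under representatives of `Γ(2)` modulo `±Γ(4)`. -/
theorem burnsideChi_T_sq_U (τ : ℍ) (γ : SL(2, ℤ)) (i j : Fin 2)
    (h00 : γ 0 0 = 1 + 4 * (i : ℤ) * j) (h01 : γ 0 1 = 2 * i) (h10 : γ 1 0 = 2 * j)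
    (h11 : γ 1 1 = 1) (h : burnsideChi (γ • τ) = burnsideChi τ) : i = 0 ∧ j = 0 := by
  have hτ2 := half_im_pos τ.2
  have hu : xFun ((τ : ℂ) / 2) ≠ 0 := xFun_ne_zero hτ2
  have hu4 := xFun_pow_add_wFun_pow hτ2
  have hw4 := pow_ne_zero 4 (wFun_ne_zero hτ2)
  have hd : (2 * (τ : ℂ) + 1) ≠ 0 := by
    have := int_mul_add_ne_zero (c := 2) (d := 1) (by norm_num) τ
    exact_mod_cast this
  have hU := xFun_four_mul_add_one hτ2
  rw [show 4 * ((τ : ℂ) / 2) + 1 = 2 * τ + 1 by ring] at hU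
  rw [burnsideChi_eq, burnsideChi_eq, coe_SL2Z_smul, h00, h01, h10, h11, neg_inj] at h
  set u := xFun ((τ : ℂ) / 2) with hudef
  -- The three nontrivial representatives replace `u` by `-u`, `1/u` and `-1/u`; none equals `u`,
  -- since `u ≠ 0` and `u⁴ ≠ 1`.
  have key : ∀ v : ℂ, v = u → v = u⁻¹ ∨ v = -u ∨ v = -u⁻¹ → False := by
    rintro v rfl (h | h | h)
    · field_simp at h
      exact hw4 (by linear_combination hu4 - (u ^ 2 + 1) * h)
    · exact hu (by linear_combination h / 2)
    · field_simp at h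
      exact hw4 (by linear_combination hu4 - (u ^ 2 - 1) * h)
  fin_cases i <;> fin_cases j
  · exact ⟨rfl, rfl⟩
  · exfalso
    refine key _ h (Or.inr (Or.inl ?_))
    rw [← hU]
    congr 1
    norm_num
    rw [div_div, div_div, mul_comm]
  · exfalso
    refine key _ h (Or.inl ?_)
    rw [hudef, ← xFun_add_one]
    congr 1
    norm_num
    ring
  · exfalso
    refine key _ h (Or.inr (Or.inr ?_))
    rw [hudef, ← inv_neg, ← hU, ← xFun_add_one]
    congr 1
    norm_num
    linear_combination mul_inv_cancel₀ hd

/-- Every element of `Γ(2)` is the product of an element of `±Γ(4)` and one of four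
representatives. -/
theorem exists_Gamma_four_mul {γ : SL(2, ℤ)} (hγ : γ ∈ CongruenceSubgroup.Gamma 2) :
    ∃ δ ∈ CongruenceSubgroup.Gamma 4, ∃ ρ : SL(2, ℤ), ∃ i j : Fin 2,
      (γ = δ * ρ ∨ γ = -(δ * ρ)) ∧ ρ 0 0 = 1 + 4 * (i : ℤ) * j ∧ ρ 0 1 = 2 * i ∧
      ρ 1 0 = 2 * j ∧ ρ 1 1 = 1 := by
  -- The upper left entry is odd, so a change of sign makes it `1` modulo `4`; the determinant then
  -- does the same for the lower right entry.
  wlog h1 : ∃ a : ℤ, γ 0 0 = 4 * a + 1 generalizing γ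
  · have hneg : -γ ∈ CongruenceSubgroup.Gamma 2 := by
      rw [CongruenceSubgroup.Gamma_mem] at hγ ⊢
      have e : ∀ z : ZMod 2, -z = z := by decide
      simpa [e] using hγ
    obtain ⟨ha, -⟩ := CongruenceSubgroup.Gamma_mem.mp hγ
    have h2 : ((γ 0 0 - 1 : ℤ) : ZMod 2) = 0 := by push_cast; rw [ha]; ring
    obtain ⟨k, hk⟩ := (ZMod.intCast_zmod_eq_zero_iff_dvd _ 2).mp h2
    push_cast at hk
    obtain ⟨δ, hδ, ρ, i, j, h, h'⟩ := this hneg (by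
      simp only [Matrix.SpecialLinearGroup.coe_neg, Matrix.neg_apply]
      obtain ⟨l, rfl | rfl⟩ := Int.even_or_odd' k
      · exact absurd ⟨l, by omega⟩ h1
      · exact ⟨-l - 1, by omega⟩)
    refine ⟨δ, hδ, ρ, i, j, ?_, h'⟩
    rcases h with h | h
    · exact Or.inr (by rw [← h, neg_neg])
    · exact Or.inl (neg_injective h)
  obtain ⟨ha, hb, hc, hd⟩ := CongruenceSubgroup.Gamma_mem.mp hγ
  obtain ⟨a, ha⟩ := h1
  obtain ⟨b, hb⟩ := (ZMod.intCast_zmod_eq_zero_iff_dvd _ 2).mp hb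
  obtain ⟨c, hc⟩ := (ZMod.intCast_zmod_eq_zero_iff_dvd _ 2).mp hc
  push_cast at hb hc
  have hdet := det_eq γ
  have hd : ∃ d : ℤ, γ 1 1 = 4 * d + 1 := by
    rw [ha, hb, hc] at hdet
    exact ⟨b * c - a * γ 1 1, by linear_combination hdet⟩
  obtain ⟨d, hd⟩ := hd
  have hfin : ∀ k : ℤ, ∃ i : Fin 2, ∃ l : ℤ, k = 2 * l + i := fun k => by
    obtain ⟨l, rfl | rfl⟩ := Int.even_or_odd' k
    · exact ⟨0, l, by simp⟩
    · exact ⟨1, l, by simp⟩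
  obtain ⟨i, b', rfl⟩ := hfin b
  obtain ⟨j, c', rfl⟩ := hfin c
  -- `ρ` is the product of the upper unipotent matrix with entry `2i` and the lower one with entry
  -- `2j`; it matches the off-diagonal residues of `γ` modulo `4`.
  obtain ⟨ρ, r00, r01, r10, r11⟩ := exists_SL2Z
    (show (1 + 4 * (i : ℤ) * j) * 1 - (2 * i) * (2 * j) = 1 by ring)
  refine ⟨γ * ρ⁻¹, ?_, ρ, i, j, Or.inl (by rw [inv_mul_cancel_right]), r00, r01, r10, r11⟩
  have four : (4 : ZMod 4) = 0 := rfl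
  have c00 : (γ * ρ⁻¹) 0 0 = γ 0 0 * ρ 1 1 - γ 0 1 * ρ 1 0 := by
    rw [Matrix.SpecialLinearGroup.coe_mul, Matrix.SpecialLinearGroup.coe_inv,
      Matrix.mul_apply, Fin.sum_univ_two, Matrix.adjugate_fin_two]
    simp; ring
  have c01 : (γ * ρ⁻¹) 0 1 = -γ 0 0 * ρ 0 1 + γ 0 1 * ρ 0 0 := by
    rw [Matrix.SpecialLinearGroup.coe_mul, Matrix.SpecialLinearGroup.coe_inv,
      Matrix.mul_apply, Fin.sum_univ_two, Matrix.adjugate_fin_two]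
    simp
  have c10 : (γ * ρ⁻¹) 1 0 = γ 1 0 * ρ 1 1 - γ 1 1 * ρ 1 0 := by
    rw [Matrix.SpecialLinearGroup.coe_mul, Matrix.SpecialLinearGroup.coe_inv,
      Matrix.mul_apply, Fin.sum_univ_two, Matrix.adjugate_fin_two]
    simp; ring
  have c11 : (γ * ρ⁻¹) 1 1 = -γ 1 0 * ρ 0 1 + γ 1 1 * ρ 0 0 := by
    rw [Matrix.SpecialLinearGroup.coe_mul, Matrix.SpecialLinearGroup.coe_inv,
      Matrix.mul_apply, Fin.sum_univ_two, Matrix.adjugate_fin_two]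
    simp
  rw [CongruenceSubgroup.Gamma_mem, c00, c01, c10, c11, r00, r01, r10, r11, ha, hb, hc, hd]
  push_cast
  refine ⟨?_, ?_, ?_, ?_⟩ <;> ring_nf <;> simp only [four, show (8 : ZMod 4) = 0 from rfl,
    show (16 : ZMod 4) = 0 from rfl] <;> ring

/-- Equal values of `χ` give equal values of `x⁴`, hence `Γ(2)`-equivalence. Modulo `±Γ(4)` four
candidates are left, of which only the identity preserves `χ`. -/
theorem burnsideChi_eq_iff (τ τ' : ℍ) :
    burnsideChi τ = burnsideChi τ' ↔ ∃ g ∈ gammaFour, g • τ = τ' := by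
  constructor
  · intro h
    have hτ2 := half_im_pos τ.2
    have hτ2' := half_im_pos τ'.2
    have hx4 : xFun τ ^ 4 = xFun τ' ^ 4 := by
      have e := xFun_two_mul_sq _ hτ2
      have e' := xFun_two_mul_sq _ hτ2'
      rw [burnsideChi_eq, burnsideChi_eq, neg_inj] at h
      rw [mul_div_cancel₀ _ two_ne_zero] at e e'
      rw [← h] at e'
      have hne : 1 + xFun ((τ : ℂ) / 2) ^ 2 ≠ 0 := by
        intro h0
        have := xFun_pow_add_wFun_pow hτ2
        refine pow_ne_zero 4 (wFun_ne_zero hτ2) ?_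
        linear_combination this - (xFun ((τ : ℂ) / 2) ^ 2 - 1) * h0
      have := mul_right_cancel₀ hne (e.trans e'.symm)
      linear_combination (xFun τ ^ 2 + xFun τ' ^ 2) * this
    obtain ⟨γ, hγ, rfl⟩ := exists_Gamma_two_of_xFun_pow_eq hx4
    obtain ⟨δ, hδ, ρ, i, j, hγρ, r00, r01, r10, r11⟩ := exists_Gamma_four_mul hγ
    have hsm : γ • τ = δ • ρ • τ := by
      rcases hγρ with rfl | rfl
      · rw [mul_smul]
      · rw [ModularGroup.SL_neg_smul, mul_smul]
    rw [hsm, burnsideChi_smul_of_mem hδ] at h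
    obtain ⟨rfl, rfl⟩ := burnsideChi_T_sq_U τ ρ i j r00 r01 r10 r11 h.symm
    have hρ : ρ = 1 := by
      ext k l
      fin_cases k <;> fin_cases l <;> simp [r00, r01, r10, r11]
    rw [hρ, one_smul] at hsm
    exact ⟨_, ⟨δ, Subgroup.mem_sup_left hδ, rfl⟩, hsm.symm⟩
  · rintro ⟨g, hg, rfl⟩
    exact (burnsideChi_mem_gammaFour g hg τ).symm

/-! ### The automorphism groups. -/

theorem countable_gammaFour : Countable gammaFour := by
  have h1 : Countable (Matrix (Fin 2) (Fin 2) ℤ) := inferInstanceAs (Countable (Fin 2 → Fin 2 → ℤ))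
  have h2 : Countable SL(2, ℤ) :=
    inferInstanceAs (Countable {A : Matrix (Fin 2) (Fin 2) ℤ // A.det = 1})
  exact Set.Countable.to_subtype (Set.Countable.image (Set.to_countable _) _)

/-- The point `it`. -/
noncomputable def imaginaryPoint (t : Set.Ioi (0 : ℝ)) : ℍ :=
  ⟨(t : ℝ) * I, by have : (0 : ℝ) < t := t.2
                   simpa using this⟩

theorem neg_one_mem_gammaFour : (-1 : SL(2, ℝ)) ∈ gammaFour :=
  ⟨-1, Subgroup.mem_sup_right (Subgroup.mem_zpowers _), by ext i j; fin_cases i <;> fin_cases j <;> simp⟩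

/-- For `g` preserving `χ`, each point `it` has some `γ ∈ ±Γ(4)` with `γ(it) = g(it)`. There are
uncountably many `t` and countably many `γ`, so one `γ` serves two points; then `γ⁻¹g` fixes two
points of the half-plane and is `±1`. -/
theorem autGroup_burnsideChi : autGroup burnsideChi = gammaFour := by
  refine le_antisymm (fun g hg => ?_) fun g hg τ => burnsideChi_mem_gammaFour g hg τ
  have hpt : ∀ t : Set.Ioi (0 : ℝ), ∃ γ : gammaFour, (γ : SL(2, ℝ)) • imaginaryPoint t =
      g • imaginaryPoint t := fun t => by
    obtain ⟨γ, hγ, h⟩ := (burnsideChi_eq_iff (imaginaryPoint t)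
      (g • imaginaryPoint t)).mp (hg _).symm
    exact ⟨⟨γ, hγ⟩, h⟩
  choose F hF using hpt
  have hninj : ¬ Function.Injective F := fun hinj => by
    have := countable_gammaFour
    have hc : Countable (Set.Ioi (0 : ℝ)) := hinj.countable
    have := Cardinal.mk_Ioi_real 0 ▸ (Cardinal.le_aleph0_iff_set_countable.mpr hc.to_set)
    exact absurd this (not_le.mpr Cardinal.aleph0_lt_continuum)
  simp only [Function.Injective, not_forall] at hninj
  obtain ⟨s, t, hst, hne⟩ := hninj
  have hs := hF s
  have ht := hF t
  rw [← hst] at ht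
  set γ := F s
  set h := (γ : SL(2, ℝ))⁻¹ * g with hh
  have fix : ∀ z : ℍ, (γ : SL(2, ℝ)) • z = g • z → h • z = z := fun z hz => by
    rw [hh, mul_smul, ← hz, inv_smul_smul]
  -- Fixing `ir` forces equal diagonal entries and `b = -c r²`; two different `r` then force `b = c
  -- = 0`.
  have eqs : ∀ r : Set.Ioi (0 : ℝ), h • imaginaryPoint r =
      imaginaryPoint r → h 0 1 = -(h 1 0 * (r * r)) ∧ h 0 0 = h 1 1 := by
    intro r hr
    have hr0 : (r : ℝ) ≠ 0 := ne_of_gt r.2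
    have := congrArg (fun z : ℍ => (z : ℂ)) hr
    simp only [coe_SL2R_smul, imaginaryPoint] at this
    have hden : (h 1 0 : ℂ) * (r * I) + h 1 1 ≠ 0 := by
      intro h0
      have hre := congrArg Complex.re h0
      have him := congrArg Complex.im h0
      simp [hr0] at hre him
      have hdet : h 0 0 * h 1 1 - h 0 1 * h 1 0 = 1 := by rw [← Matrix.det_fin_two]; exact h.2
      simp [hre, him] at hdet
    rw [div_eq_iff hden] at this
    have hre := congrArg Complex.re this
    have him := congrArg Complex.im this
    simp at hre him
    refine ⟨by linear_combination hre, ?_⟩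
    exact mul_right_cancel₀ hr0 (by linear_combination him)
  obtain ⟨a1, a2⟩ := eqs s (fix _ hs)
  obtain ⟨b1, -⟩ := eqs t (fix _ ht)
  have hc : h 1 0 = 0 := by
    have h1 : h 1 0 * ((t - s : ℝ) * (t + s)) = 0 := by linear_combination b1 - a1
    rcases mul_eq_zero.mp h1 with h1 | h1
    · exact h1
    · exfalso
      have hs0 : (0 : ℝ) < s := s.2
      have ht0 : (0 : ℝ) < t := t.2
      rcases mul_eq_zero.mp h1 with h1 | h1
      · exact hne (Subtype.ext (by linarith))
      · linarith
  have hb : h 0 1 = 0 := by rw [a1, hc]; ring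
  have hdet : h 0 0 * h 1 1 - h 0 1 * h 1 0 = 1 := by rw [← Matrix.det_fin_two]; exact h.2
  rw [hb, a2, zero_mul, sub_zero, mul_self_eq_one_iff] at hdet
  have hmem : h ∈ gammaFour := by
    rcases hdet with hd | hd
    · have : h = 1 := by ext k l; fin_cases k <;> fin_cases l <;> simp [hb, hc, a2, hd]
      rw [this]; exact one_mem _
    · have : h = -1 := by ext k l; fin_cases k <;> fin_cases l <;> simp [hb, hc, a2, hd]
      rw [this]; exact neg_one_mem_gammaFour
  have : g = γ * h := by rw [hh, mul_inv_cancel_left]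
  rw [this]
  exact mul_mem γ.2 hmem

theorem autGroup_neg_comp_smul (f : ℍ → ℂ) (h : SL(2, ℝ)) :
    autGroup (fun τ => -f (h • τ)) = conjBy h (autGroup f) := by
  ext g
  constructor
  · intro hg
    refine ⟨h * g * h⁻¹, fun τ => ?_, ?_⟩
    · have := hg (h⁻¹ • τ)
      simpa [mul_smul] using this
    · simp [mul_assoc]
  · rintro ⟨k, hk, rfl⟩ τ
    have := hk (h • τ)
    simpa [mul_smul] using this

theorem coe_dilation_smul (τ : ℍ) : ((dilation • τ : ℍ) : ℂ) = 2 * τ := by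
  rw [coe_SL2R_smul]
  have h2 : ((√2 : ℝ) : ℂ) * (√2 : ℝ) = 2 := by
    rw [← Complex.ofReal_mul, Real.mul_self_sqrt (by norm_num)]; norm_num
  have h0 : ((√2 : ℝ) : ℂ) ≠ 0 := fun h => by rw [h] at h2; norm_num at h2
  simp only [dilation, Matrix.of_apply, Matrix.cons_val_zero, Matrix.cons_val_one,
    Matrix.cons_val', Matrix.cons_val_fin_one, Complex.ofReal_zero, Complex.ofReal_inv]
  field_simp
  linear_combination (τ : ℂ) * h2

theorem coe_inversion_smul (τ : ℍ) : ((inversion • τ : ℍ) : ℂ) = -1 / τ := by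
  rw [coe_SL2R_smul]
  simp [inversion]

theorem xFun_eq_neg_burnsideChi (τ : ℍ) : xFun τ = -burnsideChi (dilation • τ) := by
  rw [burnsideChi_eq, coe_dilation_smul, neg_neg, mul_div_cancel_left₀ _ two_ne_zero]

theorem autGroup_xFun : autGroup (fun τ : ℍ => xFun τ) = conjBy dilation gammaFour := by
  rw [← autGroup_burnsideChi, ← autGroup_neg_comp_smul]
  congr 1
  exact funext xFun_eq_neg_burnsideChi

theorem autGroup_wFun :
    autGroup (fun τ : ℍ => wFun τ) = conjBy (dilation * inversion) gammaFour := by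
  rw [← autGroup_burnsideChi, ← autGroup_neg_comp_smul]
  congr 1
  funext τ
  rw [mul_smul, ← xFun_eq_neg_burnsideChi, coe_inversion_smul, xFun_neg_one_div τ.2]

/-! ### Fibres of the two uniformizing maps. -/

theorem exists_autGroup_xFun {τ τ' : ℍ} (h : xFun τ = xFun τ') :
    ∃ g ∈ autGroup (fun t : ℍ => xFun t), g • τ = τ' := by
  rw [xFun_eq_neg_burnsideChi, xFun_eq_neg_burnsideChi, neg_inj, burnsideChi_eq_iff] at h
  obtain ⟨g, hg, h⟩ := h
  refine ⟨dilation⁻¹ * g * dilation, ?_, ?_⟩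
  · rw [autGroup_xFun]
    exact ⟨g, hg, by simp⟩
  · rw [mul_smul, mul_smul, h, inv_smul_smul]

/-- If `g` preserves `x`, then `y ∘ g` and `y` have the same square. They are continuous without
zeros on a connected space, so agreement at one point gives agreement everywhere. -/
theorem fibers_xFun_yFun (τ τ' : ℍ) : (xFun τ = xFun τ' ∧ yFun τ = yFun τ') ↔
    ∃ γ ∈ autGroup (fun t : ℍ => xFun t) ⊓ autGroup (fun t : ℍ => yFun t), γ • τ = τ' := by
  constructor
  · rintro ⟨hx, hy⟩
    obtain ⟨g, hg, rfl⟩ := exists_autGroup_xFun hx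
    refine ⟨g, ⟨hg, fun t => ?_⟩, rfl⟩
    have hyc : Continuous fun t : ℍ => yFun t :=
      continuous_iff_continuousAt.mpr fun t => (differentiableAt_yFun t.2).continuousAt.comp
        UpperHalfPlane.continuous_coe.continuousAt
    have hgc : Continuous fun t : ℍ => g • t := by fun_prop
    refine isPreconnected_univ.eq_of_sq_eq (f := fun t : ℍ => yFun ((g • t : ℍ)))
      (g := fun t : ℍ => yFun t) (hyc.comp hgc).continuousOn hyc.continuousOn (fun t _ => ?_)
      (fun {t} _ => yFun_ne_zero t.2) (Set.mem_univ τ) hy.symm (Set.mem_univ t)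
    have := hg t
    simp only [Pi.pow_apply] at this ⊢
    rw [yFun_sq_eq (UpperHalfPlane.im_pos _), yFun_sq_eq t.2, this]
  · rintro ⟨γ, ⟨h1, h2⟩, rfl⟩
    exact ⟨(h1 τ).symm, (h2 τ).symm⟩

/-- The sign argument is applied twice, since only `w⁴ = 1 - x⁴` is determined by `x`: first to
`w²`, then to `w`. -/
theorem fibers_xFun_wFun (τ τ' : ℍ) : (xFun τ = xFun τ' ∧ wFun τ = wFun τ') ↔
    ∃ γ ∈ autGroup (fun t : ℍ => xFun t) ⊓ autGroup (fun t : ℍ => wFun t), γ • τ = τ' := by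
  constructor
  · rintro ⟨hx, hw⟩
    obtain ⟨g, hg, rfl⟩ := exists_autGroup_xFun hx
    refine ⟨g, ⟨hg, fun t => ?_⟩, rfl⟩
    have hwc : Continuous fun t : ℍ => wFun t :=
      continuous_iff_continuousAt.mpr fun t => (differentiableAt_wFun t.2).continuousAt.comp
        UpperHalfPlane.continuous_coe.continuousAt
    have hgc : Continuous fun t : ℍ => g • t := by fun_prop
    have hsq : ∀ t : ℍ, wFun ((g • t : ℍ)) ^ 2 = wFun t ^ 2 := fun t => by
      refine isPreconnected_univ.eq_of_sq_eq (f := fun t : ℍ => wFun ((g • t : ℍ)) ^ 2)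
        (g := fun t : ℍ => wFun t ^ 2) ((hwc.comp hgc).pow 2).continuousOn (hwc.pow 2).continuousOn
        (fun t _ => ?_) (fun {t} _ => pow_ne_zero 2 (wFun_ne_zero t.2)) (Set.mem_univ τ)
        (by rw [hw]) (Set.mem_univ t)
      have := hg t
      simp only [Pi.pow_apply, ← pow_mul] at this ⊢
      have e1 := xFun_pow_add_wFun_pow (UpperHalfPlane.im_pos (g • t))
      have e2 := xFun_pow_add_wFun_pow t.2
      rw [this] at e1
      norm_num
      linear_combination e1 - e2
    exact isPreconnected_univ.eq_of_sq_eq (f := fun t : ℍ => wFun ((g • t : ℍ)))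
      (g := fun t : ℍ => wFun t) (hwc.comp hgc).continuousOn hwc.continuousOn (fun t _ => hsq t)
      (fun {t} _ => wFun_ne_zero t.2) (Set.mem_univ τ) hw.symm (Set.mem_univ t)
  · rintro ⟨γ, ⟨h1, h2⟩, rfl⟩
    exact ⟨(h1 τ).symm, (h2 τ).symm⟩

/-! ### Surjectivity -/

/-- A holomorphic function on the upper half-plane that is invariant under `τ ↦ τ + 1` and
`τ ↦ -1/τ` and tends to infinity at `i∞` is surjective. -/
theorem surjective_of_modular_invariant {f : ℂ → ℂ}
    (hd : ∀ τ : ℍ, DifferentiableAt ℂ f τ) (hT : ∀ τ : ℍ, f (τ + 1) = f τ)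
    (hS : ∀ τ : ℍ, f (-1 / τ) = f τ)
    (hlim : ∀ M : ℝ, ∀ᶠ τ : ℂ in comap im atTop, M < ‖f τ‖) (c : ℂ) :
    ∃ τ : ℍ, f τ = c := by
  have hinv : ∀ (γ : SL(2, ℤ)) (τ : ℍ), f (γ • τ : ℍ) = f τ := by
    have hle : Subgroup.closure {ModularGroup.S, ModularGroup.T} ≤
        ({ carrier := {g : SL(2, ℤ) | ∀ τ : ℍ, f (g • τ : ℍ) = f τ}
           one_mem' := fun τ => by simp
           mul_mem' := fun {a b} ha hb τ => by rw [mul_smul, ha, hb]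
           inv_mem' := fun {a} ha τ => by
            have h := ha (a⁻¹ • τ)
            rw [smul_inv_smul] at h
            exact h.symm } : Subgroup SL(2, ℤ)) := by
      rw [Subgroup.closure_le]
      rintro g (rfl | rfl) τ
      · rw [UpperHalfPlane.modular_S_smul]
        simpa [neg_div] using hS τ
      · rw [UpperHalfPlane.modular_T_smul]
        simpa [add_comm] using hT τ
    intro γ
    rw [SpecialLinearGroup.SL2Z_generators] at hle
    exact hle (Subgroup.mem_top γ)
  have hUo : IsOpen UpperHalfPlane.upperHalfPlaneSet := UpperHalfPlane.isOpen_upperHalfPlaneSet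
  have himage : f '' UpperHalfPlane.upperHalfPlaneSet = Set.range fun τ : ℍ => f τ := by
    ext z
    constructor
    · rintro ⟨w, hw, rfl⟩; exact ⟨⟨w, hw⟩, rfl⟩
    · rintro ⟨w, rfl⟩; exact ⟨w, w.2, rfl⟩
  have han : AnalyticOnNhd ℂ f UpperHalfPlane.upperHalfPlaneSet :=
    DifferentiableOn.analyticOnNhd
      (fun z hz => (hd ⟨z, hz⟩).differentiableWithinAt) hUo
  have hlim' : ∀ M : ℝ, ∃ A : ℝ, ∀ τ : ℂ, A ≤ τ.im → M < ‖f τ‖ := fun M => by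
    obtain ⟨A, hA⟩ := eventually_atTop.mp (eventually_comap.mp (hlim M))
    exact ⟨A, fun τ hτ => hA _ hτ τ rfl⟩
  -- Open mapping theorem; growth at `i∞` rules out a constant function.
  have hopen : IsOpen (Set.range fun τ : ℍ => f τ) := by
    rw [← himage]
    rcases han.is_constant_or_isOpen
      (Complex.isConnected_of_upperHalfPlane (r := 0) (s := {z | 0 < z.im}) subset_rfl
        (fun z (hz : 0 < z.im) => hz.le)).isPreconnected with h | h
    · obtain ⟨w, hw⟩ := h
      obtain ⟨A, hA⟩ := hlim' ‖w‖
      have h1 : 0 < (((max A 1 : ℝ) : ℂ) * I).im := by simp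
      have h2 := hA (((max A 1 : ℝ) : ℂ) * I) (by simp)
      rw [hw _ h1] at h2
      exact absurd h2 (lt_irrefl _)
    · exact h _ subset_rfl hUo
  -- Values within distance `1` of `z` are already taken on a compact truncation of the fundamental
  -- domain, because above a certain height `f` is too large.
  have hclosed : IsClosed (Set.range fun τ : ℍ => f τ) := by
    refine isClosed_of_closure_subset fun z hz => ?_
    obtain ⟨A, hA⟩ := hlim' (‖z‖ + 1)
    set K := ModularGroup.truncatedFundamentalDomain A
    have hK : IsCompact ((fun τ : ℍ => f τ) '' K) := by
      refine (ModularGroup.isCompact_truncatedFundamentalDomain A).image_of_continuousOn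
        fun τ _ => ?_
      exact ((hd τ).continuousAt.comp (f := fun t : ℍ => (t : ℂ))
        UpperHalfPlane.continuous_coe.continuousAt).continuousWithinAt
    have hsub : (Set.range fun τ : ℍ => f τ) ∩ Metric.ball z 1 ⊆ (fun τ : ℍ => f τ) '' K := by
      rintro _ ⟨⟨τ, rfl⟩, hball⟩
      obtain ⟨g, hg⟩ := ModularGroup.exists_smul_mem_fd τ
      refine ⟨g • τ, ⟨hg, ?_⟩, hinv g τ⟩
      by_contra hlt
      have h1 := hA (g • τ : ℍ) (le_of_lt (not_le.mp hlt))
      rw [hinv] at h1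
      have h2 : ‖f τ‖ ≤ ‖f τ - z‖ + ‖z‖ := norm_le_norm_sub_add _ _
      rw [Metric.mem_ball, dist_eq_norm] at hball
      have hball : ‖f τ - z‖ < 1 := hball
      linarith
    have h1 : z ∈ closure ((Set.range fun τ : ℍ => f τ) ∩ Metric.ball z 1) := by
      rw [Set.inter_comm]
      exact Metric.isOpen_ball.inter_closure ⟨Metric.mem_ball_self one_pos, hz⟩
    obtain ⟨τ, -, h⟩ := (hK.isClosed.closure_subset_iff.mpr hsub) h1
    exact ⟨τ, h⟩
  have := IsClopen.eq_univ ⟨hclosed, hopen⟩ ⟨f UpperHalfPlane.I, ⟨_, rfl⟩⟩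
  exact (this ▸ Set.mem_univ c : c ∈ Set.range fun τ : ℍ => f τ)

theorem add_one_im_pos {τ : ℂ} (hτ : 0 < τ.im) : 0 < (τ + 1).im := by simpa using hτ

theorem xFun_pow_four_ne_one {τ : ℂ} (hτ : 0 < τ.im) : xFun τ ^ 4 ≠ 1 := fun h =>
  pow_ne_zero 4 (wFun_ne_zero hτ) (by linear_combination xFun_pow_add_wFun_pow hτ - h)

theorem xFun_neg_one_div_pow {τ : ℂ} (hτ : 0 < τ.im) :
    xFun (-1 / τ) ^ 4 = 1 - xFun τ ^ 4 := by
  rw [xFun_neg_one_div hτ]; linear_combination xFun_pow_add_wFun_pow hτ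

/-- `x⁴` takes all values other than `0` and `1`. -/
theorem exists_xFun_pow_eq {a : ℂ} (h0 : a ≠ 0) (h1 : a ≠ 1) : ∃ τ : ℍ, xFun τ ^ 4 = a := by
  -- The `j`-invariant as a function of `λ`, up to a constant: it is unchanged by `m ↦ 1 - m` and `m
  -- ↦ 1/m`, which are the effects of the two generators on `x⁴`.
  set J : ℂ → ℂ := fun m => (m ^ 2 - m + 1) ^ 3 / (m ^ 2 * (1 - m) ^ 2) with hJ
  have ha1 : 1 - a ≠ 0 := sub_ne_zero.mpr (Ne.symm h1)
  have hne : ∀ τ : ℂ, 0 < τ.im → (xFun τ ^ 4) ^ 2 * (1 - xFun τ ^ 4) ^ 2 ≠ 0 := fun τ hτ =>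
    mul_ne_zero (pow_ne_zero 2 (pow_ne_zero 4 (xFun_ne_zero hτ)))
      (pow_ne_zero 2 (sub_ne_zero.mpr (xFun_pow_four_ne_one hτ).symm))
  obtain ⟨τ, hτ⟩ := surjective_of_modular_invariant (f := fun τ => J (xFun τ ^ 4)) (c := J a)
    (fun τ => by
      have hx := differentiableAt_xFun τ.2
      exact ((((hx.pow 4).pow 2).sub (hx.pow 4)).add_const 1).pow 3 |>.div
        (((hx.pow 4).pow 2).mul (((hx.pow 4).const_sub 1).pow 2)) (hne τ τ.2))
    (fun τ => by
      have hx := xFun_ne_zero τ.2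
      have hx4 : 1 - xFun τ ^ 4 ≠ 0 := sub_ne_zero.mpr (xFun_pow_four_ne_one τ.2).symm
      have hx4' : xFun τ ^ 4 - 1 ≠ 0 := sub_ne_zero.mpr (xFun_pow_four_ne_one τ.2)
      simp only [hJ, xFun_add_one]
      field_simp
      ring)
    (fun τ => by
      simp only [hJ, xFun_neg_one_div_pow τ.2]
      congr 1 <;> ring)
    (fun M => by
      have ht : Tendsto (fun τ => ‖((xFun τ ^ 4) ^ 2 - xFun τ ^ 4 + 1) ^ 3‖ -
          M * ‖(xFun τ ^ 4) ^ 2 * (1 - xFun τ ^ 4) ^ 2‖) (comap im atTop) (𝓝 1) := by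
        have hx := tendsto_xFun.pow 4
        have := ((((hx.pow 2).sub hx).add_const 1).pow 3).norm.sub
          (((hx.pow 2).mul ((hx.const_sub 1).pow 2)).norm.const_mul M)
        simpa using this
      filter_upwards [ht.eventually_const_lt one_pos,
        (eventually_gt_atTop (0 : ℝ)).comap im] with τ h hτ
      simp only [hJ]
      rw [norm_div, lt_div_iff₀ (norm_pos_iff.mpr (hne τ hτ))]
      linarith)
  have hm0 : xFun τ ^ 4 ≠ 0 := pow_ne_zero 4 (xFun_ne_zero τ.2)
  have hm1 : 1 - xFun τ ^ 4 ≠ 0 := sub_ne_zero.mpr (xFun_pow_four_ne_one τ.2).symm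
  have S : ∀ τ : ℍ, ∃ τ' : ℍ, xFun τ' ^ 4 = 1 - xFun τ ^ 4 := fun τ =>
    ⟨⟨-1 / τ, neg_one_div_im_pos τ.2⟩, xFun_neg_one_div_pow τ.2⟩
  have T : ∀ τ : ℍ, ∃ τ' : ℍ, xFun τ' ^ 4 = (xFun τ ^ 4)⁻¹ := fun τ =>
    ⟨⟨τ + 1, add_one_im_pos τ.2⟩, by rw [← inv_pow, ← xFun_add_one]⟩
  simp only [hJ] at hτ
  rw [div_eq_div_iff (hne τ τ.2) (mul_ne_zero (pow_ne_zero 2 h0) (pow_ne_zero 2 ha1))] at hτ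
  obtain ⟨τS, hS⟩ := S τ
  obtain ⟨τT, hT⟩ := T τ
  obtain ⟨τTS, hTS⟩ := T τS
  obtain ⟨τST, hST⟩ := S τT
  obtain ⟨τSTS, hSTS⟩ := S τTS
  rw [hTS, hS] at hSTS
  rw [hS] at hTS
  rw [hT] at hST
  set m := xFun τ ^ 4
  -- `J(m) = J(a)` means that `m` is one of the six anharmonic transforms of `a`; each case is
  -- undone by a combination of the two moves.
  have hprod : (m - a) * ((m - 1 + a) * ((a * m - 1) * (((1 - a) * m - 1) *
      (((a - 1) * m - a) * (a * m - (a - 1)))))) = 0 := by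
    linear_combination -hτ
  rcases mul_eq_zero.mp hprod with h | h
  · exact ⟨τ, by linear_combination h⟩
  rcases mul_eq_zero.mp h with h | h
  · exact ⟨τS, by rw [hS]; linear_combination -h⟩
  rcases mul_eq_zero.mp h with h | h
  · exact ⟨τT, by rw [hT]; field_simp; linear_combination -h⟩
  rcases mul_eq_zero.mp h with h | h
  · exact ⟨τST, by rw [hST]; field_simp; linear_combination h⟩
  rcases mul_eq_zero.mp h with h | h
  · exact ⟨τSTS, by rw [hSTS]; field_simp; linear_combination h⟩
  · exact ⟨τTS, by rw [hTS]; field_simp; linear_combination h⟩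

theorem eq_I_pow_mul_of_pow_four_eq {a b : ℂ} (h : a ^ 4 = b ^ 4) :
    ∃ k : ℕ, a = I ^ k * b := by
  have : (a - b) * ((a + b) * ((a - I * b) * (a + I * b))) = 0 := by
    linear_combination h - (a ^ 2 - b ^ 2) * b ^ 2 * I_sq
  rcases mul_eq_zero.mp this with h | h
  · exact ⟨0, by linear_combination h⟩
  rcases mul_eq_zero.mp h with h | h
  · exact ⟨2, by linear_combination h - b * I_sq⟩
  rcases mul_eq_zero.mp h with h | h
  · exact ⟨1, by linear_combination h⟩
  · exact ⟨3, by linear_combination h - b * I * I_sq⟩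

theorem exists_rotate_wFun (τ : ℍ) (k : ℕ) :
    ∃ τ' : ℍ, xFun τ' = xFun τ ∧ wFun τ' = I ^ k * wFun τ := by
  induction k with
  | zero => exact ⟨τ, rfl, by simp⟩
  | succ k ih =>
    obtain ⟨t, h1, h2⟩ := ih
    refine ⟨⟨t + 2, by simpa using t.2⟩, (xFun_add_two t).trans h1, ?_⟩
    rw [wFun_add_two, h2, pow_succ]; ring

theorem exists_rotate_xFun (τ : ℍ) (k : ℕ) :
    ∃ τ' : ℍ, xFun τ' = I ^ k * xFun τ ∧ wFun τ' = wFun τ := by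
  obtain ⟨t, h1, h2⟩ := exists_rotate_wFun ⟨-1 / τ, neg_one_div_im_pos τ.2⟩ k
  refine ⟨⟨-1 / t, neg_one_div_im_pos t.2⟩, ?_, ?_⟩
  · change xFun (-1 / t) = _
    rw [xFun_neg_one_div t.2, h2]
    change _ * wFun (-1 / τ) = _
    rw [wFun_neg_one_div τ.2]
  · change wFun (-1 / t) = _
    rw [wFun_neg_one_div t.2, h1]
    exact xFun_neg_one_div τ.2

/-- Once `x⁴` is right, so is `w⁴`; the remaining fourth roots of unity are adjusted independently,
by `τ ↦ τ + 2` for `w` and by its conjugate under inversion for `x`. -/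
theorem range_xFun_wFun : Set.range (fun τ : ℍ => (xFun τ, wFun τ)) = jacobiCurve := by
  ext ⟨z, w⟩
  constructor
  · rintro ⟨τ, h⟩
    obtain ⟨rfl, rfl⟩ := Prod.ext_iff.mp h
    exact ⟨xFun_pow_add_wFun_pow τ.2, xFun_ne_zero τ.2, wFun_ne_zero τ.2⟩
  · rintro ⟨h, hz, hw⟩
    simp only at h hz hw
    obtain ⟨τ, hτ⟩ := exists_xFun_pow_eq (pow_ne_zero 4 hz)
      (fun h1 => pow_ne_zero 4 hw (by linear_combination h - h1))
    obtain ⟨k, hk⟩ := eq_I_pow_mul_of_pow_four_eq hτ.symm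
    obtain ⟨l, hl⟩ := eq_I_pow_mul_of_pow_four_eq (a := w) (b := wFun τ)
      (by linear_combination h - hτ.symm - xFun_pow_add_wFun_pow τ.2)
    obtain ⟨τ₁, h1, h2⟩ := exists_rotate_xFun τ k
    obtain ⟨τ₂, h3, h4⟩ := exists_rotate_wFun τ₁ l
    exact ⟨τ₂, by simp only; rw [h3, h4, h1, h2, hk, hl]⟩

theorem range_xFun_yFun : Set.range (fun τ : ℍ => (xFun τ, yFun τ)) = burnsideCurve := by
  ext ⟨a, b⟩
  constructor
  · rintro ⟨τ, h⟩
    obtain ⟨rfl, rfl⟩ := Prod.ext_iff.mp h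
    exact ⟨yFun_sq_eq τ.2, yFun_ne_zero τ.2⟩
  · rintro ⟨h, hb⟩
    simp only at h hb
    have ha : a * (a ^ 4 - 1) ≠ 0 := by
      rw [show a * (a ^ 4 - 1) = b ^ 2 by rw [h]; ring]; exact pow_ne_zero 2 hb
    obtain ⟨τ, hτ⟩ := exists_xFun_pow_eq (pow_ne_zero 4 (left_ne_zero_of_mul ha))
      (sub_ne_zero.mp (right_ne_zero_of_mul ha))
    obtain ⟨k, hk⟩ := eq_I_pow_mul_of_pow_four_eq hτ.symm
    obtain ⟨t, h1, -⟩ := exists_rotate_xFun τ k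
    rw [← hk] at h1
    have hsq : yFun t ^ 2 = b ^ 2 := by rw [yFun_sq_eq t.2, h, h1]
    rcases sq_eq_sq_iff_eq_or_eq_neg.mp hsq with h2 | h2
    · exact ⟨t, by simp only; rw [h1, h2]⟩
    · refine ⟨⟨t + 2, by simpa using t.2⟩, ?_⟩
      change (xFun (t + 2), yFun (t + 2)) = _
      rw [xFun_add_two, yFun_add_two, h1, h2, neg_neg]

/-! ### The complete elliptic integral as a function of the parameter -/

/-- The plane cut along `[1, ∞)`. -/
def cutPlane : Set ℂ := {m | 1 - m ∈ slitPlane}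

/-- The integrals `∫ sin^p θ (1 - m sin² θ)^α dθ` over the quarter period. -/
noncomputable def ellipticMoment (p : ℕ) (α : ℂ) (m : ℂ) : ℂ :=
  ∫ θ in (0 : ℝ)..(π / 2), ((Real.sin θ : ℝ) : ℂ) ^ p *
    (1 - m * ((Real.sin θ : ℝ) : ℂ) ^ 2) ^ α

/-- The complete elliptic integral of the first kind as a function of the parameter `m = k²`. -/
noncomputable def ellipticE (m : ℂ) : ℂ := ellipticMoment 0 (-1 / 2) m

theorem isOpen_cutPlane : IsOpen cutPlane :=
  isOpen_slitPlane.preimage (by fun_prop : Continuous fun m : ℂ => 1 - m)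

/-- The point lies on the segment from `1` to `1 - m`, and the slit plane is star-shaped about `1`.
-/
theorem one_sub_mul_sq_mem_slitPlane {m : ℂ} (hm : m ∈ cutPlane) {s : ℝ} (hs : |s| ≤ 1) :
    1 - m * (s : ℂ) ^ 2 ∈ slitPlane := by
  have hs2 : s ^ 2 ≤ 1 := (sq_le_one_iff_abs_le_one s).mpr hs
  rw [cutPlane, Set.mem_ofPred_eq, mem_slitPlane_iff] at hm
  rw [mem_slitPlane_iff, ← Complex.ofReal_pow]
  simp only [sub_re, one_re, mul_re, ofReal_re, ofReal_im, mul_zero, sub_zero, sub_im, one_im,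
    mul_im, zero_add, zero_sub, neg_ne_zero] at hm ⊢
  rcases eq_or_ne s 0 with rfl | h0
  · left; simp
  rcases hm with h | h
  · left; nlinarith [mul_pos h (pow_pos (abs_pos.mpr h0) 2), sq_abs s]
  · right; exact mul_ne_zero h (pow_ne_zero 2 h0)

theorem continuousOn_ellipticMoment_integrand (p : ℕ) (α : ℂ) :
    ContinuousOn (fun q : ℂ × ℝ => ((Real.sin q.2 : ℝ) : ℂ) ^ p *
      (1 - q.1 * ((Real.sin q.2 : ℝ) : ℂ) ^ 2) ^ α) (cutPlane ×ˢ Set.univ) := by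
  have h1 : Continuous fun q : ℂ × ℝ => 1 - q.1 * ((Real.sin q.2 : ℝ) : ℂ) ^ 2 := by fun_prop
  have h2 : Continuous fun q : ℂ × ℝ => ((Real.sin q.2 : ℝ) : ℂ) ^ p := by fun_prop
  exact h2.continuousOn.mul (h1.continuousOn.cpow_const fun q hq =>
    one_sub_mul_sq_mem_slitPlane hq.1 (Real.abs_sin_le_one _))

theorem continuous_ellipticMoment_integrand (p : ℕ) (α : ℂ) {m : ℂ} (hm : m ∈ cutPlane) :
    Continuous (fun θ : ℝ => ((Real.sin θ : ℝ) : ℂ) ^ p *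
      (1 - m * ((Real.sin θ : ℝ) : ℂ) ^ 2) ^ α) :=
  (continuousOn_ellipticMoment_integrand p α).comp_continuous
    (f := fun θ : ℝ => ((m, θ) : ℂ × ℝ)) (by fun_prop) fun θ => ⟨hm, Set.mem_univ _⟩

/-- Differentiation under the integral sign; compactness of a small closed ball times the interval
supplies the dominating constant. -/
theorem hasDerivAt_ellipticMoment (p : ℕ) (α : ℂ) {m : ℂ} (hm : m ∈ cutPlane) :
    HasDerivAt (ellipticMoment p α) (-α * ellipticMoment (p + 2) (α - 1) m) m := by
  obtain ⟨ε, hε, hball⟩ := Metric.nhds_basis_closedBall.mem_iff.mp (isOpen_cutPlane.mem_nhds hm)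
  have hK : IsCompact (Metric.closedBall m ε ×ˢ Set.Icc (0 : ℝ) (π / 2)) :=
    (isCompact_closedBall m ε).prod isCompact_Icc
  obtain ⟨C, hC⟩ := hK.exists_bound_of_continuousOn
    ((continuousOn_ellipticMoment_integrand (p + 2) (α - 1)).mono
      (Set.prod_mono hball (Set.subset_univ _)))
  have hle : (0 : ℝ) ≤ π / 2 := by positivity
  have key := intervalIntegral.hasDerivAt_integral_of_dominated_loc_of_deriv_le (𝕜 := ℂ)
    (μ := volume) (a := 0) (b := π / 2)
    (F := fun m θ => ((Real.sin θ : ℝ) : ℂ) ^ p * (1 - m * ((Real.sin θ : ℝ) : ℂ) ^ 2) ^ α)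
    (F' := fun m θ => -α * (((Real.sin θ : ℝ) : ℂ) ^ (p + 2) *
      (1 - m * ((Real.sin θ : ℝ) : ℂ) ^ 2) ^ (α - 1)))
    (bound := fun _ => ‖α‖ * C) (Metric.closedBall_mem_nhds m hε)
    (by
      filter_upwards [isOpen_cutPlane.mem_nhds hm] with z hz
      exact (continuous_ellipticMoment_integrand p α hz).aestronglyMeasurable)
    ((continuous_ellipticMoment_integrand p α hm).intervalIntegrable _ _)
    ((continuous_ellipticMoment_integrand (p + 2) (α - 1) hm).const_mul
      (-α) |>.aestronglyMeasurable)
    (by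
      refine Eventually.of_forall fun θ hθ z hz => ?_
      rw [Set.uIoc_of_le hle] at hθ
      rw [norm_mul, norm_neg]
      exact mul_le_mul_of_nonneg_left (hC (z, θ) ⟨hz, hθ.1.le, hθ.2⟩) (norm_nonneg _))
    intervalIntegrable_const
    (by
      refine Eventually.of_forall fun θ _ z hz => ?_
      have hs := one_sub_mul_sq_mem_slitPlane (hball hz) (Real.abs_sin_le_one θ)
      have h1 : HasDerivAt (fun z : ℂ => 1 - z * ((Real.sin θ : ℝ) : ℂ) ^ 2)
          (-(((Real.sin θ : ℝ) : ℂ) ^ 2)) z := by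
        simpa using ((hasDerivAt_id z).mul_const (((Real.sin θ : ℝ) : ℂ) ^ 2)).const_sub 1
      exact ((h1.cpow_const hs).const_mul (((Real.sin θ : ℝ) : ℂ) ^ p)).congr_deriv (by ring))
  rw [ellipticMoment, ← intervalIntegral.integral_const_mul]
  exact key.2

/-- The hypergeometric equation of the elliptic integral. -/
theorem ellipticMoment_relation {m : ℂ} (hm : m ∈ cutPlane) :
    m * (1 - m) * (3 / 4 * ellipticMoment 4 (-5 / 2) m) +
      (1 - 2 * m) * (1 / 2 * ellipticMoment 2 (-3 / 2) m) -
      1 / 4 * ellipticMoment 0 (-1 / 2) m = 0 := by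
  have hs := fun θ => one_sub_mul_sq_mem_slitPlane hm (Real.abs_sin_le_one θ)
  have i0 := continuous_ellipticMoment_integrand 0 (-1 / 2) hm
  have i2 := continuous_ellipticMoment_integrand 2 (-3 / 2) hm
  have i4 := continuous_ellipticMoment_integrand 4 (-5 / 2) hm
  -- The left side of the hypergeometric equation is the integral of an exact derivative; this
  -- primitive vanishes at both ends because of the factor `sin θ cos θ`.
  set G : ℝ → ℂ := fun θ => -1 / 4 * (((Real.sin θ : ℝ) : ℂ) * ((Real.cos θ : ℝ) : ℂ) *
    (1 - m * ((Real.sin θ : ℝ) : ℂ) ^ 2) ^ (-3 / 2 : ℂ)) with hG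
  set g : ℝ → ℂ := fun θ => m * (1 - m) * (3 / 4 * (((Real.sin θ : ℝ) : ℂ) ^ 4 *
      (1 - m * ((Real.sin θ : ℝ) : ℂ) ^ 2) ^ (-5 / 2 : ℂ))) +
    (1 - 2 * m) * (1 / 2 * (((Real.sin θ : ℝ) : ℂ) ^ 2 *
      (1 - m * ((Real.sin θ : ℝ) : ℂ) ^ 2) ^ (-3 / 2 : ℂ))) -
    1 / 4 * (((Real.sin θ : ℝ) : ℂ) ^ 0 *
      (1 - m * ((Real.sin θ : ℝ) : ℂ) ^ 2) ^ (-1 / 2 : ℂ)) with hg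
  have hderiv : ∀ θ : ℝ, HasDerivAt G (g θ) θ := fun θ => by
    have d1 : HasDerivAt (fun θ : ℝ => ((Real.sin θ : ℝ) : ℂ)) ((Real.cos θ : ℝ) : ℂ) θ :=
      (Real.hasDerivAt_sin θ).ofReal_comp
    have d2 : HasDerivAt (fun θ : ℝ => ((Real.cos θ : ℝ) : ℂ)) ((-Real.sin θ : ℝ) : ℂ) θ :=
      (Real.hasDerivAt_cos θ).ofReal_comp
    have d3 : HasDerivAt (fun θ : ℝ => 1 - m * ((Real.sin θ : ℝ) : ℂ) ^ 2)
        (-(m * (2 * ((Real.sin θ : ℝ) : ℂ) * ((Real.cos θ : ℝ) : ℂ)))) θ := by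
      refine (((d1.pow 2).const_mul m).const_sub 1).congr_deriv ?_
      push_cast; ring
    have d4 := (Complex.hasStrictDerivAt_cpow_const (c := (-3 / 2 : ℂ)) (hs θ)).hasDerivAt.comp θ d3
    refine (((d1.mul d2).mul d4).const_mul (-1 / 4 : ℂ)).congr_deriv ?_
    have hne := slitPlane_ne_zero (hs θ)
    have hcs : ((Real.cos θ : ℝ) : ℂ) ^ 2 = 1 - ((Real.sin θ : ℝ) : ℂ) ^ 2 := by
      rw [← Complex.ofReal_pow, Real.cos_sq']; push_cast; ring
    simp only [hg, Pi.mul_apply, Function.comp_apply]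
    set Δ := 1 - m * ((Real.sin θ : ℝ) : ℂ) ^ 2 with hΔ
    have e1 : Δ ^ (-3 / 2 : ℂ) = Δ * Δ ^ (-5 / 2 : ℂ) := by
      rw [show (-3 / 2 : ℂ) = 1 + (-5 / 2) by norm_num, Complex.cpow_add _ _ hne, cpow_one]
    have e2 : Δ ^ (-1 / 2 : ℂ) = Δ ^ 2 * Δ ^ (-5 / 2 : ℂ) := by
      rw [show (-1 / 2 : ℂ) = (2 : ℕ) + (-5 / 2) by norm_num, Complex.cpow_add _ _ hne,
        cpow_natCast]
    rw [show (-3 / 2 : ℂ) - 1 = -5 / 2 by norm_num, e1, e2]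
    generalize Δ ^ (-5 / 2 : ℂ) = D
    rw [hΔ]
    push_cast at hcs ⊢
    generalize Complex.sin θ = s at *
    generalize Complex.cos θ = c at *
    linear_combination (-1 / 4 * D * (1 + 2 * m * s ^ 2)) * hcs
  have hcont : Continuous g := by
    simp only [hg]
    exact (((i4.const_mul _).const_mul _).add ((i2.const_mul _).const_mul _)).sub (i0.const_mul _)
  have hint := intervalIntegral.integral_eq_sub_of_hasDerivAt (fun θ _ => hderiv θ)
    (hcont.intervalIntegrable 0 (π / 2))
  have hG0 : G (π / 2) - G 0 = 0 := by simp [hG]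
  rw [hG0] at hint
  simp only [ellipticMoment]
  rw [← hint]
  simp only [hg]
  rw [intervalIntegral.integral_sub, intervalIntegral.integral_add]
  · simp only [intervalIntegral.integral_const_mul]
  · exact ((i4.const_mul _).const_mul _).intervalIntegrable _ _
  · exact ((i2.const_mul _).const_mul _).intervalIntegrable _ _
  · exact (((i4.const_mul _).const_mul _).add ((i2.const_mul _).const_mul _)).intervalIntegrable _ _
  · exact (i0.const_mul _).intervalIntegrable _ _

/-- The first derivative of `ellipticE`. -/
noncomputable def ellipticE' (m : ℂ) : ℂ := 1 / 2 * ellipticMoment 2 (-3 / 2) m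

/-- The second derivative of `ellipticE`. -/
noncomputable def ellipticE'' (m : ℂ) : ℂ := 3 / 4 * ellipticMoment 4 (-5 / 2) m

theorem hasDerivAt_ellipticE {m : ℂ} (hm : m ∈ cutPlane) :
    HasDerivAt ellipticE (ellipticE' m) m := by
  have := hasDerivAt_ellipticMoment 0 (-1 / 2) hm
  refine this.congr_deriv ?_
  rw [ellipticE']
  norm_num

theorem hasDerivAt_ellipticE' {m : ℂ} (hm : m ∈ cutPlane) :
    HasDerivAt ellipticE' (ellipticE'' m) m := by
  have := (hasDerivAt_ellipticMoment 2 (-3 / 2) hm).const_mul (1 / 2)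
  refine this.congr_deriv ?_
  rw [ellipticE'']
  norm_num
  ring

theorem ellipticE_equation {m : ℂ} (hm : m ∈ cutPlane) :
    m * (1 - m) * ellipticE'' m + (1 - 2 * m) * ellipticE' m - 1 / 4 * ellipticE m = 0 :=
  ellipticMoment_relation hm

theorem zero_mem_cutPlane : (0 : ℂ) ∈ cutPlane := by simp [cutPlane]

theorem ellipticE_zero : ellipticE 0 = π / 2 := by
  simp [ellipticE, ellipticMoment]

theorem image_sin_Ioo : Real.sin '' Set.Ioo 0 (π / 2) = Set.Ioo 0 1 := by
  ext y
  constructor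
  · rintro ⟨θ, hθ, rfl⟩
    refine ⟨Real.sin_pos_of_pos_of_lt_pi hθ.1 (by linarith [hθ.2, Real.pi_pos]), ?_⟩
    rw [← Real.sin_pi_div_two]
    exact Real.sin_lt_sin_of_lt_of_le_pi_div_two (by linarith [hθ.1, Real.pi_pos]) le_rfl hθ.2
  · rintro ⟨h0, h1⟩
    exact ⟨Real.arcsin y, ⟨Real.arcsin_pos.mpr h0, Real.arcsin_lt_pi_div_two.mpr h1⟩,
      Real.sin_arcsin (by linarith) h1.le⟩

/-- Substitution `t = sin θ`, on open intervals because of the singularity at `t = 1`. The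
integrands match pointwise, so nothing is required of `m`. -/
theorem integral_eq_ellipticE (m : ℂ) :
    ∫ t in (0 : ℝ)..1, 1 / (((√(1 - t ^ 2) : ℝ) : ℂ) * (1 - m * t ^ 2) ^ (1 / 2 : ℂ)) =
      ellipticE m := by
  have hsub : Set.Ioo 0 (π / 2) ⊆ Set.Icc (-(π / 2)) (π / 2) :=
    fun θ hθ => ⟨by linarith [hθ.1, Real.pi_pos], hθ.2.le⟩
  have hinj : Set.InjOn Real.sin (Set.Ioo 0 (π / 2)) := Real.strictMonoOn_sin.injOn.mono hsub
  rw [intervalIntegral.integral_of_le zero_le_one, integral_Ioc_eq_integral_Ioo, ← image_sin_Ioo,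
    integral_image_eq_integral_abs_deriv_smul measurableSet_Ioo
      (fun θ _ => (Real.hasDerivAt_sin θ).hasDerivWithinAt) hinj,
    ellipticE, ellipticMoment, intervalIntegral.integral_of_le (by positivity),
    integral_Ioc_eq_integral_Ioo]
  refine setIntegral_congr_fun measurableSet_Ioo fun θ hθ => ?_
  have hcos : 0 < Real.cos θ :=
    Real.cos_pos_of_mem_Ioo ⟨by linarith [hθ.1, Real.pi_pos], hθ.2⟩
  have hc : ((Real.cos θ : ℝ) : ℂ) ≠ 0 := by exact_mod_cast hcos.ne'
  simp only [← Real.cos_sq', Real.sqrt_sq hcos.le, abs_of_pos hcos, Complex.real_smul, pow_zero,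
    one_mul]
  rw [mul_one_div, div_mul_eq_div_div, div_self hc,
    show (-1 / 2 : ℂ) = -(1 / 2) by norm_num, Complex.cpow_neg, one_div]

theorem ellK_eq (k : ℂ) : ellK k = ellipticE (k ^ 2) := integral_eq_ellipticE _

theorem ellK'_eq (k : ℂ) : ellK' k = ellipticE (1 - k ^ 2) := integral_eq_ellipticE _

/-! ### The arithmetic-geometric mean -/

/-- Gauss's integral. -/
noncomputable def gaussIntegral (a b : ℝ) : ℝ :=
  ∫ u in Set.Ioi (0 : ℝ), 1 / √((u ^ 2 + a ^ 2) * (u ^ 2 + b ^ 2))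

theorem gaussIntegral_mean {a b A B : ℝ} (ha : 0 < a) (hb : 0 < b) (hA : A = (a + b) / 2)
    (hB : B ^ 2 = a * b) : gaussIntegral A B = gaussIntegral a b := by
  have hab : 0 < a * b := mul_pos ha hb
  set f : ℝ → ℝ := fun u => 1 / √((u ^ 2 + A ^ 2) * (u ^ 2 + B ^ 2)) with hf
  have heven : ∫ u, f u = 2 * gaussIntegral A B := by
    have := integral_comp_abs (f := f)
    simp only [hf, sq_abs] at this
    exact this
  -- The substitution `u = (t - ab/t)/2` maps `(0, ∞)` bijectively onto the line; the doubling is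
  -- compensated by the evenness of the integrand.
  set φ : ℝ → ℝ := fun t => (t - a * b / t) / 2 with hφ
  have himage : φ '' Set.Ioi 0 = Set.univ := by
    refine Set.eq_univ_of_forall fun u => ?_
    have hs : u ^ 2 < u ^ 2 + a * b := by linarith
    have hlt : |u| < √(u ^ 2 + a * b) := Real.lt_sqrt_of_sq_lt (by rwa [sq_abs])
    have hpos : 0 < u + √(u ^ 2 + a * b) := by linarith [neg_abs_le u]
    refine ⟨u + √(u ^ 2 + a * b), hpos, ?_⟩
    have hsq := Real.sq_sqrt (show 0 ≤ u ^ 2 + a * b by positivity)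
    simp only [hφ]
    field_simp
    linear_combination hsq
  have hinj : Set.InjOn φ (Set.Ioi 0) := by
    intro s hs t ht h
    have hs : 0 < s := hs
    have ht : 0 < t := ht
    simp only [hφ] at h
    field_simp at h
    have : (s - t) * (s * t + a * b) = 0 := by linear_combination h
    rcases mul_eq_zero.mp this with h | h
    · linarith
    · have := mul_pos hs ht; linarith
  have hderiv : ∀ t ∈ Set.Ioi (0 : ℝ),
      HasDerivWithinAt φ ((1 + a * b / t ^ 2) / 2) (Set.Ioi 0) t := fun t ht => by
    have ht : t ≠ 0 := ne_of_gt ht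
    have h1 : HasDerivAt (fun t : ℝ => a * b / t) (-(a * b) / t ^ 2) t := by
      simpa [div_eq_mul_inv] using (hasDerivAt_inv ht).const_mul (a * b)
    exact ((((hasDerivAt_id t).sub h1).div_const 2).congr_deriv (by ring)).hasDerivWithinAt
  have hchange := integral_image_eq_integral_abs_deriv_smul measurableSet_Ioi hderiv hinj f
  rw [himage, setIntegral_univ, heven] at hchange
  have h2 : ∫ t in Set.Ioi (0 : ℝ), |(1 + a * b / t ^ 2) / 2| • f (φ t) =
      2 * gaussIntegral a b := by
    rw [gaussIntegral, ← integral_const_mul]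
    refine setIntegral_congr_fun measurableSet_Ioi fun t ht => ?_
    have ht : 0 < t := ht
    have e1 : φ t ^ 2 + B ^ 2 = ((t ^ 2 + a * b) / (2 * t)) ^ 2 := by
      rw [hB]; simp only [hφ]; field_simp; ring
    have e2 : φ t ^ 2 + A ^ 2 = ((t ^ 2 + a ^ 2) * (t ^ 2 + b ^ 2)) / (2 * t) ^ 2 := by
      rw [hA]; simp only [hφ]; field_simp; ring
    have hp : 0 < t ^ 2 + a * b := by positivity
    have hr : 0 < √((t ^ 2 + a ^ 2) * (t ^ 2 + b ^ 2)) := Real.sqrt_pos.mpr (by positivity)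
    simp only [hf, smul_eq_mul]
    rw [e1, e2, Real.sqrt_mul (by positivity), Real.sqrt_sq (by positivity),
      Real.sqrt_div (by positivity), Real.sqrt_sq (by positivity), abs_of_pos (by positivity)]
    field_simp
  linarith

theorem image_mul_tan_Ioo {b : ℝ} (hb : 0 < b) :
    (fun θ => b * Real.tan θ) '' Set.Ioo 0 (π / 2) = Set.Ioi 0 := by
  ext y
  constructor
  · rintro ⟨θ, hθ, rfl⟩
    exact mul_pos hb (Real.tan_pos_of_pos_of_lt_pi_div_two hθ.1 hθ.2)
  · intro hy
    have hy : 0 < y := hy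
    refine ⟨Real.arctan (y / b), ⟨Real.arctan_pos.mpr (by positivity), Real.arctan_lt_pi_div_two _⟩,
      ?_⟩
    simp only [Real.tan_arctan]
    field_simp

/-- Substitution `u = b tan θ` in Gauss's integral. -/
theorem ellipticE_eq_gaussIntegral {a b : ℝ} (ha : 0 < a) (hb : 0 < b) :
    ellipticE (1 - (b : ℂ) ^ 2 / (a : ℂ) ^ 2) = ((a * gaussIntegral a b : ℝ) : ℂ) := by
  have hcos : ∀ θ ∈ Set.Ioo 0 (π / 2), 0 < Real.cos θ := fun θ hθ =>
    Real.cos_pos_of_mem_Ioo ⟨by linarith [hθ.1, Real.pi_pos], hθ.2⟩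
  have hinj : Set.InjOn (fun θ => b * Real.tan θ) (Set.Ioo 0 (π / 2)) :=
    fun s hs t ht h => Real.strictMonoOn_tan.injOn
      ⟨by linarith [hs.1, Real.pi_pos], hs.2⟩ ⟨by linarith [ht.1, Real.pi_pos], ht.2⟩
      (mul_left_cancel₀ hb.ne' h)
  rw [gaussIntegral, ← image_mul_tan_Ioo hb,
    integral_image_eq_integral_abs_deriv_smul measurableSet_Ioo
      (fun θ hθ => ((Real.hasDerivAt_tan (hcos θ hθ).ne').const_mul b).hasDerivWithinAt)
      hinj,
    ← integral_const_mul, ← integral_complex_ofReal,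
    ellipticE, ellipticMoment, intervalIntegral.integral_of_le (by positivity),
    integral_Ioc_eq_integral_Ioo]
  refine setIntegral_congr_fun measurableSet_Ioo fun θ hθ => ?_
  have hc := hcos θ hθ
  have hcs := Real.cos_sq' θ
  simp only [pow_zero, one_mul, smul_eq_mul]
  have hD : 0 < 1 - (1 - b ^ 2 / a ^ 2) * Real.sin θ ^ 2 := by
    rw [show 1 - (1 - b ^ 2 / a ^ 2) * Real.sin θ ^ 2 =
      Real.cos θ ^ 2 + b ^ 2 / a ^ 2 * Real.sin θ ^ 2 by rw [hcs]; ring]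
    positivity
  rw [show 1 - (1 - (b : ℂ) ^ 2 / (a : ℂ) ^ 2) * ((Real.sin θ : ℝ) : ℂ) ^ 2 =
      ((1 - (1 - b ^ 2 / a ^ 2) * Real.sin θ ^ 2 : ℝ) : ℂ) by push_cast; ring,
    show (-1 / 2 : ℂ) = ((-(1 / 2) : ℝ) : ℂ) by push_cast; ring,
    ← Complex.ofReal_cpow hD.le, Real.rpow_neg hD.le, ← Real.sqrt_eq_rpow]
  congr 1
  have e : ((b * Real.tan θ) ^ 2 + a ^ 2) * ((b * Real.tan θ) ^ 2 + b ^ 2) =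
      (a * b / Real.cos θ ^ 2) ^ 2 * (1 - (1 - b ^ 2 / a ^ 2) * Real.sin θ ^ 2) := by
    have hsec : (b * Real.tan θ) ^ 2 + b ^ 2 = b ^ 2 / Real.cos θ ^ 2 := by
      rw [Real.tan_eq_sin_div_cos]
      field_simp
      linear_combination hcs
    rw [hsec, show 1 - (1 - b ^ 2 / a ^ 2) * Real.sin θ ^ 2 =
      Real.cos θ ^ 2 + b ^ 2 / a ^ 2 * Real.sin θ ^ 2 by rw [hcs]; ring, Real.tan_eq_sin_div_cos]
    field_simp
    ring
  rw [e, Real.sqrt_mul (by positivity), Real.sqrt_sq (by positivity),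
    abs_of_pos (by positivity)]
  have := Real.sqrt_pos.mpr hD
  field_simp

/-! ### The elliptic integrals along the imaginary axis -/

theorem theta3_theta4_real (t : ℝ) :
    (∃ a : ℝ, theta3 (t * I) = a) ∧ ∃ b : ℝ, theta4 (t * I) = b := by
  refine ⟨Complex.conj_eq_iff_real.mp ?_, Complex.conj_eq_iff_real.mp ?_⟩
  · rw [theta3_eq, jacobiTheta₂_conj]; simp
  · rw [theta4, jacobiTheta₂_conj]; simp [Complex.conj_ofNat]

/-- Under `t ↦ 2t` the squares `θ₃(it)²` and `θ₄(it)²` undergo a step of the arithmetic-geometric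
mean, so their Gauss integral is constant along `2ⁿt`. In the limit both squares tend to `1` and the
modulus to `0`, which evaluates the integral as `π/2`. -/
theorem ellipticE_one_sub_xFun_imag {t : ℝ} (ht : 0 < t) :
    ellipticE (1 - xFun (t * I) ^ 4) = π / 2 * theta3 (t * I) ^ 2 := by
  choose a ha using fun t => (theta3_theta4_real t).1
  choose b hb using fun t => (theta3_theta4_real t).2
  have him : ∀ t : ℝ, 0 < t → 0 < ((t : ℂ) * I).im := fun t ht => by simpa using ht
  have ha0 : ∀ t, 0 < t → 0 < a t ^ 2 := fun t ht => by
    have := theta3_ne_zero (him t ht)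
    rw [ha] at this
    exact sq_pos_of_ne_zero (by exact_mod_cast this)
  have hb0 : ∀ t, 0 < t → 0 < b t ^ 2 := fun t ht => by
    have := theta4_ne_zero (him t ht)
    rw [hb] at this
    exact sq_pos_of_ne_zero (by exact_mod_cast this)
  have hx : ∀ t : ℝ, xFun (t * I) ^ 4 = ((b t ^ 2 : ℝ) : ℂ) ^ 2 / ((a t ^ 2 : ℝ) : ℂ) ^ 2 := fun t => by
    rw [xFun, ha, hb, div_pow]; push_cast; ring
  have hE : ∀ t : ℝ, 0 < t → ellipticE (1 - xFun (t * I) ^ 4) =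
      ((a t ^ 2 * gaussIntegral (a t ^ 2) (b t ^ 2) : ℝ) : ℂ) := fun t ht => by
    rw [hx, ellipticE_eq_gaussIntegral (ha0 t ht) (hb0 t ht)]
  have hdouble : ∀ t : ℝ, 0 < t → gaussIntegral (a (2 * t) ^ 2) (b (2 * t) ^ 2) =
      gaussIntegral (a t ^ 2) (b t ^ 2) := fun t ht => by
    have e1 := theta3_sq (him t ht)
    have e2 := theta4_sq (him t ht)
    have e3 := theta3_mul_theta4 (him t ht)
    have h2 : 2 * ((t : ℂ) * I) = ((2 * t : ℝ) : ℂ) * I := by push_cast; ring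
    rw [h2, ha, ha] at e1
    rw [h2, hb, ha] at e2
    rw [h2, ha, hb, hb] at e3
    have e4 : a (2 * t) ^ 2 = (a t ^ 2 + b t ^ 2) / 2 := by
      have : ((a (2 * t) ^ 2 : ℝ) : ℂ) = (((a t ^ 2 + b t ^ 2) / 2 : ℝ) : ℂ) := by
        push_cast; linear_combination -(e1 + e2) / 2
      exact_mod_cast this
    have e5 : a t * b t = b (2 * t) ^ 2 := by exact_mod_cast e3
    exact gaussIntegral_mean (ha0 t ht) (hb0 t ht) e4 (by rw [← e5]; ring)
  have hpow : ∀ n : ℕ, gaussIntegral (a (2 ^ n * t) ^ 2) (b (2 ^ n * t) ^ 2) =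
      gaussIntegral (a t ^ 2) (b t ^ 2) := fun n => by
    induction n with
    | zero => simp
    | succ n ih =>
      have h := hdouble (2 ^ n * t) (by positivity)
      rw [show 2 * (2 ^ n * t) = 2 ^ (n + 1) * t by ring] at h
      rw [h, ih]
  have hlim := tendsto_two_pow_mul (him t ht)
  have hseq : ∀ n : ℕ, (2 : ℂ) ^ n * (t * I) = ((2 ^ n * t : ℝ) : ℂ) * I := fun n => by
    push_cast; ring
  have l1 : Tendsto (fun n : ℕ => ellipticE (1 - xFun (2 ^ n * (t * I)) ^ 4)) atTop
      (𝓝 (π / 2)) := by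
    rw [← ellipticE_zero]
    refine (hasDerivAt_ellipticE zero_mem_cutPlane).continuousAt.tendsto.comp ?_
    have := ((tendsto_xFun.comp hlim).pow 4).const_sub 1
    simpa using this
  have l2 : Tendsto (fun n : ℕ => theta3 (2 ^ n * (t * I)) ^ 2 *
      gaussIntegral (a t ^ 2) (b t ^ 2)) atTop (𝓝 (gaussIntegral (a t ^ 2) (b t ^ 2))) := by
    have := ((tendsto_theta3.comp hlim).pow 2).mul_const
      ((gaussIntegral (a t ^ 2) (b t ^ 2) : ℝ) : ℂ)
    simpa using this
  have hG := tendsto_nhds_unique l1 (l2.congr fun n => by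
    rw [hseq, hE _ (by positivity), hpow, ha]; push_cast; ring)
  rw [hE t ht, ha, hG]
  push_cast
  rw [← hG]
  ring

/-! ### The first derivatives of `x` and `w` -/

theorem isOpen_im_pos : IsOpen {τ : ℂ | 0 < τ.im} := isOpen_lt continuous_const continuous_im

theorem isPreconnected_im_pos : IsPreconnected {τ : ℂ | 0 < τ.im} :=
  (convex_halfSpace_im_gt 0).isPreconnected

/-- A holomorphic function with a limit at `i∞` has a derivative that vanishes at `i∞`. -/
theorem tendsto_deriv_comap_im {f : ℂ → ℂ} {c : ℂ}
    (hf : ∀ τ : ℂ, 0 < τ.im → DifferentiableAt ℂ f τ) (hc : Tendsto f (comap im atTop) (𝓝 c)) :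
    Tendsto (deriv f) (comap im atTop) (𝓝 0) := by
  rw [Metric.tendsto_nhds]
  intro ε hε
  have h1 : ∀ᶠ τ : ℂ in comap im atTop, dist (f τ) c ≤ ε / 2 :=
    (Metric.tendsto_nhds.mp hc (ε / 2) (by positivity)).mono fun _ h => h.le
  obtain ⟨A, hA⟩ := eventually_atTop.mp (eventually_comap.mp h1)
  refine eventually_comap.mpr (eventually_atTop.mpr ⟨max A 0 + 2, fun b hb τ hτ => ?_⟩)
  have him : ∀ z ∈ Metric.closedBall τ 1, max A 0 + 1 ≤ z.im := fun z hz => by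
    have := (Complex.abs_im_le_norm (z - τ)).trans (mem_closedBall_iff_norm.mp hz)
    rw [Complex.sub_im, hτ] at this
    linarith [neg_abs_le (z.im - b)]
  have hd : ∀ z ∈ Metric.closedBall τ 1, DifferentiableAt ℂ (fun z => f z - c) z := fun z hz =>
    (hf z (by linarith [him z hz, le_max_right A 0])).sub_const c
  have := norm_deriv_le_of_forall_mem_sphere_norm_le (f := fun z => f z - c) (c := τ) one_pos
    (C := ε / 2) ((show DifferentiableOn ℂ (fun z => f z - c) (closure (Metric.ball τ 1)) from
      fun z hz => (hd z (Metric.closure_ball_subset_closedBall hz)).differentiableWithinAt).diffContOnCl)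
    (fun z hz => by
      rw [← dist_eq_norm]
      exact hA z.im (by linarith [him z (Metric.sphere_subset_closedBall hz), le_max_left A 0])
        z rfl)
  rw [deriv_sub_const] at this
  rw [dist_zero_right]
  linarith

theorem hasDerivAt_neg_one_div {τ : ℂ} (h0 : τ ≠ 0) :
    HasDerivAt (fun τ : ℂ => -1 / τ) (1 / τ ^ 2) τ := by
  have := (hasDerivAt_inv h0).neg
  simp only [neg_neg] at this
  refine (this.congr_of_eventuallyEq ?_).congr_deriv (by rw [one_div])
  exact Eventually.of_forall fun z => by simp [neg_div]

theorem ne_zero_of_im_pos {τ : ℂ} (hτ : 0 < τ.im) : τ ≠ 0 := fun h => by simp [h] at hτ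

theorem deriv_wFun_eq {τ : ℂ} (hτ : 0 < τ.im) :
    deriv wFun τ = deriv xFun (-1 / τ) / τ ^ 2 := by
  have h1 : wFun =ᶠ[𝓝 τ] fun τ => xFun (-1 / τ) := by
    filter_upwards [isOpen_im_pos.mem_nhds hτ] with z hz
    exact (xFun_neg_one_div hz).symm
  rw [h1.deriv_eq]
  have := (differentiableAt_xFun (neg_one_div_im_pos hτ)).hasDerivAt.comp τ
    (hasDerivAt_neg_one_div (ne_zero_of_im_pos hτ))
  rw [div_eq_mul_one_div]
  exact this.deriv

theorem wFun_pow_mul_deriv {τ : ℂ} (hτ : 0 < τ.im) :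
    wFun τ ^ 3 * deriv wFun τ = -(xFun τ ^ 3 * deriv xFun τ) := by
  have h1 : (fun τ => xFun τ ^ 4 + wFun τ ^ 4) =ᶠ[𝓝 τ] fun _ => 1 := by
    filter_upwards [isOpen_im_pos.mem_nhds hτ] with z hz
    exact xFun_pow_add_wFun_pow hz
  have h2 := ((differentiableAt_xFun hτ).hasDerivAt.pow 4).add
    ((differentiableAt_wFun hτ).hasDerivAt.pow 4)
  have h3 := h1.hasDerivAt_iff.mp h2 |>.unique (hasDerivAt_const τ 1)
  norm_num at h3
  linear_combination h3 / 4

theorem xFun_mul_wFun_pow {τ : ℂ} (hτ : 0 < τ.im) : yFun τ ^ 2 = -(xFun τ * wFun τ ^ 4) := by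
  rw [yFun_sq_eq hτ]; linear_combination xFun τ * xFun_pow_add_wFun_pow hτ

theorem differentiableAt_deriv_of_im_pos {f : ℂ → ℂ}
    (hf : ∀ τ : ℂ, 0 < τ.im → DifferentiableAt ℂ f τ) {τ : ℂ} (hτ : 0 < τ.im) :
    DifferentiableAt ℂ (deriv f) τ := by
  have : AnalyticOnNhd ℂ f {τ : ℂ | 0 < τ.im} := DifferentiableOn.analyticOnNhd
    (fun z hz => (hf z hz).differentiableWithinAt) isOpen_im_pos
  exact (this τ hτ).deriv.differentiableAt

/-- `w` is `e^{πiτ/4}` times a holomorphic function with limit `2`, whose derivative tends to `0`.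
-/
theorem tendsto_wFun_logDeriv :
    Tendsto (fun τ => deriv wFun τ / wFun τ) (comap im atTop) (𝓝 (π * I / 4)) := by
  set g : ℂ → ℂ := fun τ => jacobiTheta₂ (τ / 2) τ / theta3 τ with hg
  have hgd : ∀ τ : ℂ, 0 < τ.im → DifferentiableAt ℂ g τ := fun τ hτ => by
    refine DifferentiableAt.div ?_ (differentiableAt_theta3 hτ) (theta3_ne_zero hτ)
    exact (hasFDerivAt_jacobiTheta₂ (τ / 2) hτ).differentiableAt.comp τ
      (f := fun τ : ℂ => (τ / 2, τ)) (by fun_prop)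
  have hgl : Tendsto g (comap im atTop) (𝓝 2) := by
    have := tendsto_jacobiTheta₂_half.div tendsto_theta3 one_ne_zero
    rwa [div_one] at this
  have hw : ∀ τ, wFun τ = cexp (π * I * τ / 4) * g τ := fun τ => by
    rw [wFun, theta2, hg, mul_div_assoc]
  have hlim := ((tendsto_deriv_comap_im hgd hgl).div hgl two_ne_zero).const_add (π * I / 4)
  rw [zero_div, add_zero] at hlim
  refine hlim.congr' ?_
  filter_upwards [(eventually_gt_atTop (0 : ℝ)).comap im] with τ hτ
  have h1 : HasDerivAt (fun τ : ℂ => cexp (π * I * τ / 4)) (cexp (π * I * τ / 4) * (π * I / 4)) τ := by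
    have : HasDerivAt (fun τ : ℂ => π * I * τ / 4) (π * I / 4) τ := by
      simpa using ((hasDerivAt_id τ).const_mul (π * I : ℂ)).div_const 4
    exact this.cexp
  have h2 : HasDerivAt wFun _ τ := (h1.mul (hgd τ hτ).hasDerivAt).congr_of_eventuallyEq
    (Eventually.of_forall hw)
  have h3 := wFun_ne_zero hτ
  rw [hw] at h3
  have h4 := right_ne_zero_of_mul h3
  have h5 := left_ne_zero_of_mul h3
  rw [h2.deriv, hw]
  simp only [Pi.div_apply]
  field_simp

theorem theta3_pow_neg_one_div {τ : ℂ} (hτ : 0 < τ.im) :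
    theta3 (-1 / τ) ^ 4 = -τ ^ 2 * theta3 τ ^ 4 := by
  rw [theta3_neg_one_div hτ]
  have := neg_I_mul_cpow_sq τ
  linear_combination (((-I * τ) ^ (1 / 2 : ℂ)) ^ 2 - I * τ) * theta3 τ ^ 4 * this +
    τ ^ 2 * theta3 τ ^ 4 * I_sq

theorem deriv_xFun_add_one {τ : ℂ} (hτ : 0 < τ.im) :
    deriv xFun (τ + 1) = -deriv xFun τ / xFun τ ^ 2 := by
  rw [← deriv_comp_add_const, ← ((differentiableAt_xFun hτ).hasDerivAt.inv (xFun_ne_zero hτ)).deriv]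
  congr 1
  funext t
  exact xFun_add_one t

/-- The logarithmic derivative of `x`, in terms of theta constants. -/
theorem deriv_xFun_eq {τ : ℂ} (hτ : 0 < τ.im) :
    deriv xFun τ = π * I / 4 * (yFun τ ^ 2 * theta3 τ ^ 4) := by
  have hne : ∀ τ : ℂ, 0 < τ.im → yFun τ ^ 2 * theta3 τ ^ 4 ≠ 0 := fun τ hτ =>
    mul_ne_zero (pow_ne_zero 2 (yFun_ne_zero hτ)) (pow_ne_zero 4 (theta3_ne_zero hτ))
  have key := eq_of_modular_invariant (f := fun τ => deriv xFun τ / (yFun τ ^ 2 * theta3 τ ^ 4))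
    (c := π * I / 4) (fun τ => ?_) (fun τ => ?_) (fun τ => ?_) ?_ ⟨τ, hτ⟩
  · change deriv xFun τ / (yFun τ ^ 2 * theta3 τ ^ 4) = _ at key
    rwa [div_eq_iff (hne τ hτ)] at key
  · exact (differentiableAt_deriv_of_im_pos (fun _ h => differentiableAt_xFun h) τ.2).div
      (((differentiableAt_yFun τ.2).pow 2).mul ((differentiableAt_theta3 τ.2).pow 4)) (hne τ τ.2)
  · have hx := xFun_ne_zero τ.2
    have h3 := theta3_ne_zero τ.2
    have hy := yFun_ne_zero τ.2
    have hy2 : yFun (τ + 1) ^ 2 = -(yFun τ ^ 2 / xFun τ ^ 6) := by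
      rw [yFun_sq_eq (add_one_im_pos τ.2), xFun_add_one, yFun_sq_eq τ.2]
      field_simp
      ring
    have h4 : theta4 τ = xFun τ * theta3 τ := by rw [xFun]; field_simp
    rw [deriv_xFun_add_one τ.2, hy2, theta3_add_one, h4]
    field_simp
  · have hx := xFun_ne_zero τ.2
    have hw := wFun_ne_zero τ.2
    have h3 := theta3_ne_zero τ.2
    have hτ0 := ne_zero_of_im_pos τ.2
    have e1 := deriv_wFun_eq τ.2
    have e2 := wFun_pow_mul_deriv τ.2
    have hd : deriv xFun (-1 / τ) = -(τ ^ 2 * xFun τ ^ 3 * deriv xFun τ / wFun τ ^ 3) := by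
      rw [eq_div_iff (pow_ne_zero 2 hτ0)] at e1
      rw [← e1]
      field_simp
      linear_combination e2
    rw [xFun_mul_wFun_pow (neg_one_div_im_pos τ.2), xFun_mul_wFun_pow τ.2, xFun_neg_one_div τ.2,
      wFun_neg_one_div τ.2, theta3_pow_neg_one_div τ.2, hd]
    field_simp
  -- From `w³w' = -x³x'` and `y² = -x w⁴` the quotient equals `(w'/w)/(x⁴θ₃⁴)`, whose limit is
  -- visible.
  · have h1 := tendsto_wFun_logDeriv.div ((tendsto_xFun.pow 4).mul (tendsto_theta3.pow 4))
      (by simp)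
    simp only [one_pow, mul_one, div_one] at h1
    refine h1.congr' ?_
    filter_upwards [(eventually_gt_atTop (0 : ℝ)).comap im] with τ hτ
    have hx := xFun_ne_zero hτ
    have hw := wFun_ne_zero hτ
    have h3 := theta3_ne_zero hτ
    have e2 := wFun_pow_mul_deriv hτ
    simp only [Pi.div_apply]
    rw [xFun_mul_wFun_pow hτ]
    field_simp
    linear_combination e2

theorem deriv_xFun_ne_zero {τ : ℂ} (hτ : 0 < τ.im) : deriv xFun τ ≠ 0 := by
  rw [deriv_xFun_eq hτ]
  refine mul_ne_zero ?_ (mul_ne_zero (pow_ne_zero 2 (yFun_ne_zero hτ))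
    (pow_ne_zero 4 (theta3_ne_zero hτ)))
  simp [Real.pi_ne_zero]

theorem deriv_wFun_ne_zero {τ : ℂ} (hτ : 0 < τ.im) : deriv wFun τ ≠ 0 := by
  rw [deriv_wFun_eq hτ]
  exact div_ne_zero (deriv_xFun_ne_zero (neg_one_div_im_pos hτ))
    (pow_ne_zero 2 (ne_zero_of_im_pos hτ))

/-! ### The Fuchsian equation -/

theorem mem_principalDomain_iff {x : ℂ} :
    x ∈ principalDomain ↔ x ^ 4 ∈ cutPlane ∧ 1 - x ^ 4 ∈ cutPlane := by
  have aux : ∀ z : ℂ, z ∉ slitPlane ↔ ∃ r : ℝ, r ≤ 0 ∧ z = r := fun z => by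
    rw [mem_slitPlane_iff, not_or, not_lt, not_not]
    constructor
    · exact fun h => ⟨z.re, h.1, Complex.ext (by simp) (by simp [h.2])⟩
    · rintro ⟨r, hr, rfl⟩
      exact ⟨by simpa using hr, by simp⟩
  have h1 : x ^ 4 ∈ cutPlane ↔ ¬ ∃ r : ℝ, 1 ≤ r ∧ x ^ 4 = r := by
    change 1 - x ^ 4 ∈ slitPlane ↔ _
    rw [← not_iff_not, not_not, aux]
    constructor
    · rintro ⟨r, hr, h⟩
      exact ⟨1 - r, by linarith, by push_cast; linear_combination -h⟩
    · rintro ⟨r, hr, h⟩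
      exact ⟨1 - r, by linarith, by push_cast; linear_combination -h⟩
  have h2 : 1 - x ^ 4 ∈ cutPlane ↔ ¬ ∃ r : ℝ, r ≤ 0 ∧ x ^ 4 = r := by
    change 1 - (1 - x ^ 4) ∈ slitPlane ↔ _
    rw [← not_iff_not, not_not, aux, sub_sub_cancel]
  rw [h1, h2]
  change (¬ ∃ r : ℝ, (r ≤ 0 ∨ 1 ≤ r) ∧ x ^ 4 = r) ↔ _
  rw [← not_or, not_iff_not]
  constructor
  · rintro ⟨r, h | h, hr⟩
    · exact Or.inr ⟨r, h, hr⟩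
    · exact Or.inl ⟨r, h, hr⟩
  · rintro (⟨r, h, hr⟩ | ⟨r, h, hr⟩)
    · exact ⟨r, Or.inr h, hr⟩
    · exact ⟨r, Or.inl h, hr⟩

theorem isOpen_principalDomain : IsOpen principalDomain := by
  have : principalDomain = {x | x ^ 4 ∈ cutPlane} ∩ {x | 1 - x ^ 4 ∈ cutPlane} :=
    Set.ext fun x => mem_principalDomain_iff
  rw [this]
  exact (isOpen_cutPlane.preimage (by fun_prop : Continuous fun x : ℂ => x ^ 4)).inter
    (isOpen_cutPlane.preimage (by fun_prop : Continuous fun x : ℂ => 1 - x ^ 4))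

theorem quintic_ne_zero {x : ℂ} (hx : x ∈ principalDomain) : x ^ 5 - x ≠ 0 := by
  intro h
  have : x * (x ^ 4 - 1) = 0 := by linear_combination h
  rcases mul_eq_zero.mp this with h | h
  · exact hx ⟨0, Or.inl le_rfl, by rw [h]; simp⟩
  · exact hx ⟨1, Or.inr le_rfl, by push_cast; linear_combination h⟩

/-- `F` solves `((x - x⁵) F')' = 4x³ F` at the points of `U`, with the derivatives `F₁`, `F₂`. -/
def IsPeriodSolution (U : Set ℂ) (F F₁ F₂ : ℂ → ℂ) : Prop :=
  ∀ u ∈ U, HasDerivAt F (F₁ u) u ∧ HasDerivAt F₁ (F₂ u) u ∧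
    (u - u ^ 5) * F₂ u + (1 - 5 * u ^ 4) * F₁ u - 4 * u ^ 3 * F u = 0

theorem IsPeriodSolution.const_mul {U : Set ℂ} {F F₁ F₂ : ℂ → ℂ} (h : IsPeriodSolution U F F₁ F₂)
    (c : ℂ) : IsPeriodSolution U (fun u => c * F u) (fun u => c * F₁ u) (fun u => c * F₂ u) :=
  fun u hu => by
    obtain ⟨h1, h2, h3⟩ := h u hu
    exact ⟨h1.const_mul c, h2.const_mul c, by linear_combination c * h3⟩

/-- The hypergeometric equation with `m = u⁴`, multiplied by `16u³`; the symmetry `m ↦ 1 - m` of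
that equation gives the companion statement. -/
theorem isPeriodSolution_ellipticE :
    IsPeriodSolution principalDomain (fun u => ellipticE (u ^ 4))
      (fun u => 4 * u ^ 3 * ellipticE' (u ^ 4))
      (fun u => 12 * u ^ 2 * ellipticE' (u ^ 4) + 16 * u ^ 6 * ellipticE'' (u ^ 4)) := by
  intro u hu
  have hm := (mem_principalDomain_iff.mp hu).1
  have hp : HasDerivAt (fun u : ℂ => u ^ 4) (4 * u ^ 3) u := by simpa using hasDerivAt_pow 4 u
  have hp3 : HasDerivAt (fun u : ℂ => 4 * u ^ 3) (12 * u ^ 2) u :=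
    ((hasDerivAt_pow 3 u).const_mul 4).congr_deriv (by push_cast; ring)
  have hc : HasDerivAt (fun u : ℂ => ellipticE' (u ^ 4)) (ellipticE'' (u ^ 4) * (4 * u ^ 3)) u :=
    HasDerivAt.comp (h₂ := ellipticE') (h := fun u : ℂ => u ^ 4) u (hasDerivAt_ellipticE' hm) hp
  refine ⟨((hasDerivAt_ellipticE hm).comp u hp).congr_deriv (by ring),
    (hp3.fun_mul hc).congr_deriv (by ring), ?_⟩
  linear_combination 16 * u ^ 3 * ellipticE_equation hm

theorem isPeriodSolution_ellipticE_one_sub :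
    IsPeriodSolution principalDomain (fun u => ellipticE (1 - u ^ 4))
      (fun u => -4 * u ^ 3 * ellipticE' (1 - u ^ 4))
      (fun u => -12 * u ^ 2 * ellipticE' (1 - u ^ 4) + 16 * u ^ 6 * ellipticE'' (1 - u ^ 4)) := by
  intro u hu
  have hm := (mem_principalDomain_iff.mp hu).2
  have hp : HasDerivAt (fun u : ℂ => 1 - u ^ 4) (-(4 * u ^ 3)) u := by
    simpa using (hasDerivAt_pow 4 u).const_sub 1
  have hp3 : HasDerivAt (fun u : ℂ => -4 * u ^ 3) (-12 * u ^ 2) u :=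
    ((hasDerivAt_pow 3 u).const_mul (-4)).congr_deriv (by push_cast; ring)
  have hc : HasDerivAt (fun u : ℂ => ellipticE' (1 - u ^ 4)) (ellipticE'' (1 - u ^ 4) * (-(4 * u ^ 3))) u :=
    HasDerivAt.comp (h₂ := ellipticE') (h := fun u : ℂ => 1 - u ^ 4) u (hasDerivAt_ellipticE' hm) hp
  refine ⟨((hasDerivAt_ellipticE hm).comp u hp).congr_deriv (by ring),
    (hp3.fun_mul hc).congr_deriv (by ring), ?_⟩
  linear_combination 16 * u ^ 3 * ellipticE_equation hm

theorem hasDerivAt_sqrt_quintic {ξ s : ℂ → ℂ} {ξ' t : ℂ} (hξ : HasDerivAt ξ ξ' t)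
    (hs : DifferentiableAt ℂ s t) (h : ∀ᶠ z in 𝓝 t, s z ^ 2 = ξ z ^ 5 - ξ z) (h0 : s t ≠ 0) :
    HasDerivAt s ((5 * ξ t ^ 4 - 1) / (2 * s t) * ξ') t := by
  have h1 : HasDerivAt (fun z => s z ^ 2) _ t :=
    ((hξ.pow 5).sub hξ).congr_of_eventuallyEq h
  have h2 := (hs.hasDerivAt.pow 2).unique h1
  refine hs.hasDerivAt.congr_deriv ?_
  norm_num at h2
  field_simp
  linear_combination h2

/-- The derivative of `s e` with respect to `ξ`, where `s² = ξ⁵ - ξ` and `e₁ = de/dξ`. -/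
noncomputable def quinticDeriv (ξ s e e₁ : ℂ → ℂ) (t : ℂ) : ℂ :=
  (5 * ξ t ^ 4 - 1) / (2 * s t) * e t + s t * e₁ t

theorem hasDerivAt_sqrt_quintic_mul {ξ s e e₁ : ℂ → ℂ} {ξ' t : ℂ} (hξ : HasDerivAt ξ ξ' t)
    (hs : DifferentiableAt ℂ s t) (h : ∀ᶠ z in 𝓝 t, s z ^ 2 = ξ z ^ 5 - ξ z) (h0 : s t ≠ 0)
    (he : HasDerivAt e (e₁ t * ξ') t) :
    HasDerivAt (fun z => s z * e z) (quinticDeriv ξ s e e₁ t * ξ') t :=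
  ((hasDerivAt_sqrt_quintic hξ hs h h0).mul he).congr_deriv (by rw [quinticDeriv]; ring)

/-- The period equation has the form `(pF')' = 4u³F` with `p = u - u⁵`. Multiplication by `s`, where
`s² = -p`, removes the first-order term, and `Q₁/2` is the resulting potential. -/
theorem hasDerivAt_quinticDeriv {ξ s e e₁ : ℂ → ℂ} {ξ' e₂ t : ℂ} (hξ : HasDerivAt ξ ξ' t)
    (hs : DifferentiableAt ℂ s t) (h : ∀ᶠ z in 𝓝 t, s z ^ 2 = ξ z ^ 5 - ξ z) (h0 : s t ≠ 0)
    (he : HasDerivAt e (e₁ t * ξ') t) (he₁ : HasDerivAt e₁ (e₂ * ξ') t)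
    (hode : (ξ t - ξ t ^ 5) * e₂ + (1 - 5 * ξ t ^ 4) * e₁ t - 4 * ξ t ^ 3 * e t = 0) :
    HasDerivAt (quinticDeriv ξ s e e₁) (1 / 2 * Q1 (ξ t) * (s t * e t) * ξ') t := by
  have hds := hasDerivAt_sqrt_quintic hξ hs h h0
  have h1 := ((((hξ.pow 4).const_mul 5).sub_const 1).div (hds.const_mul 2)
    (mul_ne_zero two_ne_zero h0)).mul he |>.add (hds.mul he₁)
  refine h1.congr_deriv ?_
  have hsq := h.self_of_nhds
  have hq : ξ t ^ 2 * (ξ t ^ 4 - 1) ^ 2 = s t ^ 4 := by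
    linear_combination -(s t ^ 2 + ξ t ^ 5 - ξ t) * hsq
  simp only [Q1, hq, Pi.div_apply, Pi.pow_apply]
  push_cast
  generalize s t = S at *
  generalize ξ t = X at *
  generalize e t = A at *
  generalize e₁ t = B at *
  field_simp
  norm_num
  linear_combination -4 * S ^ 2 * ξ' * hode + ξ' * (24 * X ^ 3 * A + 4 * S ^ 2 * e₂) * hsq

/-! ### The elliptic integrals as functions of `τ` -/

theorem xFun_I_pow : xFun I ^ 4 = 1 / 2 := by
  have h := xFun_neg_one_div_pow (τ := I) (by simp)
  rw [show -1 / I = I by rw [div_eq_iff I_ne_zero, I_mul_I]] at h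
  linear_combination h / 2

theorem xFun_I_mem : xFun I ∈ principalDomain := by
  rw [mem_principalDomain_iff, xFun_I_pow]
  constructor <;> simp only [cutPlane, Set.mem_ofPred_eq, mem_slitPlane_iff] <;> norm_num

theorem frequently_imaginary {p : ℂ → Prop} (hp : ∀ t : ℝ, 0 < t → p (t * I)) :
    ∃ᶠ τ in 𝓝[≠] I, p τ := by
  have ht : Tendsto (fun t : ℝ => (t : ℂ) * I) (𝓝[≠] 1) (𝓝[≠] I) := by
    refine tendsto_nhdsWithin_of_tendsto_nhds_of_eventually_within _ ?_ ?_
    · have : Continuous fun t : ℝ => (t : ℂ) * I := by fun_prop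
      simpa using (this.tendsto 1).mono_left nhdsWithin_le_nhds
    · filter_upwards [self_mem_nhdsWithin] with t ht h
      have h : (t : ℂ) * I = I := h
      have h1 : ((t : ℂ) - 1) * I = 0 := by linear_combination h
      have h2 := (mul_eq_zero.mp h1).resolve_right I_ne_zero
      exact ht (by exact_mod_cast sub_eq_zero.mp h2)
  refine ht.frequently (Eventually.frequently ?_)
  filter_upwards [nhdsWithin_le_nhds (lt_mem_nhds one_pos)] with t h0
  exact hp t h0

theorem eqOn_of_imaginary {W : Set ℂ} (hW : IsOpen W) (hWc : IsPreconnected W) (hI : I ∈ W)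
    {f g : ℂ → ℂ} (hf : DifferentiableOn ℂ f W) (hg : DifferentiableOn ℂ g W)
    (h : ∀ t : ℝ, 0 < t → f (t * I) = g (t * I)) : Set.EqOn f g W :=
  (hf.analyticOnNhd hW).eqOn_of_preconnected_of_frequently_eq (hg.analyticOnNhd hW) hWc hI
    (frequently_imaginary h)

/-- The previous evaluation at `i/t`, transported by inversion, which exchanges `x⁴` and `1 - x⁴`.
The factor `-I * (t * I)` is `t`. -/
theorem ellipticE_xFun_imag {t : ℝ} (ht : 0 < t) :
    ellipticE (xFun (t * I) ^ 4) = -I * (t * I) * (π / 2 * theta3 (t * I) ^ 2) := by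
  have hτ : 0 < ((t : ℂ) * I).im := by simpa using ht
  have h1 := ellipticE_one_sub_xFun_imag (inv_pos.mpr ht)
  have h2 : ((t⁻¹ : ℝ) : ℂ) * I = -1 / (t * I) := by
    have ht' : (t : ℂ) ≠ 0 := by exact_mod_cast ht.ne'
    push_cast
    field_simp
    linear_combination I_sq
  rw [h2, xFun_neg_one_div_pow hτ, sub_sub_cancel, theta3_neg_one_div hτ] at h1
  rw [h1, mul_pow, neg_I_mul_cpow_sq]
  ring

/-- The complete elliptic integrals in terms of theta constants. -/
theorem ellipticE_xFun {W : Set ℂ} (hW : IsOpen W) (hWc : IsPreconnected W) (hI : I ∈ W)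
    (him : ∀ τ ∈ W, 0 < τ.im) (hdom : ∀ τ ∈ W, xFun τ ∈ principalDomain) {τ : ℂ} (hτ : τ ∈ W) :
    ellipticE (1 - xFun τ ^ 4) = π / 2 * theta3 τ ^ 2 ∧
    ellipticE (xFun τ ^ 4) = -I * τ * (π / 2 * theta3 τ ^ 2) := by
  have hθ : DifferentiableOn ℂ (fun τ => π / 2 * theta3 τ ^ 2) W := fun τ hτ =>
    (((differentiableAt_theta3 (him τ hτ)).pow 2).const_mul (π / 2 : ℂ)).differentiableWithinAt
  have hE : ∀ F F₁ F₂, IsPeriodSolution principalDomain F F₁ F₂ →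
      DifferentiableOn ℂ (fun τ => F (xFun τ)) W := fun F F₁ F₂ hF τ hτ =>
    ((hF _ (hdom τ hτ)).1.differentiableAt.comp τ
      (differentiableAt_xFun (him τ hτ))).differentiableWithinAt
  exact ⟨eqOn_of_imaginary hW hWc hI (hE _ _ _ isPeriodSolution_ellipticE_one_sub) hθ
      (fun t ht => ellipticE_one_sub_xFun_imag ht) hτ,
    eqOn_of_imaginary hW hWc hI (hE _ _ _ isPeriodSolution_ellipticE)
      ((by fun_prop : Differentiable ℂ fun τ : ℂ => -I * τ).differentiableOn.mul hθ)
      (fun t ht => ellipticE_xFun_imag ht) hτ⟩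

theorem eventually_ellipticE_xFun : ∀ᶠ τ in 𝓝 I, 0 < τ.im ∧ xFun τ ∈ principalDomain ∧
    ellipticE (1 - xFun τ ^ 4) = π / 2 * theta3 τ ^ 2 ∧
    ellipticE (xFun τ ^ 4) = -I * τ * (π / 2 * theta3 τ ^ 2) := by
  have hI : 0 < I.im := by simp
  have h1 : ∀ᶠ τ in 𝓝 I, 0 < τ.im ∧ xFun τ ∈ principalDomain :=
    Filter.Eventually.and (isOpen_im_pos.mem_nhds hI)
      ((differentiableAt_xFun hI).continuousAt.eventually
        (isOpen_principalDomain.mem_nhds xFun_I_mem))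
  obtain ⟨ε, hε, hball⟩ := Metric.eventually_nhds_iff_ball.mp h1
  filter_upwards [Metric.ball_mem_nhds I hε] with τ hτ
  exact ⟨(hball τ hτ).1, (hball τ hτ).2, ellipticE_xFun Metric.isOpen_ball
    (convex_ball I ε).isPreconnected (Metric.mem_ball_self hε) (fun t ht => (hball t ht).1)
    (fun t ht => (hball t ht).2) hτ⟩

/-! ### Solutions of the Fuchsian equation on the upper half-plane -/

theorem Q1_eq_of_sq {u s : ℂ} (h : s ^ 2 = u ^ 5 - u) :
    Q1 u = -(1 / 2) * ((u ^ 8 + 14 * u ^ 4 + 1) / s ^ 4) := by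
  rw [Q1, show u ^ 2 * (u ^ 4 - 1) ^ 2 = s ^ 4 by linear_combination -(s ^ 2 + u ^ 5 - u) * h]

/-- The product of `√(ξ⁵ - ξ)` and a period solution continues to a solution of the Fuchsian
equation on the upper half-plane. -/
theorem exists_fuchsian_of_period {ξ s e F F₁ F₂ : ℂ → ℂ} {U : Set ℂ}
    (hξ : ∀ τ : ℂ, 0 < τ.im → DifferentiableAt ℂ ξ τ)
    (hξ0 : ∀ τ : ℂ, 0 < τ.im → deriv ξ τ ≠ 0)
    (hs : ∀ τ : ℂ, 0 < τ.im → DifferentiableAt ℂ s τ)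
    (hs0 : ∀ τ : ℂ, 0 < τ.im → s τ ≠ 0)
    (hsq : ∀ τ : ℂ, 0 < τ.im → s τ ^ 2 = ξ τ ^ 5 - ξ τ)
    (he : ∀ τ : ℂ, 0 < τ.im → DifferentiableAt ℂ e τ)
    (hF : IsPeriodSolution U F F₁ F₂) (hnear : ∀ᶠ τ in 𝓝 I, ξ τ ∈ U ∧ e τ = F (ξ τ)) :
    ∃ A : ℂ → ℂ, ∀ τ : ℂ, 0 < τ.im →
      HasDerivAt (fun z => s z * e z) (A τ * deriv ξ τ) τ ∧
      HasDerivAt A (1 / 2 * Q1 (ξ τ) * (s τ * e τ) * deriv ξ τ) τ := by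
  have hP : ∀ τ : ℂ, 0 < τ.im → DifferentiableAt ℂ (fun z => s z * e z) τ := fun τ hτ =>
    (hs τ hτ).mul (he τ hτ)
  have hdξ : ∀ τ : ℂ, 0 < τ.im → DifferentiableAt ℂ (deriv ξ) τ := fun τ hτ =>
    differentiableAt_deriv_of_im_pos hξ hτ
  set A : ℂ → ℂ := fun τ => deriv (fun z => s z * e z) τ / deriv ξ τ with hA
  have hAd : ∀ τ : ℂ, 0 < τ.im → DifferentiableAt ℂ A τ := fun τ hτ =>
    (differentiableAt_deriv_of_im_pos hP hτ).div (hdξ τ hτ) (hξ0 τ hτ)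
  have hI : I ∈ {τ : ℂ | 0 < τ.im} := by simp
  -- The equation is verified near `i`, where `e` is the elliptic integral of `ξ`. Both sides are
  -- holomorphic on the half-plane, so it persists; `Q₁` is written with denominator `s⁴` to make
  -- this evident.
  have hcon : ∀ᶠ τ in 𝓝 I, deriv A τ / deriv ξ τ =
      1 / 2 * (-(1 / 2) * ((ξ τ ^ 8 + 14 * ξ τ ^ 4 + 1) / s τ ^ 4)) * (s τ * e τ) := by
    have hquint : ∀ᶠ τ in 𝓝 I, A τ = quinticDeriv ξ s e (fun z => F₁ (ξ z)) τ := by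
      filter_upwards [hnear.eventually_nhds, isOpen_im_pos.mem_nhds hI] with τ h1 hτ
      have hF1 := (hF _ h1.self_of_nhds.1).1.comp τ (hξ τ hτ).hasDerivAt
      have hev : e =ᶠ[𝓝 τ] F ∘ ξ := h1.mono fun z hz => hz.2
      have := hasDerivAt_sqrt_quintic_mul (hξ τ hτ).hasDerivAt (hs τ hτ)
        (by filter_upwards [isOpen_im_pos.mem_nhds hτ] with z hz using hsq z hz) (hs0 τ hτ)
        (e₁ := fun z => F₁ (ξ z)) (hF1.congr_of_eventuallyEq hev)
      rw [hA]
      simp only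
      rw [this.deriv, mul_div_cancel_right₀ _ (hξ0 τ hτ)]
    filter_upwards [hquint.eventually_nhds, hnear.eventually_nhds,
      isOpen_im_pos.mem_nhds hI] with τ h0 h1 hτ
    obtain ⟨f1, f2, f3⟩ := hF _ h1.self_of_nhds.1
    have hev : e =ᶠ[𝓝 τ] F ∘ ξ := h1.mono fun z hz => hz.2
    have hξτ := (hξ τ hτ).hasDerivAt
    have f2' : HasDerivAt (fun z => F₁ (ξ z)) (F₂ (ξ τ) * deriv ξ τ) τ := f2.comp τ hξτ
    have := hasDerivAt_quinticDeriv hξτ (hs τ hτ)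
        (by filter_upwards [isOpen_im_pos.mem_nhds hτ] with z hz using hsq z hz) (hs0 τ hτ)
        (e₁ := fun z => F₁ (ξ z)) ((f1.comp τ hξτ).congr_of_eventuallyEq hev) f2'
        (by rw [h1.self_of_nhds.2]; exact f3)
    rw [Filter.EventuallyEq.deriv_eq h0, this.deriv, mul_div_cancel_right₀ _ (hξ0 τ hτ),
      Q1_eq_of_sq (hsq τ hτ)]
  have hall := AnalyticOnNhd.eqOn_of_preconnected_of_eventuallyEq
    (DifferentiableOn.analyticOnNhd (f := fun τ => deriv A τ / deriv ξ τ)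
      (fun τ hτ => ((differentiableAt_deriv_of_im_pos hAd hτ).div (hdξ τ hτ)
        (hξ0 τ hτ)).differentiableWithinAt) isOpen_im_pos)
    (DifferentiableOn.analyticOnNhd
      (f := fun τ => 1 / 2 * (-(1 / 2) * ((ξ τ ^ 8 + 14 * ξ τ ^ 4 + 1) / s τ ^ 4)) * (s τ * e τ))
      (fun τ hτ => by
        have h1 := hξ τ hτ
        refine DifferentiableAt.differentiableWithinAt ?_
        exact ((((((h1.pow 8).add ((h1.pow 4).const_mul 14)).add_const 1).div ((hs τ hτ).pow 4)
          (pow_ne_zero 4 (hs0 τ hτ))).const_mul (-(1 / 2))).const_mul (1 / 2)).mul (hP τ hτ))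
      isOpen_im_pos) isPreconnected_im_pos hI hcon
  refine ⟨A, fun τ hτ => ⟨?_, ?_⟩⟩
  · rw [hA]
    simp only
    rw [div_mul_cancel₀ _ (hξ0 τ hτ)]
    exact (hP τ hτ).hasDerivAt
  · have := hall hτ
    simp only at this
    rw [div_eq_iff (hξ0 τ hτ)] at this
    rw [Q1_eq_of_sq (hsq τ hτ), ← this]
    exact (hAd τ hτ).hasDerivAt

theorem sqrtIDivPi_sq : sqrtIDivPi ^ 2 = I / π := by
  rw [sqrtIDivPi, ← Complex.cpow_nat_mul]; norm_num

/-- The function `√(i/π) (π/2) ϑ₃²`. -/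
noncomputable def periodFun (τ : ℂ) : ℂ := sqrtIDivPi * (π / 2 * theta3 τ ^ 2)

theorem differentiableAt_periodFun {τ : ℂ} (hτ : 0 < τ.im) : DifferentiableAt ℂ periodFun τ :=
  (((differentiableAt_theta3 hτ).pow 2).const_mul (π / 2 : ℂ)).const_mul _

/-- The constant `√(i/π) · π/2` squares to `πi/4`, the constant in the formula for `x'`. -/
theorem yFun_mul_periodFun_sq {τ : ℂ} (hτ : 0 < τ.im) :
    (yFun τ * periodFun τ) ^ 2 = deriv xFun τ := by
  have hpi : (π : ℂ) ≠ 0 := by exact_mod_cast Real.pi_ne_zero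
  rw [deriv_xFun_eq hτ, periodFun, mul_pow, mul_pow, sqrtIDivPi_sq]
  field_simp
  norm_num
  ring

theorem exists_fuchsian_fst : ∃ A : ℂ → ℂ, ∀ τ : ℂ, 0 < τ.im →
    HasDerivAt (fun z => yFun z * periodFun z) (A τ * deriv xFun τ) τ ∧
    HasDerivAt A (1 / 2 * Q1 (xFun τ) * (yFun τ * periodFun τ) * deriv xFun τ) τ := by
  refine exists_fuchsian_of_period (fun _ h => differentiableAt_xFun h)
    (fun _ h => deriv_xFun_ne_zero h) (fun _ h => differentiableAt_yFun h)
    (fun _ h => yFun_ne_zero h) (fun _ h => yFun_sq_eq h)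
    (fun _ h => differentiableAt_periodFun h)
    (isPeriodSolution_ellipticE_one_sub.const_mul sqrtIDivPi) ?_
  filter_upwards [eventually_ellipticE_xFun] with τ h
  exact ⟨h.2.1, by rw [h.2.2.1, periodFun]⟩

theorem exists_fuchsian_snd : ∃ A : ℂ → ℂ, ∀ τ : ℂ, 0 < τ.im →
    HasDerivAt (fun z => yFun z * (z * periodFun z)) (A τ * deriv xFun τ) τ ∧
    HasDerivAt A (1 / 2 * Q1 (xFun τ) * (yFun τ * (τ * periodFun τ)) * deriv xFun τ) τ := by
  refine exists_fuchsian_of_period (fun _ h => differentiableAt_xFun h)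
    (fun _ h => deriv_xFun_ne_zero h) (fun _ h => differentiableAt_yFun h)
    (fun _ h => yFun_ne_zero h) (fun _ h => yFun_sq_eq h)
    (fun _ h => differentiableAt_id.mul (differentiableAt_periodFun h))
    (isPeriodSolution_ellipticE.const_mul (I * sqrtIDivPi)) ?_
  filter_upwards [eventually_ellipticE_xFun] with τ h
  refine ⟨h.2.1, ?_⟩
  rw [h.2.2.2, periodFun]
  linear_combination τ * sqrtIDivPi * (π / 2 * theta3 τ ^ 2) * I_sq

/-- Inversion exchanges `x` and `w`, so `y(-1/τ)` is a root of `w⁵ - w`, and `K'(x²)` becomes the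
integral with parameter `w⁴`. The factor `-i` makes the square of the solution equal to `w'`. -/
theorem exists_fuchsian_wFun : ∃ A : ℂ → ℂ, ∀ τ : ℂ, 0 < τ.im →
    HasDerivAt (fun z => yFun (-1 / z) * (-I * periodFun z)) (A τ * deriv wFun τ) τ ∧
    HasDerivAt A (1 / 2 * Q1 (wFun τ) * (yFun (-1 / τ) * (-I * periodFun τ)) * deriv wFun τ) τ := by
  refine exists_fuchsian_of_period (fun _ h => differentiableAt_wFun h)
    (fun _ h => deriv_wFun_ne_zero h)
    (fun τ h => (differentiableAt_yFun (neg_one_div_im_pos h)).comp τ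
      (hasDerivAt_neg_one_div (ne_zero_of_im_pos h)).differentiableAt)
    (fun _ h => yFun_ne_zero (neg_one_div_im_pos h))
    (fun τ h => by rw [yFun_sq_eq (neg_one_div_im_pos h), xFun_neg_one_div h])
    (fun _ h => (differentiableAt_periodFun h).const_mul (-I))
    (isPeriodSolution_ellipticE.const_mul (-I * sqrtIDivPi)) ?_
  filter_upwards [eventually_ellipticE_xFun] with τ ⟨hτ, h1, h2, _⟩
  have hw : wFun τ ^ 4 = 1 - xFun τ ^ 4 := by linear_combination xFun_pow_add_wFun_pow hτ
  refine ⟨?_, ?_⟩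
  · rw [mem_principalDomain_iff] at h1 ⊢
    rw [hw, sub_sub_cancel]
    exact ⟨h1.2, h1.1⟩
  · rw [hw, h2, periodFun]; ring

theorem deriv_wFun_eq_sq {τ : ℂ} (hτ : 0 < τ.im) :
    (yFun (-1 / τ) * (-I * periodFun τ)) ^ 2 = deriv wFun τ := by
  have hpi : (π : ℂ) ≠ 0 := by exact_mod_cast Real.pi_ne_zero
  have h0 := ne_zero_of_im_pos hτ
  rw [deriv_wFun_eq hτ, deriv_xFun_eq (neg_one_div_im_pos hτ), theta3_pow_neg_one_div hτ,
    periodFun, mul_pow, mul_pow, mul_pow, sqrtIDivPi_sq, neg_sq, I_sq]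
  field_simp
  norm_num
  ring

/-! ### Schwarzian derivatives -/

/-- The Schwarzian of a function `f` with `f' = T P²`, where the derivations are taken with
respect to a variable of derivative `P²`. -/
theorem meroDeriv_eq {f T T₁ P A : ℂ → ℂ} {T₂ q t : ℂ}
    (hf : ∀ᶠ z in 𝓝 t, HasDerivAt f (T z * P z ^ 2) z)
    (hT : ∀ᶠ z in 𝓝 t, HasDerivAt T (T₁ z * P z ^ 2) z)
    (hP : ∀ᶠ z in 𝓝 t, HasDerivAt P (A z * P z ^ 2) z)
    (hT₁ : HasDerivAt T₁ (T₂ * P t ^ 2) t) (hA : HasDerivAt A (1 / 2 * q * P t * P t ^ 2) t)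
    (hT0 : T t ≠ 0) (hP0 : P t ≠ 0) :
    meroDeriv f t = (T₂ / T t - 3 / 2 * (T₁ t / T t) ^ 2 + q) / T t ^ 2 := by
  have d1 : deriv f =ᶠ[𝓝 t] fun z => T z * P z ^ 2 := hf.mono fun z h => h.deriv
  have d2 : deriv (deriv f) =ᶠ[𝓝 t] fun z => T₁ z * P z ^ 4 + 2 * T z * A z * P z ^ 3 := by
    filter_upwards [d1.eventually_nhds, hT, hP] with z h1 h2 h3
    rw [Filter.EventuallyEq.deriv_eq h1]
    refine ((h2.mul (h3.pow 2)).congr_deriv ?_).deriv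
    simp only [Pi.pow_apply]
    push_cast
    ring
  have hTt := hT.self_of_nhds
  have hPt := hP.self_of_nhds
  have d3 : deriv (deriv (deriv f)) t = T₂ * P t ^ 6 + 6 * T₁ t * A t * P t ^ 5 +
      T t * q * P t ^ 6 + 6 * T t * A t ^ 2 * P t ^ 4 := by
    rw [d2.deriv_eq]
    refine (((hT₁.mul (hPt.pow 4)).add
      (((hTt.const_mul 2).mul hA).mul (hPt.pow 3))).congr_deriv ?_).deriv
    simp only [Pi.pow_apply, Pi.mul_apply]
    push_cast
    ring
  rw [meroDeriv, schwarzian, show iteratedDeriv 3 f t = deriv (deriv (deriv f)) t by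
    simp [iteratedDeriv_succ], show iteratedDeriv 2 f t = deriv (deriv f) t by
    simp [iteratedDeriv_succ], d3, d2.self_of_nhds, d1.self_of_nhds]
  simp only
  field_simp
  ring

theorem meroDeriv_xFun {τ : ℂ} (hτ : 0 < τ.im) : meroDeriv xFun τ = Q1 (xFun τ) := by
  obtain ⟨A, hA⟩ := exists_fuchsian_fst
  have hnhds := isOpen_im_pos.mem_nhds hτ
  have hP0 : yFun τ * periodFun τ ≠ 0 := fun h => deriv_xFun_ne_zero hτ (by
    rw [← yFun_mul_periodFun_sq hτ, h]; simp)
  have := meroDeriv_eq (f := xFun) (T := fun _ => 1) (T₁ := fun _ => 0)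
    (P := fun z => yFun z * periodFun z) (A := A) (T₂ := 0) (q := Q1 (xFun τ)) (t := τ)
    (by
      filter_upwards [hnhds] with z hz
      rw [yFun_mul_periodFun_sq hz, one_mul]
      exact (differentiableAt_xFun hz).hasDerivAt)
    (by
      filter_upwards with z
      rw [zero_mul]
      exact hasDerivAt_const z 1)
    (by
      filter_upwards [hnhds] with z hz
      rw [yFun_mul_periodFun_sq hz]
      exact (hA z hz).1)
    (by rw [zero_mul]; exact hasDerivAt_const τ 0)
    (by rw [yFun_mul_periodFun_sq hτ]; exact (hA τ hτ).2) one_ne_zero hP0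
  rw [this]
  simp

theorem meroDeriv_wFun {τ : ℂ} (hτ : 0 < τ.im) : meroDeriv wFun τ = Q1 (wFun τ) := by
  obtain ⟨A, hA⟩ := exists_fuchsian_wFun
  have hnhds := isOpen_im_pos.mem_nhds hτ
  have hP0 : yFun (-1 / τ) * (-I * periodFun τ) ≠ 0 := fun h => deriv_wFun_ne_zero hτ (by
    rw [← deriv_wFun_eq_sq hτ, h]; simp)
  have := meroDeriv_eq (f := wFun) (T := fun _ => 1) (T₁ := fun _ => 0)
    (P := fun z => yFun (-1 / z) * (-I * periodFun z)) (A := A) (T₂ := 0) (q := Q1 (wFun τ)) (t := τ)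
    (by
      filter_upwards [hnhds] with z hz
      rw [deriv_wFun_eq_sq hz, one_mul]
      exact (differentiableAt_wFun hz).hasDerivAt)
    (by
      filter_upwards with z
      rw [zero_mul]
      exact hasDerivAt_const z 1)
    (by
      filter_upwards [hnhds] with z hz
      rw [deriv_wFun_eq_sq hz]
      exact (hA z hz).1)
    (by rw [zero_mul]; exact hasDerivAt_const τ 0)
    (by rw [deriv_wFun_eq_sq hτ]; exact (hA τ hτ).2) one_ne_zero hP0
  rw [this]
  simp

theorem hasDerivAt_yFun {τ : ℂ} (hτ : 0 < τ.im) :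
    HasDerivAt yFun ((5 * xFun τ ^ 4 - 1) / (2 * yFun τ) * deriv xFun τ) τ :=
  hasDerivAt_sqrt_quintic (differentiableAt_xFun hτ).hasDerivAt (differentiableAt_yFun hτ)
    (by filter_upwards [isOpen_im_pos.mem_nhds hτ] with z hz using yFun_sq_eq hz)
    (yFun_ne_zero hτ)

/-- If `5x⁴ = 1`, then `y⁸ = x⁴(x⁴ - 1)⁴ = 2⁸/5⁵`; the displayed cofactor is the quotient of the
polynomial division by `5x⁴ - 1`. -/
theorem five_mul_pow_ne_one {x y : ℂ} (h : y ^ 2 = x ^ 5 - x) (hy : y ^ 8 ≠ 2 ^ 8 / 5 ^ 5) :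
    5 * x ^ 4 - 1 ≠ 0 := fun h0 => hy (by
  have e : y ^ 8 = (x ^ 5 - x) ^ 4 := by rw [← h]; ring
  rw [e]
  linear_combination (x ^ 16 / 5 - 19 / 25 * x ^ 12 + 131 / 125 * x ^ 8 - 369 / 625 * x ^ 4
    + 256 / 3125) * h0)

/-- The rational identity behind the equation of `y`. -/
theorem Q2_identity {x y : ℂ} (h : y ^ 2 = x ^ 5 - x) (hy0 : y ≠ 0)
    (hy : y ^ 8 ≠ 2 ^ 8 / 5 ^ 5) :
    ((240 * x ^ 2 * y ^ 4 - 3 * (5 * x ^ 4 - 1) * (40 * x ^ 3 * y ^ 2 - (5 * x ^ 4 - 1) ^ 2)) /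
        (8 * y ^ 5) / ((5 * x ^ 4 - 1) / (2 * y)) -
      3 / 2 * ((40 * x ^ 3 * y ^ 2 - (5 * x ^ 4 - 1) ^ 2) / (4 * y ^ 3) /
        ((5 * x ^ 4 - 1) / (2 * y))) ^ 2 + Q1 x) / ((5 * x ^ 4 - 1) / (2 * y)) ^ 2 = Q2 x y := by
  have hq := five_mul_pow_ne_one h hy
  have hd : y ^ 8 - 2 ^ 8 / 5 ^ 5 ≠ 0 := sub_ne_zero.mpr hy
  have hlhs : ((240 * x ^ 2 * y ^ 4 - 3 * (5 * x ^ 4 - 1) *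
        (40 * x ^ 3 * y ^ 2 - (5 * x ^ 4 - 1) ^ 2)) /
        (8 * y ^ 5) / ((5 * x ^ 4 - 1) / (2 * y)) -
      3 / 2 * ((40 * x ^ 3 * y ^ 2 - (5 * x ^ 4 - 1) ^ 2) / (4 * y ^ 3) /
        ((5 * x ^ 4 - 1) / (2 * y))) ^ 2 + Q1 x) / ((5 * x ^ 4 - 1) / (2 * y)) ^ 2 =
      (480 * x ^ 2 * (y ^ 2) ^ 2 * (5 * x ^ 4 - 1) - 4800 * x ^ 6 * (y ^ 2) ^ 2 +
        3 * (5 * x ^ 4 - 1) ^ 4 - 4 * (5 * x ^ 4 - 1) ^ 2 * (x ^ 8 + 14 * x ^ 4 + 1)) /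
      (2 * y ^ 2 * (5 * x ^ 4 - 1) ^ 4) := by
    rw [Q1_eq_of_sq h]
    generalize 5 * x ^ 4 - 1 = q at *
    field_simp
    ring
  have hN : (y ^ 16 - 192 / 5 ^ 3 * x * y ^ 14 + 576 / 5 ^ 4 * x ^ 2 * y ^ 12
      + 1536 / 5 ^ 5 * x ^ 3 * y ^ 10 - 6144 / 5 ^ 5 * x ^ 4 * y ^ 8 + 46592 / 5 ^ 6 * y ^ 8
      - 196608 / 5 ^ 8 * x * y ^ 6 + 344064 / 5 ^ 9 * x ^ 2 * y ^ 4
      - 393216 / 5 ^ 10 * x ^ 3 * y ^ 2 + 2 ^ 16 / 5 ^ 10) * (5 * x ^ 4 - 1) ^ 4 +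
      (480 * x ^ 2 * (y ^ 2) ^ 2 * (5 * x ^ 4 - 1) - 4800 * x ^ 6 * (y ^ 2) ^ 2 +
        3 * (5 * x ^ 4 - 1) ^ 4 - 4 * (5 * x ^ 4 - 1) ^ 2 * (x ^ 8 + 14 * x ^ 4 + 1)) *
      (y ^ 8 - 2 ^ 8 / 5 ^ 5) ^ 2 = 0 := by
    rw [show y ^ 16 = (y ^ 2) ^ 8 by ring, show y ^ 14 = (y ^ 2) ^ 7 by ring,
      show y ^ 12 = (y ^ 2) ^ 6 by ring, show y ^ 10 = (y ^ 2) ^ 5 by ring,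
      show y ^ 8 = (y ^ 2) ^ 4 by ring, show y ^ 6 = (y ^ 2) ^ 3 by ring,
      show y ^ 4 = (y ^ 2) ^ 2 by ring, h]
    ring
  rw [hlhs, Q2]
  rw [← mul_div_assoc, div_eq_div_iff (mul_ne_zero (mul_ne_zero two_ne_zero (pow_ne_zero 2 hy0))
    (pow_ne_zero 4 hq)) (mul_ne_zero (pow_ne_zero 2 hy0) (pow_ne_zero 2 hd))]
  linear_combination y ^ 2 * hN

theorem meroDeriv_yFun {τ : ℂ} (hτ : 0 < τ.im) (hy : yFun τ ^ 8 ≠ 2 ^ 8 / 5 ^ 5) :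
    deriv yFun τ ≠ 0 ∧ meroDeriv yFun τ = Q2 (xFun τ) (yFun τ) := by
  obtain ⟨A, hA⟩ := exists_fuchsian_fst
  have hnhds := isOpen_im_pos.mem_nhds hτ
  have hy0 := yFun_ne_zero hτ
  have hq := five_mul_pow_ne_one (yFun_sq_eq hτ) hy
  have hT0 : (5 * xFun τ ^ 4 - 1) / (2 * yFun τ) ≠ 0 :=
    div_ne_zero hq (mul_ne_zero two_ne_zero hy0)
  refine ⟨by rw [(hasDerivAt_yFun hτ).deriv]; exact mul_ne_zero hT0 (deriv_xFun_ne_zero hτ), ?_⟩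
  have hP0 : yFun τ * periodFun τ ≠ 0 := fun h => deriv_xFun_ne_zero hτ (by
    rw [← yFun_mul_periodFun_sq hτ, h]; simp)
  -- Here `dy/dx = T = (5x⁴ - 1)/(2y)`, and its successive derivatives with respect to `x` are the
  -- data required by `meroDeriv_eq`.
  have hT : ∀ z : ℂ, 0 < z.im → HasDerivAt (fun z => (5 * xFun z ^ 4 - 1) / (2 * yFun z))
      ((40 * xFun z ^ 3 * yFun z ^ 2 - (5 * xFun z ^ 4 - 1) ^ 2) / (4 * yFun z ^ 3) *
        deriv xFun z) z := fun z hz => by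
    have hy0 := yFun_ne_zero hz
    refine ((((differentiableAt_xFun hz).hasDerivAt.fun_pow 4).const_mul 5 |>.sub_const 1).fun_div
      ((hasDerivAt_yFun hz).const_mul 2) (mul_ne_zero two_ne_zero hy0)).congr_deriv ?_
    push_cast
    field_simp
    ring
  have hT₁ : HasDerivAt (fun z => (40 * xFun z ^ 3 * yFun z ^ 2 - (5 * xFun z ^ 4 - 1) ^ 2) /
      (4 * yFun z ^ 3)) ((240 * xFun τ ^ 2 * yFun τ ^ 4 - 3 * (5 * xFun τ ^ 4 - 1) *
        (40 * xFun τ ^ 3 * yFun τ ^ 2 - (5 * xFun τ ^ 4 - 1) ^ 2)) / (8 * yFun τ ^ 5) *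
        deriv xFun τ) τ := by
    have hx := (differentiableAt_xFun hτ).hasDerivAt
    have hy := hasDerivAt_yFun hτ
    refine (((((hx.fun_pow 3).const_mul 40).fun_mul (hy.fun_pow 2)).fun_sub
      ((((hx.fun_pow 4).const_mul 5).sub_const 1).fun_pow 2)).fun_div
      ((hy.fun_pow 3).const_mul 4) (mul_ne_zero (by norm_num) (pow_ne_zero 3 hy0))).congr_deriv ?_
    push_cast
    field_simp
    ring
  have hsq : ∀ z : ℂ, 0 < z.im → (yFun z * periodFun z) ^ 2 = deriv xFun z := fun _ hz =>
    yFun_mul_periodFun_sq hz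
  have := meroDeriv_eq (f := yFun) (T := fun z => (5 * xFun z ^ 4 - 1) / (2 * yFun z))
    (T₁ := fun z => (40 * xFun z ^ 3 * yFun z ^ 2 - (5 * xFun z ^ 4 - 1) ^ 2) / (4 * yFun z ^ 3))
    (P := fun z => yFun z * periodFun z) (A := A) (q := Q1 (xFun τ)) (t := τ)
    (by filter_upwards [hnhds] with z hz; rw [hsq z hz]; exact hasDerivAt_yFun hz)
    (by filter_upwards [hnhds] with z hz; rw [hsq z hz]; exact hT z hz)
    (by filter_upwards [hnhds] with z hz; rw [hsq z hz]; exact (hA z hz).1)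
    (by rw [hsq τ hτ]; exact hT₁)
    (by rw [hsq τ hτ]; exact (hA τ hτ).2) hT0 hP0
  rw [this]
  exact Q2_identity (yFun_sq_eq hτ) hy0 hy

/-! ### The fundamental domain of `Γ(2)` -/

/-- The open fundamental domain of `Γ(2)`, as a subset of the complex plane. -/
def gammaTwoRegion : Set ℂ := {τ | 0 < τ.im ∧ |τ.re| < 1 ∧ |τ.re| < normSq τ}

theorem half_lt_norm_sub_half_iff {τ : ℂ} : 1 / 2 < ‖τ - 1 / 2‖ ↔ τ.re < normSq τ := by
  rw [← sq_lt_sq₀ (by norm_num) (norm_nonneg _), ← Complex.normSq_eq_norm_sq, normSq_apply,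
    normSq_apply]
  have : (τ - 1 / 2).re = τ.re - 1 / 2 := by norm_num
  have h' : (τ - 1 / 2).im = τ.im := by norm_num
  rw [this, h']
  constructor <;> intro h <;> nlinarith

theorem half_lt_norm_add_half_iff {τ : ℂ} : 1 / 2 < ‖τ + 1 / 2‖ ↔ -τ.re < normSq τ := by
  have h1 := half_lt_norm_sub_half_iff (τ := -τ)
  rw [normSq_neg, neg_re, ← norm_neg] at h1
  rw [← h1, show -(-τ - 1 / 2) = τ + 1 / 2 by ring]

theorem mem_gammaTwoDomain_iff {τ : ℍ} : τ ∈ gammaTwoDomain ↔ (τ : ℂ) ∈ gammaTwoRegion := by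
  change (|τ.re| < 1 ∧ 1 / 2 < ‖(τ : ℂ) - 1 / 2‖ ∧ 1 / 2 < ‖(τ : ℂ) + 1 / 2‖) ↔
    (0 < (τ : ℂ).im ∧ |(τ : ℂ).re| < 1 ∧ |(τ : ℂ).re| < normSq τ)
  rw [half_lt_norm_sub_half_iff, half_lt_norm_add_half_iff, abs_lt (a := (τ : ℂ).re)
    (b := normSq τ), neg_lt]
  have h := τ.im_pos
  constructor
  · rintro ⟨h1, h2, h3⟩; exact ⟨h, h1, h3, h2⟩
  · rintro ⟨-, h1, h3, h2⟩; exact ⟨h1, h2, h3⟩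

theorem isOpen_gammaTwoRegion : IsOpen gammaTwoRegion := by
  exact (isOpen_lt continuous_const continuous_im).inter
    ((isOpen_lt continuous_re.abs continuous_const).inter
      (isOpen_lt continuous_re.abs continuous_normSq))

/-- A vertical segment of length `2` stays in the region and ends in a convex strip contained in it.
-/
theorem isPreconnected_gammaTwoRegion : IsPreconnected gammaTwoRegion := by
  set strip : Set ℂ := {τ | -1 < τ.re} ∩ {τ | τ.re < 1} ∩ {τ | 1 < τ.im} with hstrip
  have hconv : Convex ℝ strip :=
    ((convex_halfSpace_re_gt (-1)).inter (convex_halfSpace_re_lt 1)).inter (convex_halfSpace_im_gt 1)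
  have hsub : strip ⊆ gammaTwoRegion := by
    rintro τ ⟨⟨h1, h2⟩, h3⟩
    have h1 : -1 < τ.re := h1
    have h2 : τ.re < 1 := h2
    have h3 : 1 < τ.im := h3
    have h4 := abs_lt.mpr ⟨h1, h2⟩
    refine ⟨by linarith, h4, ?_⟩
    rw [normSq_apply]
    nlinarith [mul_self_nonneg τ.re]
  refine isPreconnected_of_forall (2 * I) fun τ hτ => ⟨segment ℝ τ (τ + 2 * I) ∪ strip, ?_, ?_, ?_, ?_⟩
  · refine Set.union_subset ?_ hsub
    rintro _ ⟨a, b, ha, hb, hab, rfl⟩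
    obtain ⟨h1, h2, h3⟩ := hτ
    have hre : (a • τ + b • (τ + 2 * I)).re = τ.re := by
      simp; linear_combination τ.re * hab
    have him : (a • τ + b • (τ + 2 * I)).im = τ.im + 2 * b := by
      simp; linear_combination τ.im * hab
    refine ⟨by rw [him]; positivity, by rw [hre]; exact h2, ?_⟩
    rw [normSq_apply] at h3
    rw [normSq_apply, hre, him]
    nlinarith [mul_nonneg hb h1.le, mul_nonneg hb hb]
  · exact Or.inr ⟨⟨by norm_num, by norm_num⟩, by norm_num⟩
  · exact Or.inl (left_mem_segment ℝ _ _)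
  · refine IsPreconnected.union (τ + 2 * I) (right_mem_segment ℝ _ _) ?_
      (convex_segment _ _).isPreconnected hconv.isPreconnected
    obtain ⟨h1, h2, -⟩ := hτ
    obtain ⟨h2, h3⟩ := abs_lt.mp h2
    refine ⟨⟨?_, ?_⟩, ?_⟩
    · change -1 < (τ + 2 * I).re; simpa using h2
    · change (τ + 2 * I).re < 1; simpa using h3
    · change 1 < (τ + 2 * I).im; simp; linarith

theorem I_mem_gammaTwoRegion : I ∈ gammaTwoRegion := by
  refine ⟨by simp, by simp, by simp⟩

/-- Inversion interchanges the conditions `|Re τ| < 1` and `|Re τ| < |τ|²`. -/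
theorem neg_one_div_mem_gammaTwoRegion {τ : ℂ} (hτ : τ ∈ gammaTwoRegion) :
    -1 / τ ∈ gammaTwoRegion := by
  obtain ⟨h1, h2, h3⟩ := hτ
  have hN : 0 < normSq τ := lt_of_le_of_lt (abs_nonneg _) h3
  have hre : (-1 / τ).re = -(τ.re / normSq τ) := by
    rw [div_re]; simp
    ring
  have hn : normSq (-1 / τ) = 1 / normSq τ := by rw [normSq_div]; simp
  refine ⟨neg_one_div_im_pos h1, ?_, ?_⟩
  · rw [hre, abs_neg, abs_div, abs_of_pos hN, div_lt_one hN]; exact h3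
  · rw [hre, hn, abs_neg, abs_div, abs_of_pos hN]
    exact div_lt_div_of_pos_right h2 hN

/-- The `Γ(2)`-images of the line `Re τ = 1` do not meet the fundamental domain. -/
theorem re_smul_ne_one {τ : ℍ} (hτ : (τ : ℂ) ∈ gammaTwoRegion) {γ : SL(2, ℤ)}
    (hγ : γ ∈ CongruenceSubgroup.Gamma 2) : ((γ • τ : ℍ) : ℂ).re ≠ 1 := by
  intro hre
  obtain ⟨-, h2, h3⟩ := hτ
  obtain ⟨ha, hb, hc, hd⟩ := CongruenceSubgroup.Gamma_mem.mp hγ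
  have odd : ∀ a : ℤ, (a : ZMod 2) = 1 → ¬ 2 ∣ a := fun a h h' => by
    rw [(ZMod.intCast_zmod_eq_zero_iff_dvd a 2).mpr h'] at h
    exact absurd h (by decide)
  have hdet := det_eq γ
  have hd2 := odd _ hd
  have hb2 : ¬ 2 ∣ γ 0 1 - γ 1 1 := odd _ (by push_cast; rw [hb, hd]; decide)
  have hc2 : (2 : ℤ) ∣ γ 1 0 := (ZMod.intCast_zmod_eq_zero_iff_dvd _ 2).mp hc
  have hden := SL2Z_denom_ne_zero γ τ
  have hmul := coe_SL2Z_smul γ τ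
  set g := ((γ • τ : ℍ) : ℂ)
  rw [eq_div_iff hden] at hmul
  generalize γ 0 0 = a at *
  generalize γ 0 1 = b at *
  generalize γ 1 0 = c at *
  generalize γ 1 1 = d at *
  have e1 := congrArg Complex.re hmul
  have e2 := congrArg Complex.im hmul
  simp only [mul_re, mul_im, add_re, add_im, intCast_re, intCast_im, zero_mul, sub_zero, add_zero,
    hre, one_mul] at e1 e2
  set X := (τ : ℂ).re
  set Y := (τ : ℂ).im
  have hNdef : normSq (τ : ℂ) = X * X + Y * Y := normSq_apply _
  -- The preimage of `Re = 1` is the curve `p|τ|² + s Re τ + q = 0` with integers satisfying `s² = 1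
  -- + 4pq`.
  have heq : ((c * (a - c) : ℤ) : ℝ) * normSq (τ : ℂ) +
      (((a - c) * d + (b - d) * c : ℤ) : ℝ) * X + ((d * (b - d) : ℤ) : ℝ) = 0 := by
    rw [hNdef]
    push_cast
    linear_combination (-(c * X + d) : ℝ) * e1 - (c * Y : ℝ) * e2
  have hs : ((a - c) * d + (b - d) * c) ^ 2 = 1 + 4 * ((c * (a - c)) * (d * (b - d))) := by
    have : (a - c) * d - (b - d) * c = 1 := by linear_combination hdet
    linear_combination ((a - c) * d - (b - d) * c + 1) * this
  have hd0 : d ≠ 0 := fun h => hd2 (by rw [h]; exact dvd_zero _)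
  have hb0 : b - d ≠ 0 := fun h => hb2 (by rw [h]; exact dvd_zero _)
  rcases eq_or_ne c 0 with hc0 | hc0
  · rw [hc0] at heq hdet
    have had : a * d = 1 := by linear_combination hdet
    have hX : X = -((d * (b - d) : ℤ) : ℝ) := by
      have : ((a * d : ℤ) : ℝ) = 1 := by exact_mod_cast had
      push_cast at this heq ⊢
      linear_combination heq - X * this
    rw [hX, abs_neg, ← Int.cast_abs] at h2
    have : |d * (b - d)| < 1 := by exact_mod_cast h2
    exact (Int.abs_lt_one_iff.not.mpr (mul_ne_zero hd0 hb0)) this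
  · have hk : (c * (a - c)) * (d * (b - d)) = ((b - d) * c) * ((b - d) * c + 1) := by
      linear_combination ((b - d) * c) * hdet
    have hk0 : (b - d) * c ≠ 0 := mul_ne_zero hb0 hc0
    -- As `c` is even, `k = (b - d)c` is not `-1`; it is not `0` either, so `pq = k(k + 1)` is
    -- positive.
    have hk1 : (b - d) * c + 1 ≠ 0 := by
      intro h
      obtain ⟨e, he⟩ := hc2
      have : 2 * ((b - d) * e) = -1 := by rw [he] at h; linear_combination h
      omega
    have hpq : 0 < (c * (a - c)) * (d * (b - d)) := by
      rw [hk]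
      rcases lt_trichotomy ((b - d) * c) 0 with h | h | h
      · exact mul_pos_of_neg_of_neg h (by omega)
      · exact absurd h hk0
      · exact mul_pos h (by omega)
    generalize c * (a - c) = p at *
    generalize d * (b - d) = q at *
    generalize (a - c) * d + (b - d) * c = s at *
    -- The bounds `|X| < 1` and `|X| < |τ|²` give `p + q < |s|`, so `(p + q + 1)² ≤ 1 + 4pq`,
    -- impossible for positive `p, q`.
    have main : ∀ p q s : ℤ, 0 < p → 0 < q → s ^ 2 = 1 + 4 * (p * q) →
        (p : ℝ) * normSq (τ : ℂ) + s * X + q = 0 → False := by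
      intro p q s hp hq hs heq
      have hp' : (0 : ℝ) < p := by exact_mod_cast hp
      have hq' : (0 : ℝ) < q := by exact_mod_cast hq
      have h4 : (p : ℝ) * |X| + q < |(s : ℝ)| * |X| := by
        rw [← abs_mul]
        have := neg_abs_le ((s : ℝ) * X)
        nlinarith
      have h5 : (p : ℝ) + q < |(s : ℝ)| := by
        have h6 : 0 < (|(s : ℝ)| - p) * |X| := by nlinarith
        have h7 : 0 < |(s : ℝ)| - p := pos_of_mul_pos_left h6 (abs_nonneg X)
        nlinarith
      have h6 : p + q < |s| := by exact_mod_cast h5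
      have h7 : (p + q + 1) ^ 2 ≤ |s| ^ 2 := pow_le_pow_left₀ (by omega) (by omega) 2
      rw [sq_abs, hs] at h7
      nlinarith [sq_nonneg (p - q)]
    rcases pos_and_pos_or_neg_and_neg_of_mul_pos hpq with ⟨hp, hq⟩ | ⟨hp, hq⟩
    · exact main p q s hp hq hs heq
    · refine main (-p) (-q) (-s) (by omega) (by omega) (by rw [neg_sq, hs]; ring) ?_
      push_cast
      linear_combination -heq

/-- Intermediate value theorem: on the imaginary axis `x⁴` is real, tends to `1` at infinity, and
becomes `1 - x⁴` under `t ↦ 1/t`. -/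
theorem exists_xFun_pow_imag {r : ℝ} (h0 : 0 < r) (h1 : r < 1) :
    ∃ t : ℝ, 0 < t ∧ xFun (t * I) ^ 4 = r := by
  choose a ha using fun t => (theta3_theta4_real t).1
  choose b hb using fun t => (theta3_theta4_real t).2
  set f : ℝ → ℝ := fun t => (b t / a t) ^ 4 with hf
  have hx : ∀ t : ℝ, xFun (t * I) ^ 4 = ((f t : ℝ) : ℂ) := fun t => by
    rw [xFun, ha, hb, hf]; push_cast; ring
  have him : ∀ t : ℝ, 0 < t → 0 < ((t : ℂ) * I).im := fun t ht => by simpa using ht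
  have hfre : ∀ t, f t = (xFun (t * I) ^ 4).re := fun t => by rw [hx]; simp
  have hcont : ContinuousOn f (Set.Ioi 0) := by
    intro t ht
    have h1 : ContinuousAt (fun t : ℝ => (xFun (t * I) ^ 4).re) t := by
      have h2 : ContinuousAt xFun ((t : ℂ) * I) := (differentiableAt_xFun (him t ht)).continuousAt
      have h3 : ContinuousAt (fun t : ℝ => (t : ℂ) * I) t := by fun_prop
      exact Complex.continuous_re.continuousAt.comp ((h2.comp_of_eq h3 rfl).pow 4)
    exact (h1.congr (Eventually.of_forall fun t => (hfre t).symm)).continuousWithinAt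
  have hlim : Tendsto f atTop (𝓝 1) := by
    have h2 : Tendsto (fun t : ℝ => (t : ℂ) * I) atTop (comap im atTop) := by
      rw [tendsto_comap_iff]
      exact tendsto_id.congr fun t => by simp
    have h3 := (Complex.continuous_re.tendsto _).comp ((tendsto_xFun.comp h2).pow 4)
    simp only [one_pow, one_re] at h3
    exact h3.congr fun t => (hfre t).symm
  have hinv : ∀ t : ℝ, 0 < t → f t⁻¹ = 1 - f t := fun t ht => by
    have h := xFun_neg_one_div_pow (him t ht)
    have h2 : ((t⁻¹ : ℝ) : ℂ) * I = -1 / (t * I) := by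
      have ht' : (t : ℂ) ≠ 0 := by exact_mod_cast ht.ne'
      push_cast
      field_simp
      linear_combination I_sq
    rw [← h2, hx, hx] at h
    exact_mod_cast h
  obtain ⟨t₁, ht₁, h₁⟩ := ((hlim.eventually_const_lt h1).and (eventually_gt_atTop 0)).exists.imp
    fun t h => And.intro h.2 h.1
  obtain ⟨t₂, ht₂, h₂⟩ := ((hlim.eventually_const_lt (show 1 - r < 1 by linarith)).and
    (eventually_gt_atTop 0)).exists.imp fun t h => And.intro h.2 h.1
  have hmem : r ∈ f '' Set.Ioi 0 :=
    isPreconnected_Ioi.intermediate_value (Set.mem_Ioi.mpr (inv_pos.mpr ht₂)) ht₁ hcont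
      ⟨by rw [hinv t₂ ht₂]; linarith, h₁.le⟩
  obtain ⟨t, ht, h⟩ := hmem
  exact ⟨t, ht, by rw [hx, h]⟩

/-- Since `x(τ + 1) = 1/x(τ)`, the value `r` is already taken on the line `Re τ = 1`. A second
occurrence would be `Γ(2)`-equivalent to that point. -/
theorem xFun_pow_ne_of_one_lt {τ : ℂ} (hτ : τ ∈ gammaTwoRegion) {r : ℝ} (hr : 1 < r) :
    xFun τ ^ 4 ≠ r := by
  intro h
  obtain ⟨t, ht, h1⟩ := exists_xFun_pow_imag (inv_pos.mpr (by linarith)) (inv_lt_one_of_one_lt₀ hr)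
  have him : 0 < ((t : ℂ) * I + 1).im := by simpa using ht
  have h2 : xFun ((⟨τ, hτ.1⟩ : ℍ) : ℂ) ^ 4 = xFun ((⟨t * I + 1, him⟩ : ℍ) : ℂ) ^ 4 := by
    change xFun τ ^ 4 = xFun (t * I + 1) ^ 4
    rw [xFun_add_one, inv_pow, h1, h]
    push_cast
    rw [inv_inv]
  obtain ⟨γ, hγ, h3⟩ := exists_Gamma_two_of_xFun_pow_eq h2
  refine re_smul_ne_one (τ := ⟨τ, hτ.1⟩) hτ hγ ?_
  rw [h3]
  change ((t : ℂ) * I + 1).re = 1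
  simp

theorem xFun_mem_principalDomain {τ : ℂ} (hτ : τ ∈ gammaTwoRegion) :
    xFun τ ∈ principalDomain := by
  rintro ⟨r, hr | hr, h⟩
  · rcases hr.lt_or_eq with hr | rfl
    · refine xFun_pow_ne_of_one_lt (neg_one_div_mem_gammaTwoRegion hτ) (r := 1 - r) (by linarith) ?_
      rw [xFun_neg_one_div_pow hτ.1, h]; push_cast; ring
    · exact pow_ne_zero 4 (xFun_ne_zero hτ.1) (by simpa using h)
  · rcases hr.lt_or_eq with hr | rfl
    · exact xFun_pow_ne_of_one_lt hτ hr h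
    · exact xFun_pow_four_ne_one hτ.1 (by simpa using h)

/-! ### The Legendre relation -/

theorem mem_cutPlane_and_iff {m : ℂ} :
    (m ∈ cutPlane ∧ 1 - m ∈ cutPlane) ↔ m.im ≠ 0 ∨ (0 < m.re ∧ m.re < 1) := by
  simp only [cutPlane, Set.mem_ofPred_eq, mem_slitPlane_iff, sub_re, one_re, sub_im, one_im,
    zero_sub, neg_ne_zero, sub_sub_cancel]
  constructor
  · rintro ⟨h1 | h1, h2 | h2⟩
    · exact Or.inr ⟨h2, by linarith⟩
    · exact Or.inl h2
    · exact Or.inl h1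
    · exact Or.inl h2
  · rintro (h | ⟨h1, h2⟩)
    · exact ⟨Or.inr h, Or.inr h⟩
    · exact ⟨Or.inl (by linarith), Or.inl h1⟩

theorem isPreconnected_twoCutPlane : IsPreconnected {m : ℂ | m ∈ cutPlane ∧ 1 - m ∈ cutPlane} := by
  have hstar : StarConvex ℝ (1 / 2 : ℂ) {m : ℂ | m ∈ cutPlane ∧ 1 - m ∈ cutPlane} := by
    intro m hm a b ha hb hab
    rw [Set.mem_ofPred_eq, mem_cutPlane_and_iff] at hm ⊢
    have hre : (a • (1 / 2 : ℂ) + b • m).re = a / 2 + b * m.re := by simp; ring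
    have him : (a • (1 / 2 : ℂ) + b • m).im = b * m.im := by simp
    rw [hre, him]
    rcases hb.eq_or_lt with rfl | hb
    · right; constructor <;> linarith
    · rcases hm with h | ⟨h1, h2⟩
      · exact Or.inl (mul_ne_zero hb.ne' h)
      · right
        constructor <;> nlinarith
  have hmem : (1 / 2 : ℂ) ∈ {m : ℂ | m ∈ cutPlane ∧ 1 - m ∈ cutPlane} := by
    rw [Set.mem_ofPred_eq, mem_cutPlane_and_iff]; norm_num
  exact (hstar.isPathConnected hmem).isConnected.isPreconnected

/-- At `τ = i` both `x⁴` and `1 - x⁴` equal `1/2`. Differentiating the two theta formulas there and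
subtracting eliminates the unknown derivative of `θ₃²`, and the formula for `x'` does the rest. -/
theorem ellipticE_half_mul : ellipticE (1 / 2) * ellipticE' (1 / 2) = π / 2 := by
  have hI : 0 < I.im := by simp
  have hx4 := xFun_I_pow
  have hhalf : (1 / 2 : ℂ) ∈ cutPlane := by
    have := (mem_principalDomain_iff.mp xFun_I_mem).1
    rwa [hx4] at this
  have hx := (differentiableAt_xFun hI).hasDerivAt
  have hθ := ((differentiableAt_theta3 hI).hasDerivAt.fun_pow 2).const_mul (π / 2 : ℂ)
  generalize (π / 2 : ℂ) * _ = D at hθ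
  have e1 : HasDerivAt (fun τ => ellipticE (1 - xFun τ ^ 4))
      (ellipticE' (1 / 2) * -(4 * xFun I ^ 3 * deriv xFun I)) I := by
    have h1 : HasDerivAt (fun τ => 1 - xFun τ ^ 4) (-(4 * xFun I ^ 3 * deriv xFun I)) I := by
      simpa using (hx.fun_pow 4).const_sub 1
    refine HasDerivAt.comp (h₂ := ellipticE) (h := fun τ => 1 - xFun τ ^ 4) I ?_ h1
    rw [show 1 - xFun I ^ 4 = 1 / 2 by rw [hx4]; norm_num]
    exact hasDerivAt_ellipticE hhalf
  have e2 : HasDerivAt (fun τ => ellipticE (xFun τ ^ 4))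
      (ellipticE' (1 / 2) * (4 * xFun I ^ 3 * deriv xFun I)) I := by
    have h1 : HasDerivAt (fun τ => xFun τ ^ 4) (4 * xFun I ^ 3 * deriv xFun I) I := by
      simpa using hx.fun_pow 4
    refine HasDerivAt.comp (h₂ := ellipticE) (h := fun τ => xFun τ ^ 4) I ?_ h1
    rw [hx4]
    exact hasDerivAt_ellipticE hhalf
  have hev := eventually_ellipticE_xFun
  have u1 := (e1.congr_of_eventuallyEq (f₁ := fun τ => π / 2 * theta3 τ ^ 2)
    (hev.mono fun τ h => h.2.2.1.symm)).unique hθ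
  have u2 := (e2.congr_of_eventuallyEq (f₁ := fun τ => -I * τ * (π / 2 * theta3 τ ^ 2))
    (hev.mono fun τ h => h.2.2.2.symm)).unique
    ((((hasDerivAt_id I).const_mul (-I)).fun_mul hθ))
  have v1 := hev.self_of_nhds.2.2.1
  rw [show 1 - xFun I ^ 4 = 1 / 2 by rw [hx4]; norm_num] at v1
  simp only [id, mul_one] at u2
  rw [← v1] at u2
  have hd := deriv_xFun_eq hI
  rw [yFun_sq_eq hI] at hd
  have hxd : xFun I ^ 3 * deriv xFun I = -(π * I / 16 * theta3 I ^ 4) := by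
    rw [hd]
    linear_combination (π * I / 4 * theta3 I ^ 4 * (xFun I ^ 4 - 1 / 2)) * hx4
  have key : 8 * (xFun I ^ 3 * deriv xFun I) * ellipticE' (1 / 2) = -I * ellipticE (1 / 2) := by
    linear_combination u2 - u1 - D * I_sq
  rw [hxd] at key
  have hpi : (π : ℂ) ≠ 0 := by exact_mod_cast Real.pi_ne_zero
  have h3 := theta3_ne_zero hI
  refine mul_left_cancel₀ (mul_ne_zero (mul_ne_zero hpi I_ne_zero) (pow_ne_zero 4 h3)) ?_
  linear_combination (-2 * ellipticE (1 / 2)) * key + 2 * I * (ellipticE (1 / 2) +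
    π / 2 * theta3 I ^ 2) * v1

/-- The hypergeometric equations at `m` and `1 - m` make the derivative vanish on a domain
star-shaped about `1/2`; the constant is found at `m = 1/2`. -/
theorem legendre_relation {m : ℂ} (h1 : m ∈ cutPlane) (h2 : 1 - m ∈ cutPlane) :
    m * (1 - m) * (ellipticE (1 - m) * ellipticE' m + ellipticE' (1 - m) * ellipticE m) =
      π / 4 := by
  set M : Set ℂ := {m : ℂ | m ∈ cutPlane ∧ 1 - m ∈ cutPlane} with hM
  have hMo : IsOpen M := isOpen_cutPlane.inter
    (isOpen_cutPlane.preimage (by fun_prop : Continuous fun m : ℂ => 1 - m))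
  set L : ℂ → ℂ := fun m =>
    m * (1 - m) * (ellipticE (1 - m) * ellipticE' m + ellipticE' (1 - m) * ellipticE m) with hL
  have hderiv : ∀ m ∈ M, HasDerivAt L 0 m := by
    rintro m ⟨hm1, hm2⟩
    have hs : HasDerivAt (fun m : ℂ => 1 - m) (-1) m := (hasDerivAt_id m).const_sub 1
    have d1 : HasDerivAt (fun m => ellipticE (1 - m)) (ellipticE' (1 - m) * -1) m :=
      HasDerivAt.comp (h₂ := ellipticE) (h := fun m : ℂ => 1 - m) m (hasDerivAt_ellipticE hm2) hs
    have d2 : HasDerivAt (fun m => ellipticE' (1 - m)) (ellipticE'' (1 - m) * -1) m :=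
      HasDerivAt.comp (h₂ := ellipticE') (h := fun m : ℂ => 1 - m) m (hasDerivAt_ellipticE' hm2) hs
    have d3 := hasDerivAt_ellipticE hm1
    have d4 := hasDerivAt_ellipticE' hm1
    refine (((hasDerivAt_id m).fun_mul hs).fun_mul
      ((d1.fun_mul d4).fun_add (d2.fun_mul d3))).congr_deriv ?_
    have o1 := ellipticE_equation hm1
    have o2 := ellipticE_equation hm2
    simp only [id]
    linear_combination ellipticE (1 - m) * o1 - ellipticE m * o2
  have hhalf : (1 / 2 : ℂ) ∈ M := by
    rw [hM, Set.mem_ofPred_eq, mem_cutPlane_and_iff]; norm_num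
  have := hMo.is_const_of_deriv_eq_zero isPreconnected_twoCutPlane
    (fun m hm => (hderiv m hm).differentiableAt.differentiableWithinAt)
    (fun m hm => (hderiv m hm).deriv) (show m ∈ M from ⟨h1, h2⟩) hhalf
  change L m = _
  rw [this, hL]
  simp only
  rw [show (1 : ℂ) - 1 / 2 = 1 / 2 by norm_num]
  linear_combination 1 / 2 * ellipticE_half_mul

/-! ### Solutions of the Fuchsian equation in the variable `x` -/

section BranchSolutions

variable {V : Set ℂ} {s : ℂ → ℂ}

theorem hasDerivAt_branch_mul (hV : IsOpen V) (hVU : V ⊆ principalDomain)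
    (hs : DifferentiableOn ℂ s V) (hsq : ∀ x ∈ V, s x ^ 2 = x ^ 5 - x)
    {F F₁ F₂ : ℂ → ℂ} (hF : IsPeriodSolution principalDomain F F₁ F₂) {x : ℂ} (hx : x ∈ V) :
    HasDerivAt (fun u => s u * F u) (quinticDeriv id s F F₁ x) x ∧
      HasDerivAt (quinticDeriv id s F F₁) (1 / 2 * Q1 x * (s x * F x)) x := by
  have hn := hV.mem_nhds hx
  have h0 : s x ≠ 0 := fun h => quintic_ne_zero (hVU hx) (by rw [← hsq x hx, h]; simp)
  have hev : ∀ᶠ z in 𝓝 x, s z ^ 2 = id z ^ 5 - id z := eventually_of_mem hn hsq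
  obtain ⟨h1, h2, h3⟩ := hF x (hVU hx)
  have hd := hs.differentiableAt hn
  constructor
  · simpa using hasDerivAt_sqrt_quintic_mul (hasDerivAt_id x) hd hev h0
      (h1.congr_deriv (mul_one _).symm)
  · simpa using hasDerivAt_quinticDeriv (hasDerivAt_id x) hd hev h0
      (h1.congr_deriv (mul_one _).symm) (h2.congr_deriv (mul_one _).symm) h3

theorem isFuchsianSolution_branch_mul (hV : IsOpen V) (hVU : V ⊆ principalDomain)
    (hs : DifferentiableOn ℂ s V) (hsq : ∀ x ∈ V, s x ^ 2 = x ^ 5 - x)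
    {F F₁ F₂ : ℂ → ℂ} (hF : IsPeriodSolution principalDomain F F₁ F₂) :
    IsFuchsianSolution V (fun u => s u * F u) := by
  refine ⟨fun x hx => (hasDerivAt_branch_mul hV hVU hs hsq hF hx).1.differentiableAt
    |>.differentiableWithinAt, fun x hx => ?_⟩
  have hev : deriv (fun u => s u * F u) =ᶠ[𝓝 x] quinticDeriv id s F F₁ :=
    eventually_of_mem (hV.mem_nhds hx) fun z hz => (hasDerivAt_branch_mul hV hVU hs hsq hF hz).1.deriv
  rw [hev.deriv_eq]
  exact (hasDerivAt_branch_mul hV hVU hs hsq hF hx).2.deriv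

theorem sqrtIDivPi_mul_ellK' (s : ℂ → ℂ) :
    (fun x => sqrtIDivPi * s x * ellK' (x ^ 2)) =
      fun x => s x * (sqrtIDivPi * ellipticE (1 - x ^ 4)) := by
  funext x
  rw [ellK'_eq, ← pow_mul]
  ring

theorem sqrtIDivPi_mul_ellK (s : ℂ → ℂ) :
    (fun x => I * sqrtIDivPi * s x * ellK (x ^ 2)) =
      fun x => s x * (I * sqrtIDivPi * ellipticE (x ^ 4)) := by
  funext x
  rw [ellK_eq, ← pow_mul]
  ring

theorem isFuchsianSolution_ellK' (hV : IsOpen V) (hVU : V ⊆ principalDomain)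
    (hs : DifferentiableOn ℂ s V) (hsq : ∀ x ∈ V, s x ^ 2 = x ^ 5 - x) :
    IsFuchsianSolution V (fun x => sqrtIDivPi * s x * ellK' (x ^ 2)) := by
  rw [sqrtIDivPi_mul_ellK']
  exact isFuchsianSolution_branch_mul hV hVU hs hsq
    (isPeriodSolution_ellipticE_one_sub.const_mul sqrtIDivPi)

theorem isFuchsianSolution_ellK (hV : IsOpen V) (hVU : V ⊆ principalDomain)
    (hs : DifferentiableOn ℂ s V) (hsq : ∀ x ∈ V, s x ^ 2 = x ^ 5 - x) :
    IsFuchsianSolution V (fun x => I * sqrtIDivPi * s x * ellK (x ^ 2)) := by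
  rw [sqrtIDivPi_mul_ellK]
  exact isFuchsianSolution_branch_mul hV hVU hs hsq
    (isPeriodSolution_ellipticE.const_mul (I * sqrtIDivPi))

/-- The terms with the derivative of `s` cancel. What remains is `s² = x⁵ - x` times the Wronskian
of the two integrals, evaluated by Legendre's relation. -/
theorem wronskian_ellK (hV : IsOpen V) (hVU : V ⊆ principalDomain)
    (hs : DifferentiableOn ℂ s V) (hsq : ∀ x ∈ V, s x ^ 2 = x ^ 5 - x) {x : ℂ} (hx : x ∈ V) :
    (sqrtIDivPi * s x * ellK' (x ^ 2)) *
        deriv (fun u => I * sqrtIDivPi * s u * ellK (u ^ 2)) x -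
      deriv (fun u => sqrtIDivPi * s u * ellK' (u ^ 2)) x *
        (I * sqrtIDivPi * s x * ellK (x ^ 2)) = 1 := by
  have e1 := congrFun (sqrtIDivPi_mul_ellK' s) x
  have e2 := congrFun (sqrtIDivPi_mul_ellK s) x
  beta_reduce at e1 e2
  rw [e1, e2, sqrtIDivPi_mul_ellK', sqrtIDivPi_mul_ellK,
    (hasDerivAt_branch_mul hV hVU hs hsq
      (isPeriodSolution_ellipticE_one_sub.const_mul sqrtIDivPi) hx).1.deriv,
    (hasDerivAt_branch_mul hV hVU hs hsq
      (isPeriodSolution_ellipticE.const_mul (I * sqrtIDivPi)) hx).1.deriv]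
  have hm := mem_principalDomain_iff.mp (hVU hx)
  have hL := legendre_relation hm.1 hm.2
  have hc : I * sqrtIDivPi ^ 2 * π = -1 := by
    rw [sqrtIDivPi_sq]
    field_simp
    exact I_sq
  simp only [quinticDeriv, id_eq]
  linear_combination (4 * I * sqrtIDivPi ^ 2 * x ^ 3 * (ellipticE (1 - x ^ 4) * ellipticE' (x ^ 4) +
    ellipticE' (1 - x ^ 4) * ellipticE (x ^ 4))) * hsq x hx - 4 * I * sqrtIDivPi ^ 2 * hL - hc

end BranchSolutions

/-! ### Continuation along `x = x(τ)` -/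

theorem derivX_derivX_eq {P A q : ℂ → ℂ} (h : ∀ τ : ℂ, 0 < τ.im →
    HasDerivAt P (A τ * deriv xFun τ) τ ∧ HasDerivAt A (q τ * deriv xFun τ) τ) {τ : ℂ}
    (hτ : 0 < τ.im) : derivX (derivX P) τ = q τ := by
  have hev : derivX P =ᶠ[𝓝 τ] A :=
    eventually_of_mem (isOpen_im_pos.mem_nhds hτ) fun z hz => by
      rw [derivX, (h z hz).1.deriv, mul_div_cancel_right₀ _ (deriv_xFun_ne_zero hz)]
  rw [derivX, hev.deriv_eq, (h τ hτ).2.deriv, mul_div_cancel_right₀ _ (deriv_xFun_ne_zero hτ)]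

theorem derivX_derivX_fst {τ : ℂ} (hτ : 0 < τ.im) :
    derivX (derivX fun z => yFun z * periodFun z) τ =
      1 / 2 * Q1 (xFun τ) * (yFun τ * periodFun τ) := by
  obtain ⟨A, hA⟩ := exists_fuchsian_fst
  exact derivX_derivX_eq (q := fun τ => 1 / 2 * Q1 (xFun τ) * (yFun τ * periodFun τ)) hA hτ

theorem derivX_derivX_snd {τ : ℂ} (hτ : 0 < τ.im) :
    derivX (derivX fun z => yFun z * (z * periodFun z)) τ =
      1 / 2 * Q1 (xFun τ) * (yFun τ * (τ * periodFun τ)) := by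
  obtain ⟨A, hA⟩ := exists_fuchsian_snd
  exact derivX_derivX_eq (q := fun τ => 1 / 2 * Q1 (xFun τ) * (yFun τ * (τ * periodFun τ))) hA hτ

theorem periodFun_eq_ellK' {τ : ℂ} (hτ : τ ∈ gammaTwoRegion) :
    yFun τ * periodFun τ = sqrtIDivPi * yFun τ * ellK' (xFun τ ^ 2) := by
  have h := (ellipticE_xFun isOpen_gammaTwoRegion isPreconnected_gammaTwoRegion
    I_mem_gammaTwoRegion (fun _ h => h.1) (fun _ h => xFun_mem_principalDomain h) hτ).1
  rw [ellK'_eq, ← pow_mul, h, periodFun]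
  ring

theorem mul_periodFun_eq_ellK {τ : ℂ} (hτ : τ ∈ gammaTwoRegion) :
    yFun τ * (τ * periodFun τ) = I * sqrtIDivPi * yFun τ * ellK (xFun τ ^ 2) := by
  have h := (ellipticE_xFun isOpen_gammaTwoRegion isPreconnected_gammaTwoRegion
    I_mem_gammaTwoRegion (fun _ h => h.1) (fun _ h => xFun_mem_principalDomain h) hτ).2
  rw [ellK_eq, ← pow_mul, h, periodFun]
  linear_combination (sqrtIDivPi * yFun τ * τ * (π / 2 * theta3 τ ^ 2)) * I_sq

/-! ### Uniformization -/

theorem uniformizes_xFun_yFun : Uniformizes xFun yFun burnsideCurve where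
  holo_fst _ hτ := (differentiableAt_xFun hτ).differentiableWithinAt
  holo_snd _ hτ := (differentiableAt_yFun hτ).differentiableWithinAt
  immersion τ := Or.inl (deriv_xFun_ne_zero τ.2)
  range_eq := range_xFun_yFun
  fibers := fibers_xFun_yFun

theorem uniformizes_xFun_wFun : Uniformizes xFun wFun jacobiCurve where
  holo_fst _ hτ := (differentiableAt_xFun hτ).differentiableWithinAt
  holo_snd _ hτ := (differentiableAt_wFun hτ).differentiableWithinAt
  immersion τ := Or.inl (deriv_xFun_ne_zero τ.2)
  range_eq := range_xFun_wFun
  fibers := fibers_xFun_wFun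

end ThetaUnif

theorem mainTheorem4 :
    -- all quotients are over a zero-free denominator
    (∀ τ : ℍ, theta3 τ ≠ 0) ∧
    -- `x` is Burnside's function after the change `(x, τ) ↦ (-x, 2τ)`
    (∀ τ : ℍ, burnsideChi τ = -xFun ((τ : ℂ) / 2)) ∧
    -- uniformization of both curves
    Uniformizes xFun yFun burnsideCurve ∧
    Uniformizes xFun wFun jacobiCurve ∧
    -- differential equations of `x = z`, `w` and `y`
    (∀ τ : ℍ, deriv xFun τ ≠ 0 ∧ meroDeriv xFun τ = Q1 (xFun τ)) ∧
    (∀ τ : ℍ, deriv wFun τ ≠ 0 ∧ meroDeriv wFun τ = Q1 (wFun τ)) ∧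
    (∀ τ : ℍ, yFun τ ^ 8 ≠ 2 ^ 8 / 5 ^ 5 →
      deriv yFun τ ≠ 0 ∧ meroDeriv yFun τ = Q2 (xFun τ) (yFun τ)) ∧
    -- automorphism groups
    autGroup burnsideChi = gammaFour ∧
    autGroup (fun τ : ℍ => xFun τ) = conjBy dilation gammaFour ∧
    autGroup (fun τ : ℍ => wFun τ) = conjBy (dilation * inversion) gammaFour ∧
    -- solutions of the Fuchsian equation in the variable `x`
    (∀ (V : Set ℂ) (s : ℂ → ℂ), IsOpen V → V ⊆ principalDomain → DifferentiableOn ℂ s V →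
      (∀ x ∈ V, s x ^ 2 = x ^ 5 - x) →
      IsFuchsianSolution V (fun x => sqrtIDivPi * s x * ellK' (x ^ 2)) ∧
      IsFuchsianSolution V (fun x => I * sqrtIDivPi * s x * ellK (x ^ 2)) ∧
      ∀ x ∈ V,
        (sqrtIDivPi * s x * ellK' (x ^ 2)) *
            deriv (fun u => I * sqrtIDivPi * s u * ellK (u ^ 2)) x -
          deriv (fun u => sqrtIDivPi * s u * ellK' (u ^ 2)) x *
            (I * sqrtIDivPi * s x * ellK (x ^ 2)) = 1) ∧
    -- the same solutions, continued along `x = x(τ)`, with their normalization and their ratio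
    (∃ P₁ P₂ : ℂ → ℂ,
      DifferentiableOn ℂ P₁ UpperHalfPlane.upperHalfPlaneSet ∧
      DifferentiableOn ℂ P₂ UpperHalfPlane.upperHalfPlaneSet ∧
      (∀ τ : ℍ, P₁ τ ^ 2 = deriv xFun τ ∧ P₂ τ = τ * P₁ τ ∧
        derivX (derivX P₁) τ = 1 / 2 * Q1 (xFun τ) * P₁ τ ∧
        derivX (derivX P₂) τ = 1 / 2 * Q1 (xFun τ) * P₂ τ) ∧
      ∀ τ ∈ gammaTwoDomain, xFun τ ∈ principalDomain ∧
        P₁ τ = sqrtIDivPi * yFun τ * ellK' (xFun τ ^ 2) ∧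
        P₂ τ = I * sqrtIDivPi * yFun τ * ellK (xFun τ ^ 2)) := by
  refine ⟨fun τ => theta3_ne_zero τ.2, burnsideChi_eq, uniformizes_xFun_yFun,
    uniformizes_xFun_wFun, fun τ => ⟨deriv_xFun_ne_zero τ.2, meroDeriv_xFun τ.2⟩,
    fun τ => ⟨deriv_wFun_ne_zero τ.2, meroDeriv_wFun τ.2⟩, fun τ hy => meroDeriv_yFun τ.2 hy,
    autGroup_burnsideChi, autGroup_xFun, autGroup_wFun,
    fun V s hV hVU hs hsq => ⟨isFuchsianSolution_ellK' hV hVU hs hsq,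
      isFuchsianSolution_ellK hV hVU hs hsq, fun x hx => wronskian_ellK hV hVU hs hsq hx⟩,
    fun τ => yFun τ * periodFun τ, fun τ => yFun τ * (τ * periodFun τ),
    fun τ hτ => ((differentiableAt_yFun hτ).mul
      (differentiableAt_periodFun hτ)).differentiableWithinAt,
    fun τ hτ => ((differentiableAt_yFun hτ).mul
      (differentiableAt_id.mul (differentiableAt_periodFun hτ))).differentiableWithinAt,
    fun τ => ⟨yFun_mul_periodFun_sq τ.2, by ring, derivX_derivX_fst τ.2, derivX_derivX_snd τ.2⟩,
    fun τ hτ => ?_⟩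
  have h := mem_gammaTwoDomain_iff.mp hτ
  exact ⟨xFun_mem_principalDomain h, periodFun_eq_ellK' h, mul_periodFun_eq_ellK h⟩
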